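/- **Setting.** Let $\mathbb P=\mathbb R^2\times(0,\infty)\times\mathbb R$ be the affine Poincaré group, with elements $g=(b,a,\theta)$, product $(b,a,\theta)(b',a',\theta')=(b+a\Lambda_\theta b',aa',\theta+\theta')$, where $\Lambda_\theta=\begin{pmatrix}\cosh\theta&\sinh\theta\\ \sinh\theta&\cosh\theta\end{pmatrix}$, left Haar measure $d\mu=a^{-3}\,db\,da\,d\theta$ and modular function $\Delta(b,a,\theta)=a^{-2}$. Put $\langle x;y\rangle=x_1y_1-x_2y_2$ on $\mathbb R^2$. Let $C_1^1,C_2^1$ be the cones $\{x_1^2>x_2^2,\ \pm x_1>0\}$ and $C_1^2,C_2^2$ the cones $\{x_1^2<x_2^2,\ \pm x_2>0\}$ (upper sign for lower index $1$). On $L^2(C_i^j)$ let $(\pi_i^j(b,a,\theta)\varphi)(x)=a\,e^{i\langle x;b\rangle}\varphi(a\Lambda_{-\theta}x)$, and let $D_i^j$ be the unbounded operator of multiplication by $(2\pi)^{-1}|\langle x;x\rangle|^{1/2}$ with its maximal domain. For $f\in L^2(\mathbb P)$ let $\widehat f(\pi_i^j)$ be the bounded operator on $L^2(C_i^j)$ with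 $\langle\widehat f(\pi_i^j)\varphi,\psi\rangle=\int_{\mathbb P}f(g)\langle\pi_i^j(g)D_i^j\varphi,\psi\rangle\,d\mu(g)$ for all $\varphi$ in the domain of $D_i^j$ and all $\psi\in L^2(C_i^j)$. Write $S_2$ for the Hilbert–Schmidt class. Let $\sigma$ assign to every $g\in\mathbb P$ and $i,j\in\{1,2\}$ a Hilbert–Schmidt operator $\sigma(g,\pi_i^j)$ on $L^2(C_i^j)$ such that $\sum_{i,j}\int_{\mathbb P}\|\sigma(g,\pi_i^j)\|_{S_2}^2\,d\mu(g)<\infty$, the operator $D_i^j\sigma(g,\pi_i^j)$ is everywhere defined, and $g\mapsto\pi_i^j(g)^*D_i^j\sigma(g,\pi_i^j)$ is a weakly continuous map from $\mathbb P$ to the Hilbert space $S_2(L^2(C_i^j))$ for all $i,j$. For $f\in L^2(\mathbb P)$ put $$(T_\sigma f)(g)=\Delta(g)^{-1/2}\sum_{i,j=1}^2\operatorname{Tr}\big[D_i^j\sigma(g,\pi_i^j)\,\widehat f(\pi_i^j)\,\pi_i^j(g)^*\big].$$ For a symbol $\tau\in L^2(\mathbb R^2\times\mathbb R^2)$ the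 Weyl transform $W_\tau$ is the bounded operator on $L^2(\mathbb R^2)$ with $$\langle W_\tau u,v\rangle=\frac1{2\pi}\int_{\mathbb R^2}\int_{\mathbb R^2}\tau(x,\xi)\,W(u,v)(x,\xi)\,dx\,d\xi,\qquad W(u,v)(x,\xi)=\frac1{2\pi}\int_{\mathbb R^2}e^{-i\xi\cdot q}\,u\big(x+\tfrac q2\big)\overline{v\big(x-\tfrac q2\big)}\,dq .$$ Let $\mathcal F^{-1}$ be the unitary inverse Minkowski–Fourier transform on $L^2(\mathbb R^2)$, $(\mathcal F^{-1}u)(x)=\frac1{2\pi}\int e^{-i\langle\xi;x\rangle}u(\xi)\,d\xi$, and let $\mathcal F_1^{-1},\mathcal F_2^{-1}$ denote it acting in the first, respectively second, $\mathbb R^2$-variable. For $g\in\mathbb P$ and $\beta\in L^2(\mathbb P)$ put $$K_{g,\beta}(x,\xi)=\frac{\Delta(g)^{1/2}}{2\pi}\,\frac{|\langle x;x\rangle|^{1/2}}{|\langle\xi;\xi\rangle|}\,(\mathcal F_1^{-1}\beta)(x,c,t)$$ if $x$ and $\xi$ lie in the same cone $C_i^j$, where $c>0$ and $t\in\mathbb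 R$ are the unique numbers with $\xi=c\Lambda_{-t}x$ (so $c=(\langle\xi;\xi\rangle/\langle x;x\rangle)^{1/2}$ and $\cosh t=\langle x;\xi\rangle/(c\langle x;x\rangle)$), and $K_{g,\beta}(x,\xi)=0$ otherwise. Let $(TK)(x,q)=K(x+\frac q2,x-\frac q2)$ and $\tau_{g,\beta}(x,\xi)=(\mathcal F_2^{-1}TK_{g,\beta})(x,\tilde\xi)$ with $\tilde\xi=(-\xi_1,\xi_2)$. **Theorem.** $T_\sigma$ is a Hilbert–Schmidt operator on $L^2(\mathbb P)$ (that is, there is a Hilbert–Schmidt operator $S$ on $L^2(\mathbb P)$ with $Sf=T_\sigma f$ almost everywhere for every $f\in L^2(\mathbb P)$) if and only if there is a weakly continuous map $\alpha:\mathbb P\to L^2(\mathbb P)$ with $\int_{\mathbb P}\|\alpha(g)\|_{L^2(\mathbb P)}^2\,d\mu(g)<\infty$ such that $$D_i^j\sigma(g,\pi_i^j)\,\pi_i^j(g)^*=W_{\tau_{g,\alpha(g)}}\quad\text{on }L^2(C_i^j)\qquad\text{for all }g\in\mathbb P,\ i,j=1,2,$$ where $L^2(C_i^j)$ is regarded as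 a subspace of $L^2(\mathbb R^2)$ through extension by zero. -/

import Mathlib

open MeasureTheory
open scoped ENNReal InnerProductSpace SchwartzMap ComplexConjugate

set_option linter.unusedSimpArgs false

noncomputable section

namespace AffPoincare

/-! ### Hilbert–Schmidt operators and the trace -/

section HilbertSchmidt

variable (H : Type*) [NormedAddCommGroup H] [InnerProductSpace ℂ H] [CompleteSpace H]

/-- The index set of a fixed orthonormal basis of `H`. -/
def onbIndex : Set H := (exists_hilbertBasis ℂ H).choose

/-- A fixed orthonormal basis of `H`. The notions below do not depend on which one is taken. -/
def onb : HilbertBasis (onbIndex H) ℂ H := (exists_hilbertBasis ℂ H).choose_spec.choose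

variable {H}

/-- The squared Hilbert–Schmidt norm `∑ₙ ‖A eₙ‖²`, with value `∞` allowed. -/
def hsNormSq (A : H →L[ℂ] H) : ℝ≥0∞ := ∑' n, ‖A (onb H n)‖ₑ ^ 2

/-- `A` belongs to the Hilbert–Schmidt class `S₂`. -/
def IsHilbertSchmidt (A : H →L[ℂ] H) : Prop := hsNormSq A < ∞

/-- The trace `∑ₙ ⟨A eₙ, eₙ⟩`. -/
def opTrace (A : H →L[ℂ] H) : ℂ := ∑' n, ⟪onb H n, A (onb H n)⟫_ℂ

/-- Weak continuity of a map into the Hilbert space `S₂`, whose inner product is `Tr (A B*)`. -/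
def WeaklyContinuousS2 {X : Type*} [TopologicalSpace X] (F : X → (H →L[ℂ] H)) : Prop :=
  (∀ x, IsHilbertSchmidt (F x)) ∧
    ∀ B : H →L[ℂ] H, IsHilbertSchmidt B →
      Continuous fun x => opTrace (F x ∘L ContinuousLinearMap.adjoint B)

/-- Weak continuity of a map into a Hilbert space. -/
def WeaklyContinuous {X : Type*} [TopologicalSpace X] (F : X → H) : Prop :=
  ∀ h : H, Continuous fun x => ⟪h, F x⟫_ℂ

end HilbertSchmidt

/-! ### The plane, the Minkowski form, the cones and the group -/

abbrev Plane : Type := EuclideanSpace ℝ (Fin 2)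

/-- The Minkowski inner product `⟨x; y⟩ = x₁ y₁ - x₂ y₂`. -/
def mink (x y : Plane) : ℝ := x 0 * y 0 - x 1 * y 1

/-- The hyperbolic rotation `Λ_θ`. -/
def hypRot (θ : ℝ) : Plane →ₗ[ℝ] Plane :=
  Matrix.toEuclideanLin !![Real.cosh θ, Real.sinh θ; Real.sinh θ, Real.cosh θ]

/-- The four open cones: `cone (i, j)` is `C_{i+1}^{j+1}`, with the first coordinate dominating
for `j = 0` and the second one for `j = 1`, and the dominating coordinate positive for `i = 0`
and negative for `i = 1`. -/
def cone : Fin 2 × Fin 2 → Set Plane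
  | (0, 0) => {x | x 1 ^ 2 < x 0 ^ 2 ∧ 0 < x 0}
  | (1, 0) => {x | x 1 ^ 2 < x 0 ^ 2 ∧ x 0 < 0}
  | (0, 1) => {x | x 0 ^ 2 < x 1 ^ 2 ∧ 0 < x 1}
  | (1, 1) => {x | x 0 ^ 2 < x 1 ^ 2 ∧ x 1 < 0}

/-- The parameters `(a, θ)` with `a > 0` and `θ` real. -/
abbrev DilRot : Type := Set.Ioi (0 : ℝ) × ℝ

/-- The affine Poincaré group as a space: the triples `(b, a, θ)`. -/
abbrev PGroup : Type := Plane × DilRot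

/-- The measure `da dθ / a³`. -/
def dilRotMeasure : Measure DilRot :=
  (((volume : Measure ℝ).comap ((↑) : Set.Ioi (0 : ℝ) → ℝ)).prod
    (volume : Measure ℝ)).withDensity fun y => ENNReal.ofReal (1 / (y.1 : ℝ) ^ 3)

/-- The left Haar measure `db da dθ / a³`. -/
def haar : Measure PGroup := (volume : Measure Plane).prod dilRotMeasure

/-- The modular function `Δ (b, a, θ) = a⁻²`. -/
def modular (g : PGroup) : ℝ := 1 / (g.2.1 : ℝ) ^ 2

abbrev L2Group : Type := Lp ℂ 2 haar

abbrev L2Cone (i : Fin 2 × Fin 2) : Type := Lp ℂ 2 ((volume : Measure Plane).restrict (cone i))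

abbrev L2Plane : Type := Lp ℂ 2 (volume : Measure Plane)

/-! ### The representations -/

/-- The point `a Λ_{-θ} x`. -/
def dilRotMap (y : DilRot) : Plane →ₗ[ℝ] Plane := (y.1 : ℝ) • hypRot (-y.2)

lemma hypRot_apply_zero (θ : ℝ) (x : Plane) :
    hypRot θ x 0 = Real.cosh θ * x 0 + Real.sinh θ * x 1 := by
  simp [hypRot, Matrix.toEuclideanLin, Matrix.toLpLin, dotProduct, Fin.sum_univ_two]

lemma hypRot_apply_one (θ : ℝ) (x : Plane) :
    hypRot θ x 1 = Real.sinh θ * x 0 + Real.cosh θ * x 1 := by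
  simp [hypRot, Matrix.toEuclideanLin, Matrix.toLpLin, dotProduct, Fin.sum_univ_two]

/-- The function `x ↦ a e^{i⟨x; b⟩} φ (a Λ_{-θ} x)`. -/
def repFun (g : PGroup) (φ : Plane → ℂ) (x : Plane) : ℂ :=
  (g.2.1 : ℝ) * Complex.exp (Complex.I * mink x g.1) * φ (dilRotMap g.2 x)

lemma det_dilRotMap (y : DilRot) : LinearMap.det (dilRotMap y) = (y.1 : ℝ) ^ 2 := by
  have h : LinearMap.det (hypRot (-y.2)) = 1 := by
    rw [hypRot, Matrix.toEuclideanLin, LinearMap.det_toLpLin, Matrix.det_fin_two_of]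
    nlinarith [Real.cosh_sq (-y.2)]
  simp [dilRotMap, LinearMap.det_smul, h]

lemma dilRotMap_mem_cone (y : DilRot) (i : Fin 2 × Fin 2) (x : Plane) :
    dilRotMap y x ∈ cone i ↔ x ∈ cone i := by
  obtain ⟨⟨a, ha⟩, θ⟩ := y
  have ha : 0 < a := ha
  have e0 : dilRotMap (⟨a, ha⟩, θ) x 0 = a * (Real.cosh θ * x 0 - Real.sinh θ * x 1) := by
    simp [dilRotMap, hypRot_apply_zero, sub_eq_add_neg]
  have e1 : dilRotMap (⟨a, ha⟩, θ) x 1 = a * (Real.cosh θ * x 1 - Real.sinh θ * x 0) := by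
    simp [dilRotMap, hypRot_apply_one, neg_add_eq_sub]
  have hc := Real.cosh_sq θ
  have key : ∀ s t : ℝ, (a * (Real.cosh θ * s - Real.sinh θ * t)) ^ 2 -
      (a * (Real.cosh θ * t - Real.sinh θ * s)) ^ 2 = a ^ 2 * (s ^ 2 - t ^ 2) := by
    intro s t
    have : Real.cosh θ ^ 2 = Real.sinh θ ^ 2 + 1 := hc
    linear_combination a ^ 2 * (s ^ 2 - t ^ 2) * this
  have lt : ∀ s t : ℝ, (a * (Real.cosh θ * t - Real.sinh θ * s)) ^ 2 <
      (a * (Real.cosh θ * s - Real.sinh θ * t)) ^ 2 ↔ t ^ 2 < s ^ 2 := by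
    intro s t
    rw [← sub_pos, key, mul_pos_iff_of_pos_left (by positivity), sub_pos]
  have hsc : |Real.sinh θ| < Real.cosh θ := by
    rw [abs_lt]
    constructor <;> nlinarith [Real.cosh_pos θ, hc]
  have pos : ∀ s t : ℝ, t ^ 2 < s ^ 2 → 0 < s →
      0 < a * (Real.cosh θ * s - Real.sinh θ * t) := by
    intro s t h hs
    have h1 : |t| < s := abs_lt_of_sq_lt_sq h hs.le
    have h2 : Real.sinh θ * t ≤ |Real.sinh θ| * |t| := by
      rw [← abs_mul]; exact le_abs_self _
    have h3 : |Real.sinh θ| * |t| < Real.cosh θ * s := by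
      nlinarith [abs_nonneg t, abs_nonneg (Real.sinh θ)]
    exact mul_pos ha (by linarith)
  have neg : ∀ s t : ℝ, t ^ 2 < s ^ 2 → s < 0 →
      a * (Real.cosh θ * s - Real.sinh θ * t) < 0 := by
    intro s t h hs
    have := pos (-s) (-t) (by simpa using h) (by linarith)
    nlinarith
  have posiff : ∀ s t : ℝ, t ^ 2 < s ^ 2 →
      (0 < a * (Real.cosh θ * s - Real.sinh θ * t) ↔ 0 < s) := by
    intro s t h
    refine ⟨fun h' => ?_, pos s t h⟩
    by_contra hs
    rcases (not_lt.1 hs).lt_or_eq with hs | hs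
    · linarith [neg s t h hs]
    · subst hs; nlinarith [sq_nonneg t]
  have negiff : ∀ s t : ℝ, t ^ 2 < s ^ 2 →
      (a * (Real.cosh θ * s - Real.sinh θ * t) < 0 ↔ s < 0) := by
    intro s t h
    refine ⟨fun h' => ?_, neg s t h⟩
    by_contra hs
    rcases (not_lt.1 hs).lt_or_eq with hs | hs
    · linarith [pos s t h hs]
    · subst hs; nlinarith [sq_nonneg t]
  obtain ⟨i, j⟩ := i
  fin_cases i <;> fin_cases j <;>
    simp only [cone, Set.mem_ofPred_eq, Fin.isValue, Fin.mk_zero, Fin.mk_one, Fin.zero_eta, e0, e1]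
  all_goals
    rw [lt]
    refine and_congr_right fun h => ?_
    first | exact posiff _ _ h | exact negiff _ _ h

lemma measurableSet_cone (i : Fin 2 × Fin 2) : MeasurableSet (cone i) := by
  obtain ⟨i, j⟩ := i
  have h0 : Measurable fun x : Plane => x 0 := by fun_prop
  have h1 : Measurable fun x : Plane => x 1 := by fun_prop
  fin_cases i <;> fin_cases j
  · exact (measurableSet_lt (h1.pow_const 2) (h0.pow_const 2)).inter
      (measurableSet_lt measurable_const h0)
  · exact (measurableSet_lt (h0.pow_const 2) (h1.pow_const 2)).inter
      (measurableSet_lt measurable_const h1)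
  · exact (measurableSet_lt (h1.pow_const 2) (h0.pow_const 2)).inter
      (measurableSet_lt h0 measurable_const)
  · exact (measurableSet_lt (h0.pow_const 2) (h1.pow_const 2)).inter
      (measurableSet_lt h1 measurable_const)

lemma map_dilRotMap (y : DilRot) (i : Fin 2 × Fin 2) :
    Measure.map (dilRotMap y) ((volume : Measure Plane).restrict (cone i)) =
      ENNReal.ofReal (((y.1 : ℝ) ^ 2)⁻¹) • (volume : Measure Plane).restrict (cone i) := by
  have ha : 0 < (y.1 : ℝ) := y.1.2
  have hpre : dilRotMap y ⁻¹' cone i = cone i := Set.ext fun x => dilRotMap_mem_cone y i x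
  have hm : Measurable (dilRotMap y) := (dilRotMap y).continuous_of_finiteDimensional.measurable
  have hdet : LinearMap.det (dilRotMap y) ≠ 0 := by rw [det_dilRotMap]; positivity
  have h := Measure.map_linearMap_addHaar_eq_smul_addHaar (volume : Measure Plane) hdet
  rw [det_dilRotMap, abs_of_pos (by positivity)] at h
  have h2 := Measure.restrict_map (μ := (volume : Measure Plane)) hm (measurableSet_cone i)
  rw [hpre, h, Measure.restrict_smul] at h2
  exact h2.symm

lemma eLpNorm_repFun (g : PGroup) (i : Fin 2 × Fin 2) (φ : L2Cone i) :
    MemLp (repFun g φ) 2 ((volume : Measure Plane).restrict (cone i)) ∧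
      eLpNorm (repFun g φ) 2 ((volume : Measure Plane).restrict (cone i)) =
        eLpNorm φ 2 ((volume : Measure Plane).restrict (cone i)) := by
  set ν := (volume : Measure Plane).restrict (cone i) with hν
  have ha : 0 < (g.2.1 : ℝ) := g.2.1.2
  have hm : Measurable (dilRotMap g.2) :=
    (dilRotMap g.2).continuous_of_finiteDimensional.measurable
  have hmap := map_dilRotMap g.2 i
  rw [← hν] at hmap
  have hφ : AEStronglyMeasurable φ (Measure.map (dilRotMap g.2) ν) := by
    rw [hmap]
    exact (Lp.stronglyMeasurable φ).aestronglyMeasurable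
  have hfac : Continuous fun x : Plane =>
      ((g.2.1 : ℝ) : ℂ) * Complex.exp (Complex.I * mink x g.1) := by
    unfold mink; fun_prop
  have hmeas : AEStronglyMeasurable (repFun g φ) ν :=
    hfac.aestronglyMeasurable.mul (hφ.comp_measurable hm)
  have hnorm : eLpNorm (repFun g φ) 2 ν =
      eLpNorm (((g.2.1 : ℝ) : ℂ) • ((φ : Plane → ℂ) ∘ dilRotMap g.2)) 2 ν := by
    refine eLpNorm_congr_norm_ae (Filter.Eventually.of_forall fun x => ?_)
    have : ‖Complex.exp (Complex.I * mink x g.1)‖ = 1 := by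
      rw [mul_comm, Complex.norm_exp_ofReal_mul_I]
    simp [repFun, this]
  have heq : eLpNorm (repFun g φ) 2 ν = eLpNorm φ 2 ν := by
    rw [hnorm, eLpNorm_const_smul, ← eLpNorm_map_measure hφ hm.aemeasurable, hmap,
      eLpNorm_smul_measure_of_ne_top (by simp), smul_eq_mul, ← mul_assoc]
    have : ‖((g.2.1 : ℝ) : ℂ)‖ₑ *
        ENNReal.ofReal (((g.2.1 : ℝ) ^ 2)⁻¹) ^ (1 / (2 : ℝ≥0∞).toReal) = 1 := by
      rw [ENNReal.ofReal_rpow_of_nonneg (by positivity) (by positivity), ← ofReal_norm,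
        ← ENNReal.ofReal_mul (by positivity)]
      have h1 : (((g.2.1 : ℝ) ^ 2)⁻¹) ^ (1 / (2 : ℝ≥0∞).toReal) = (g.2.1 : ℝ)⁻¹ := by
        rw [ENNReal.toReal_ofNat, ← Real.sqrt_eq_rpow, Real.sqrt_inv, Real.sqrt_sq ha.le]
      rw [h1, Complex.norm_real, Real.norm_of_nonneg ha.le, mul_inv_cancel₀ ha.ne',
        ENNReal.ofReal_one]
    have e : (1 / 2 : ℝ≥0∞).toReal = 1 / (2 : ℝ≥0∞).toReal := by simp
    rw [e, this, one_mul]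
  exact ⟨⟨hmeas, heq ▸ (Lp.memLp φ).2⟩, heq⟩

lemma repFun_congr (g : PGroup) (i : Fin 2 × Fin 2) {φ ψ : Plane → ℂ}
    (h : φ =ᵐ[(volume : Measure Plane).restrict (cone i)] ψ) :
    repFun g φ =ᵐ[(volume : Measure Plane).restrict (cone i)] repFun g ψ := by
  have hm : Measurable (dilRotMap g.2) :=
    (dilRotMap g.2).continuous_of_finiteDimensional.measurable
  have h' : ∀ᵐ x ∂(Measure.map (dilRotMap g.2) ((volume : Measure Plane).restrict (cone i))),
      φ x = ψ x := by
    rw [map_dilRotMap]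
    exact Measure.ae_smul_measure h _
  filter_upwards [ae_of_ae_map hm.aemeasurable h'] with x hx
  simp [repFun, hx]

/-- The representation `(π_i^j (b, a, θ) φ) (x) = a e^{i⟨x; b⟩} φ (a Λ_{-θ} x)` on `L² (C_i^j)`,
an isometry at every point of the group. -/
def rep (g : PGroup) (i : Fin 2 × Fin 2) : L2Cone i →ₗᵢ[ℂ] L2Cone i where
  toFun φ := (eLpNorm_repFun g i φ).1.toLp
  map_add' φ ψ := by
    rw [← MemLp.toLp_add]
    refine MemLp.toLp_congr _ _ ((repFun_congr g i (Lp.coeFn_add φ ψ)).trans ?_)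
    exact Filter.Eventually.of_forall fun x => by simp [repFun, mul_add]
  map_smul' c φ := by
    rw [RingHom.id_apply, ← MemLp.toLp_const_smul]
    refine MemLp.toLp_congr _ _ ((repFun_congr g i (Lp.coeFn_smul c φ)).trans ?_)
    exact Filter.Eventually.of_forall fun x => by simp [repFun]; ring
  norm_map' φ := by
    change ‖(eLpNorm_repFun g i φ).1.toLp‖ = ‖φ‖
    rw [Lp.norm_toLp, (eLpNorm_repFun g i φ).2, Lp.norm_def]

/-- The operator `π_i^j (g)*`. -/
def repAdj (g : PGroup) (i : Fin 2 × Fin 2) : L2Cone i →L[ℂ] L2Cone i :=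
  ContinuousLinearMap.adjoint (rep g i).toContinuousLinearMap

/-! ### The Duflo–Moore operators, the Fourier transform and pseudo-differential operators -/

/-- `IsDuflo i φ ψ` says that `φ` is in the domain of the unbounded Duflo–Moore operator `D_i^j`
of multiplication by `(2π)⁻¹ |⟨x; x⟩|^{1/2}`, and that `D_i^j φ = ψ`. -/
def IsDuflo (i : Fin 2 × Fin 2) (φ ψ : L2Cone i) : Prop :=
  ∀ᵐ x ∂((volume : Measure Plane).restrict (cone i)),
    ψ x = ((1 / (2 * Real.pi) * Real.sqrt |mink x x| : ℝ) : ℂ) * φ x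

/-- `A = D_i^j B` as an everywhere defined operator: `B` maps into the domain of `D_i^j`. -/
def IsDufloComp (i : Fin 2 × Fin 2) (B A : L2Cone i →L[ℂ] L2Cone i) : Prop :=
  ∀ φ, IsDuflo i (B φ) (A φ)

/-- The operator `D_i^j B`. There is at most one `A` as described, and none exactly if
`D_i^j B` is not everywhere defined, when the value is arbitrary. -/
def dufloComp (i : Fin 2 × Fin 2) (B : L2Cone i →L[ℂ] L2Cone i) : L2Cone i →L[ℂ] L2Cone i :=
  Classical.epsilon fun A => IsDufloComp i B A

/-- `B` is the Fourier transform of `f` at `π_i^j`: for `φ` in the domain of `D_i^j`,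
`B φ = ∫ f(g) π_i^j(g) D_i^j φ dμ(g)` as a weak integral. The coefficients
`g ↦ ⟨π_i^j(g) D_i^j φ, ψ⟩` are square integrable, so that the integral converges for every `f`
in `L²`, and the domain of `D_i^j` is dense. -/
def IsGroupFourier (f : L2Group) (i : Fin 2 × Fin 2) (B : L2Cone i →L[ℂ] L2Cone i) : Prop :=
  ∀ φ φ' : L2Cone i, IsDuflo i φ φ' → ∀ ψ : L2Cone i,
    ⟪ψ, B φ⟫_ℂ = ∫ g, f g * ⟪ψ, rep g i φ'⟫_ℂ ∂haar

/-- The Fourier transform of `f` at `π_i^j`. -/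
def groupFourier (f : L2Group) (i : Fin 2 × Fin 2) : L2Cone i →L[ℂ] L2Cone i :=
  Classical.epsilon fun B => IsGroupFourier f i B

/-- Operator-valued symbols on the group. -/
abbrev OpSymbol : Type := PGroup → (i : Fin 2 × Fin 2) → (L2Cone i →L[ℂ] L2Cone i)

/-- The pseudo-differential operator
`(T_σ f)(g) = Δ(g)^{-1/2} ∑ Tr (D_i^j σ(g, π_i^j) f̂(π_i^j) π_i^j(g)*)`. -/
def pseudoDiff (σ : OpSymbol) (f : L2Group) (g : PGroup) : ℂ :=
  (((modular g) ^ (-(1 / 2) : ℝ) : ℝ) : ℂ) *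
    ∑ i, opTrace (dufloComp i (σ g i) ∘L groupFourier f i ∘L repAdj g i)

/-- `T_σ` is a Hilbert–Schmidt operator from `L²` of the group to itself. -/
def IsHilbertSchmidtPseudoDiff (σ : OpSymbol) : Prop :=
  ∃ S : L2Group →L[ℂ] L2Group, IsHilbertSchmidt S ∧ ∀ f : L2Group, S f =ᵐ[haar] pseudoDiff σ f

/-- The standing hypotheses on a symbol: Hilbert–Schmidt values, square integrability, and weak
continuity of `g ↦ π_i^j(g)* D_i^j σ(g, π_i^j)` into the Hilbert–Schmidt class. -/
structure IsAdmissible (σ : OpSymbol) : Prop where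
  hilbertSchmidt : ∀ g i, IsHilbertSchmidt (σ g i)
  integral_lt_top : ∑ i, ∫⁻ g, hsNormSq (σ g i) ∂haar < ∞
  duflo_defined : ∀ g i, ∃ A, IsDufloComp i (σ g i) A
  weaklyContinuous : ∀ i, WeaklyContinuousS2 fun g => repAdj g i ∘L dufloComp i (σ g i)

/-! ### The Minkowski–Fourier transform, the Weyl transform and the symbols `τ_α` -/

/-- The inverse Minkowski–Fourier transform `(2π)⁻¹ ∫ e^{-i⟨ξ; x⟩} u(ξ) dξ` of a Schwartz
function. -/
def minkFourierInv (u : 𝓢(Plane, ℂ)) (x : Plane) : ℂ :=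
  (1 / (2 * Real.pi) : ℝ) * ∫ ξ : Plane, Complex.exp (-(Complex.I * mink ξ x)) * u ξ

/-- `G'` is the `L²` inverse Minkowski–Fourier transform of `G` in the first variable, through
the transposition formula against products of test functions. -/
def IsPartialFourierInv {Y : Type} [MeasurableSpace Y] (ν : Measure Y) (G G' : Plane × Y → ℂ) :
    Prop :=
  MemLp G' 2 ((volume : Measure Plane).prod ν) ∧
    ∀ (u : 𝓢(Plane, ℂ)) (v : Y → ℂ), MemLp v 2 ν →
      ∫ p, G' p * (u p.1 * v p.2) ∂((volume : Measure Plane).prod ν) =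
        ∫ p, G p * (minkFourierInv u p.1 * v p.2) ∂((volume : Measure Plane).prod ν)

/-- The inverse Minkowski–Fourier transform in the first variable of a square integrable
function; it is determined up to null sets. -/
def partialFourierInv {Y : Type} [MeasurableSpace Y] (ν : Measure Y) (G : Plane × Y → ℂ) :
    Plane × Y → ℂ :=
  Classical.epsilon fun G' => IsPartialFourierInv ν G G'

/-- The number `c > 0` with `ξ = c Λ_{-t} x`, for `x` and `ξ` in the same cone. -/
def dilParam (x ξ : Plane) : ℝ := Real.sqrt (mink ξ ξ / mink x x)

/-- The real number `t` with `ξ = c Λ_{-t} x`, for `x` and `ξ` in the same cone: the inverse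
hyperbolic cosine of `⟨x; ξ⟩ / (c ⟨x; x⟩)`, taken with the appropriate sign. -/
def rotParam (x ξ : Plane) : ℝ :=
  Real.arsinh ((x 1 * ξ 0 - x 0 * ξ 1) / (dilParam x ξ * mink x x))

lemma dilParam_pos {x ξ : Plane} (h : ∃ i, x ∈ cone i ∧ ξ ∈ cone i) : 0 < dilParam x ξ := by
  obtain ⟨⟨i, j⟩, hx, hξ⟩ := h
  refine Real.sqrt_pos.2 ?_
  fin_cases i <;> fin_cases j <;>
    simp only [cone, Set.mem_ofPred_eq, Fin.isValue, Fin.mk_zero, Fin.mk_one, Fin.zero_eta]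
      at hx hξ <;>
    unfold mink
  · exact div_pos (by nlinarith [hξ.1]) (by nlinarith [hx.1])
  · exact div_pos_of_neg_of_neg (by nlinarith [hξ.1]) (by nlinarith [hx.1])
  · exact div_pos (by nlinarith [hξ.1]) (by nlinarith [hx.1])
  · exact div_pos_of_neg_of_neg (by nlinarith [hξ.1]) (by nlinarith [hx.1])

lemma dilRotMap_param {x ξ : Plane} (h : ∃ i, x ∈ cone i ∧ ξ ∈ cone i) :
    dilRotMap (⟨dilParam x ξ, dilParam_pos h⟩, rotParam x ξ) x = ξ := by
  have hc := dilParam_pos h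
  have hr : 0 < mink ξ ξ / mink x x := Real.sqrt_pos.1 hc
  have hx : mink x x ≠ 0 := by rintro h0; simp [h0] at hr
  have hc2 : dilParam x ξ ^ 2 * mink x x = mink ξ ξ := by
    rw [dilParam, Real.sq_sqrt hr.le, div_mul_cancel₀ _ hx]
  have hpos : 0 < mink x ξ / mink x x := by
    obtain ⟨⟨i, j⟩, h1, h2⟩ := h
    fin_cases i <;> fin_cases j <;>
      simp only [cone, Set.mem_ofPred_eq, Fin.isValue, Fin.mk_zero, Fin.mk_one, Fin.zero_eta]
        at h1 h2 <;>
      obtain ⟨h1, h1'⟩ := h1 <;> obtain ⟨h2, h2'⟩ := h2 <;>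
      have h3 := sq_lt_sq.1 h1 <;> have h4 := sq_lt_sq.1 h2 <;>
      have h5 := mul_lt_mul'' h3 h4 (abs_nonneg _) (abs_nonneg _) <;>
      rw [← abs_mul, ← abs_mul] at h5 <;> unfold mink
    · rw [abs_of_pos (mul_pos h1' h2')] at h5
      exact div_pos (by linarith [le_abs_self (x 1 * ξ 1)]) (by nlinarith)
    · rw [abs_of_pos (mul_pos h1' h2')] at h5
      exact div_pos_of_neg_of_neg (by linarith [le_abs_self (x 0 * ξ 0)]) (by nlinarith)
    · rw [abs_of_pos (mul_pos_of_neg_of_neg h1' h2')] at h5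
      exact div_pos (by linarith [le_abs_self (x 1 * ξ 1)]) (by nlinarith)
    · rw [abs_of_pos (mul_pos_of_neg_of_neg h1' h2')] at h5
      exact div_pos_of_neg_of_neg (by linarith [le_abs_self (x 0 * ξ 0)]) (by nlinarith)
  have hs : Real.sinh (rotParam x ξ) =
      (x 1 * ξ 0 - x 0 * ξ 1) / (dilParam x ξ * mink x x) := Real.sinh_arsinh _
  have hch : Real.cosh (rotParam x ξ) = mink x ξ / (dilParam x ξ * mink x x) := by
    have h1 : 0 < mink x ξ / (dilParam x ξ * mink x x) := by
      rw [mul_comm, ← div_div]; exact div_pos hpos hc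
    refine (sq_eq_sq₀ (Real.cosh_pos _).le h1.le).1 ?_
    rw [Real.cosh_sq, hs]
    field_simp
    rw [show dilParam x ξ ^ 2 * mink x x ^ 2 = (dilParam x ξ ^ 2 * mink x x) * mink x x by ring, hc2]
    unfold mink; ring
  ext k
  fin_cases k
  · simp only [dilRotMap, LinearMap.smul_apply, PiLp.smul_apply, smul_eq_mul, Fin.isValue,
      Fin.zero_eta, hypRot_apply_zero, Real.cosh_neg, Real.sinh_neg, hs, hch]
    field_simp
    unfold mink; ring
  · simp only [dilRotMap, LinearMap.smul_apply, PiLp.smul_apply, smul_eq_mul, Fin.isValue,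
      Fin.mk_one, hypRot_apply_one, Real.cosh_neg, Real.sinh_neg, hs, hch]
    field_simp
    unfold mink; ring

open Classical in
/-- The kernel `K_α` of `α` in `L²` of the group at the point `g = (b, a, θ)`:
`Δ(g)^{1/2} (2π)⁻¹ |⟨x; x⟩|^{1/2} |⟨ξ; ξ⟩|⁻¹ (F₁⁻¹ α) (x, c, t)` with `ξ = c Λ_{-t} x` if `x` and
`ξ` are in the same cone, and `0` otherwise. -/
def kernelOf (g : PGroup) (α : L2Group) (x ξ : Plane) : ℂ :=
  if h : ∃ i, x ∈ cone i ∧ ξ ∈ cone i then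
    (((modular g) ^ (1 / 2 : ℝ) / (2 * Real.pi) * (Real.sqrt |mink x x| / |mink ξ ξ|) : ℝ) : ℂ) *
      partialFourierInv dilRotMeasure α (x, (⟨dilParam x ξ, dilParam_pos h⟩, rotParam x ξ))
  else 0

/-- The twisting operator `(T K)(x, q) = K (x + q/2, x - q/2)`. -/
def twist (K : Plane → Plane → ℂ) (x q : Plane) : ℂ :=
  K (x + (1 / 2 : ℝ) • q) (x - (1 / 2 : ℝ) • q)

/-- The symbol `τ_α (x, ξ) = (F₂⁻¹ T K_α) (x, ξ̃)` with `ξ̃ = (-ξ₁, ξ₂)`. -/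
def weylSymbol (g : PGroup) (α : L2Group) (x ξ : Plane) : ℂ :=
  partialFourierInv (volume : Measure Plane)
    (fun p : Plane × Plane => twist (kernelOf g α) p.2 p.1) (!₂[-ξ 0, ξ 1], x)

/-- The Wigner transform `(2π)⁻¹ ∫ e^{-iξ·q} f(x + q/2) conj (g(x - q/2)) dq`. -/
def wigner (f g : L2Plane) (x ξ : Plane) : ℂ :=
  (1 / (2 * Real.pi) : ℝ) * ∫ q : Plane, Complex.exp (-(Complex.I * (⟪ξ, q⟫_ℝ : ℝ))) *
    f (x + (1 / 2 : ℝ) • q) * conj (g (x - (1 / 2 : ℝ) • q))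

/-- `W` is the Weyl transform with symbol `τ`:
`⟨W f, g⟩ = (2π)⁻¹ ∫∫ τ(x, ξ) W(f, g)(x, ξ) dx dξ`. -/
def IsWeyl (τ : Plane → Plane → ℂ) (W : L2Plane →L[ℂ] L2Plane) : Prop :=
  ∀ f g : L2Plane, ⟪g, W f⟫_ℂ =
    (1 / (2 * Real.pi) : ℝ) * ∫ p : Plane × Plane, τ p.1 p.2 * wigner f g p.1 p.2

/-- The Weyl transform with symbol `τ`; it exists for square integrable `τ`. -/
def weyl (τ : Plane → Plane → ℂ) : L2Plane →L[ℂ] L2Plane :=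
  Classical.epsilon fun W => IsWeyl τ W

/-- Extension by zero from `L² (C_i^j)` to `L² (ℝ²)`. -/
def zeroExt (i : Fin 2 × Fin 2) (φ : L2Cone i) : L2Plane :=
  ((memLp_indicator_iff_restrict (measurableSet_cone i)).2 (Lp.memLp φ)).toLp

end AffPoincare

end

open AffPoincare

set_option linter.unusedSectionVars false
set_option linter.unusedVariables false

noncomputable section

namespace AffPoincare

open Filter Topology

/-! ### Hilbert–Schmidt operators through matrix entries, and weak continuity -/

section HilbertSpace

variable {H : Type*} [NormedAddCommGroup H] [InnerProductSpace ℂ H] [CompleteSpace H]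

/-! Both sides of the equivalence turn out to be the same square-integrability condition on a
vector-valued function of `g`. This rests on two unitary identifications of `L²(ℙ)` with the sum
over the four cones of the Hilbert–Schmidt operators on `L²(C)`.

The first is the Plancherel formula. For fixed `x` in a cone, `(a, θ) ↦ a Λ_{-θ} x` is a
diffeomorphism onto that cone with `dξ = |⟨x; x⟩| a⁴ · a⁻³ da dθ` (`lintegral_dilRotMap`). Since the
cones fill the plane up to a null set, `k ↦ |⟨x; x⟩|^{1/2} a² k(x, a Λ_{-θ} x)` is unitary from the
sum of the `L²(C × C)` to `L²(ℙ)`, so tensors of basis vectors give an orthonormal basis of `L²(ℙ)`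
(`exists_hilbertBasis_coneTensor`). The Duflo–Moore factor is what turns the conjugated matrix
coefficients of `π(g) D` into inverse Minkowski–Fourier transforms, in the translation variable, of
such tensors (`groupMink_coneTensor`). Hence the matrix entries of `f̂(π)` are the coordinates of
the back-transformed `f` (`inner_groupFourier`), and the traces defining `T_σ` add up to an inner
product: `(T_σ f)(g) = ⟨k(g), f⟩`, with `‖k(g)‖² = a² ∑ ‖D σ(g, π)‖²` in Hilbert–Schmidt norm
(`pseudoDiff_eq`, `enorm_symbolVec_sq`). By Tonelli over an orthonormal basis, an operator of this
form is Hilbert–Schmidt exactly when `∫ ‖k(g)‖² dμ` is finite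
(`exists_hilbertSchmidt_iff_lintegral_lt_top`).

The second identification concerns the Weyl side. Twisting and partial Fourier transformation are
unitary, and the Wigner transform is their effect on a tensor, so the Weyl transform with symbol
`τ_{g,β}` is the integral operator with kernel `K_{g,β} / 2π` (`inner_weyl_kernelSymbol`). On each
cone that kernel is, up to a scalar, the back-transformed `β` in the orbit coordinates above. The
identity demanded of `α` therefore says that `D σ π*` has `((2π)² a)⁻¹` times the coefficients of
the back-transformed `α(g)` (`forall_zeroExt_eq_weyl_iff`). This determines `α(g)` and gives
`‖α(g)‖² = (2π)⁴ ‖k(g)‖²` (`enorm_sq_of_isCoeff`), so the two integrals are finite together.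

What remains is weak continuity of `α`. The hypothesis concerns `π* D σ`, whereas `D σ π*` is its
conjugate by `π(g)`. Strong continuity of `π(g)*` and local boundedness of weakly continuous maps
pass from one to the other (`continuous_inner_rightOp`, `exists_weaklyContinuous_isCoeff`). -/

lemma hasSum_norm_sq_inner {ι : Type*} (b : HilbertBasis ι ℂ H) (x : H) :
    HasSum (fun i => ‖⟪b i, x⟫_ℂ‖ ^ 2) (‖x‖ ^ 2) := by
  have h := (b.hasSum_inner_mul_inner x x).mapL Complex.reCLM
  have h2 : Complex.reCLM ⟪x, x⟫_ℂ = ‖x‖ ^ 2 := inner_self_eq_norm_sq (𝕜 := ℂ) x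
  rw [h2] at h
  convert h using 2 with i
  rw [← inner_conj_symm x (b i), RCLike.conj_mul]
  norm_cast

lemma enorm_sq_eq_tsum_inner {ι : Type*} (b : HilbertBasis ι ℂ H) (x : H) :
    ‖x‖ₑ ^ 2 = ∑' i, ‖⟪b i, x⟫_ℂ‖ₑ ^ 2 := by
  have h := hasSum_norm_sq_inner b x
  have e : ∀ {E : Type _} [NormedAddCommGroup E] (y : E), ‖y‖ₑ ^ 2 = ENNReal.ofReal (‖y‖ ^ 2) :=
    fun y => by rw [ENNReal.ofReal_pow (norm_nonneg _), ofReal_norm]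
  rw [e x, ← h.tsum_eq, ENNReal.ofReal_tsum_of_nonneg (fun _ => by positivity) h.summable]
  exact tsum_congr fun i => by
    rw [ENNReal.ofReal_pow (norm_nonneg _), ofReal_norm]

lemma HilbertBasis.clm_ext {ι E : Type*} [NormedAddCommGroup E] [NormedSpace ℂ E]
    (b : HilbertBasis ι ℂ H) {A B : H →L[ℂ] E} (h : ∀ i, A (b i) = B (b i)) : A = B := by
  refine ContinuousLinearMap.ext_on (s := Set.range b)
    (Submodule.dense_iff_topologicalClosure_eq_top.2 b.dense_span) ?_
  rintro _ ⟨i, rfl⟩; exact h i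

lemma HilbertBasis.vec_ext {ι : Type*} (b : HilbertBasis ι ℂ H) {x y : H}
    (h : ∀ i, ⟪b i, x⟫_ℂ = ⟪b i, y⟫_ℂ) : x = y := by
  apply b.repr.injective
  ext i
  simpa [b.repr_apply_apply] using h i

lemma HilbertBasis.exists_of_coeff {ι : Type*} (b : HilbertBasis ι ℂ H) (c : ι → ℂ)
    (hc : ∑' i, ‖c i‖ₑ ^ 2 < ∞) : ∃ x : H, ∀ i, ⟪b i, x⟫_ℂ = c i := by
  have hm : Memℓp c 2 := by
    refine memℓp_gen ?_
    have h1 : Summable fun i => (‖c i‖₊ ^ 2 : NNReal) := by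
      rw [← ENNReal.tsum_coe_ne_top_iff_summable]
      simpa [enorm_eq_nnnorm] using hc.ne
    simpa using NNReal.summable_coe.2 h1
  refine ⟨b.repr.symm ⟨c, hm⟩, fun i => ?_⟩
  rw [← b.repr_apply_apply]
  simp

lemma hsNormSq_eq_tsum (A : H →L[ℂ] H) :
    hsNormSq A = ∑' n, ∑' m, ‖⟪onb H m, A (onb H n)⟫_ℂ‖ₑ ^ 2 :=
  tsum_congr fun n => enorm_sq_eq_tsum_inner _ _

/-- In matrix entries, passing to the adjoint only exchanges the two summations. -/
lemma hsNormSq_adjoint (A : H →L[ℂ] H) : hsNormSq (ContinuousLinearMap.adjoint A) = hsNormSq A := by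
  rw [hsNormSq_eq_tsum, hsNormSq_eq_tsum, ENNReal.tsum_comm]
  refine tsum_congr fun n => tsum_congr fun m => ?_
  rw [ContinuousLinearMap.adjoint_inner_right, ← inner_conj_symm, RCLike.enorm_conj]

lemma hsNormSq_isometry_comp (V : H →ₗᵢ[ℂ] H) (A : H →L[ℂ] H) :
    hsNormSq (V.toContinuousLinearMap ∘L A) = hsNormSq A :=
  tsum_congr fun n => by simp [enorm_eq_nnnorm]

lemma IsHilbertSchmidt.tsum_lt_top {A : H →L[ℂ] H} (hA : IsHilbertSchmidt A) :
    ∑' p : onbIndex H × onbIndex H, ‖⟪onb H p.1, A (onb H p.2)⟫_ℂ‖ₑ ^ 2 < ∞ := by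
  rw [ENNReal.tsum_prod (f := fun m n => ‖⟪onb H m, A (onb H n)⟫_ℂ‖ₑ ^ 2), ENNReal.tsum_comm,
    ← hsNormSq_eq_tsum]
  exact hA

lemma summable_sq_of_tsum_enorm {ι : Type*} {c : ι → ℂ} (hc : ∑' i, ‖c i‖ₑ ^ 2 < ∞) :
    Summable fun i => ‖c i‖ ^ 2 := by
  have h1 : Summable fun i => (‖c i‖₊ ^ 2 : NNReal) := by
    rw [← ENNReal.tsum_coe_ne_top_iff_summable]
    simpa [enorm_eq_nnnorm] using hc.ne
  simpa using NNReal.summable_coe.2 h1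

lemma summable_matrix_mul {X Y : H →L[ℂ] H} (hX : IsHilbertSchmidt X) (hY : IsHilbertSchmidt Y) :
    Summable fun p : onbIndex H × onbIndex H =>
      ⟪onb H p.1, X (onb H p.2)⟫_ℂ * ⟪onb H p.2, Y (onb H p.1)⟫_ℂ := by
  have h1 := summable_sq_of_tsum_enorm hX.tsum_lt_top
  have h2 : Summable fun p : onbIndex H × onbIndex H => ‖⟪onb H p.2, Y (onb H p.1)⟫_ℂ‖ ^ 2 :=
    (Equiv.prodComm _ _).summable_iff.2 (summable_sq_of_tsum_enorm hY.tsum_lt_top)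
  refine Summable.of_norm_bounded ((h1.add h2).mul_left (1 / 2 : ℝ)) fun p => ?_
  rw [norm_mul]
  nlinarith [sq_nonneg (‖⟪onb H p.1, X (onb H p.2)⟫_ℂ‖ - ‖⟪onb H p.2, Y (onb H p.1)⟫_ℂ‖)]

/-- Parseval for `X* eₙ` and `Y eₙ` in each diagonal term. The double sum converges absolutely, so
it can later be rearranged; this is where cyclicity of the trace comes from. -/
lemma opTrace_comp {X Y : H →L[ℂ] H} (hX : IsHilbertSchmidt X) (hY : IsHilbertSchmidt Y) :
    opTrace (X ∘L Y) = ∑' p : onbIndex H × onbIndex H,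
      ⟪onb H p.1, X (onb H p.2)⟫_ℂ * ⟪onb H p.2, Y (onb H p.1)⟫_ℂ := by
  rw [(summable_matrix_mul hX hY).tsum_prod, opTrace]
  refine tsum_congr fun n => ?_
  have h := (onb H).tsum_inner_mul_inner (ContinuousLinearMap.adjoint X (onb H n)) (Y (onb H n))
  simp only [ContinuousLinearMap.adjoint_inner_left] at h
  exact h.symm

lemma opTrace_comp_comm {X Y : H →L[ℂ] H} (hX : IsHilbertSchmidt X) (hY : IsHilbertSchmidt Y) :
    opTrace (X ∘L Y) = opTrace (Y ∘L X) := by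
  rw [opTrace_comp hX hY, opTrace_comp hY hX, ← (Equiv.prodComm _ _).tsum_eq]
  exact tsum_congr fun p => mul_comm _ _

lemma clm_ext_matrix {A B : H →L[ℂ] H}
    (h : ∀ m n, ⟪onb H m, A (onb H n)⟫_ℂ = ⟪onb H m, B (onb H n)⟫_ℂ) : A = B :=
  HilbertBasis.clm_ext (onb H) fun n => HilbertBasis.vec_ext (onb H) fun m => h m n

/-- A bounded sesquilinear form is represented by a bounded operator. -/
lemma exists_clm_of_sesq (s : H → H → ℂ)
    (hal : ∀ x x' y, s (x + x') y = s x y + s x' y) (har : ∀ x y y', s x (y + y') = s x y + s x y')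
    (hml : ∀ (c : ℂ) x y, s (c • x) y = conj c * s x y)
    (hmr : ∀ (c : ℂ) x y, s x (c • y) = c * s x y)
    (C : ℝ) (hC : ∀ x y, ‖s x y‖ ≤ C * ‖x‖ * ‖y‖) :
    ∃ B : H →L[ℂ] H, ∀ x y, ⟪x, B y⟫_ℂ = s x y := by
  let f : H →L⋆[ℂ] H →L[ℂ] ℂ := LinearMap.mkContinuous₂
    (LinearMap.mk₂'ₛₗ (starRingEnd ℂ) (RingHom.id ℂ) s hal (fun c x y => by simp [hml]) har
      (fun c x y => by simp [hmr])) C (fun x y => by simpa using hC x y)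
  refine ⟨ContinuousLinearMap.adjoint (InnerProductSpace.continuousLinearMapOfBilin (𝕜 := ℂ) f),
    fun x y => ?_⟩
  rw [ContinuousLinearMap.adjoint_inner_right]
  simp [f]

/-- On a compact neighbourhood the functionals `⟨F x, ·⟩` are pointwise bounded, hence uniformly
bounded by Banach–Steinhaus. -/
lemma WeaklyContinuous.locally_bounded {X : Type*} [TopologicalSpace X] [LocallyCompactSpace X]
    {F : X → H} (hF : WeaklyContinuous F) (x₀ : X) : ∃ C, ∀ᶠ x in 𝓝 x₀, ‖F x‖ ≤ C := by
  obtain ⟨K, hK, hx⟩ := exists_compact_mem_nhds x₀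
  obtain ⟨C, hC⟩ := banach_steinhaus (g := fun x : K => innerSL ℂ (F x)) (fun h => by
    obtain ⟨C, hC⟩ := hK.exists_bound_of_continuousOn (hF h).continuousOn
    refine ⟨C, fun x => ?_⟩
    rw [innerSL_apply_apply, norm_inner_symm]
    exact hC x x.2)
  refine ⟨C, ?_⟩
  filter_upwards [hx] with x hxK
  simpa using hC ⟨x, hxK⟩

/-- Linearity extends continuity to the span of the basis, which is dense; the local bound makes the
approximation error uniform near each point. -/
lemma weaklyContinuous_of_basis {X ι : Type*} [TopologicalSpace X] (b : HilbertBasis ι ℂ H)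
    {F : X → H} (hb : ∀ x₀, ∃ C, ∀ᶠ x in 𝓝 x₀, ‖F x‖ ≤ C)
    (hF : ∀ i, Continuous fun x => ⟪b i, F x⟫_ℂ) : WeaklyContinuous F := by
  have hd : Dense ((Submodule.span ℂ (Set.range b) : Submodule ℂ H) : Set H) :=
    Submodule.dense_iff_topologicalClosure_eq_top.2 b.dense_span
  have hs : ∀ h ∈ Submodule.span ℂ (Set.range b), Continuous fun x => ⟪h, F x⟫_ℂ := by
    intro h hh
    induction hh using Submodule.span_induction with
    | mem x hx => obtain ⟨i, rfl⟩ := hx; exact hF i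
    | zero => simpa using continuous_const
    | add x y _ _ hx hy => simp only [inner_add_left]; exact hx.add hy
    | smul c x _ hx => simp only [inner_smul_left]; exact continuous_const.mul hx
  intro h
  rw [continuous_iff_continuousAt]
  intro x₀
  obtain ⟨C, hC⟩ := hb x₀
  have hC0 : 0 ≤ C := by
    obtain ⟨x, hx⟩ := hC.exists
    exact (norm_nonneg _).trans hx
  rw [ContinuousAt, Metric.tendsto_nhds]
  intro ε hε
  -- `C + 1` instead of `C` keeps the radius meaningful when `C = 0`.
  obtain ⟨y, hy, hyd⟩ := Metric.dense_iff.1 hd h (ε / (3 * (C + 1))) (by positivity)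
  have hxy : dist h y < ε / (3 * (C + 1)) := by
    rw [dist_comm]; exact hy
  have h1 := Metric.tendsto_nhds.1 ((hs y hyd).tendsto x₀) (ε / 3) (by positivity)
  have key : ∀ x, ‖F x‖ ≤ C → ‖⟪h, F x⟫_ℂ - ⟪y, F x⟫_ℂ‖ ≤ ε / 3 := by
    intro x hx
    rw [← inner_sub_left]
    refine (norm_inner_le_norm _ _).trans ?_
    rw [← dist_eq_norm]
    calc dist h y * ‖F x‖ ≤ ε / (3 * (C + 1)) * (C + 1) :=
          mul_le_mul hxy.le (hx.trans (by linarith)) (norm_nonneg _) (by positivity)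
      _ = ε / 3 := by field_simp
  filter_upwards [h1, hC] with x hx1 hx2
  have e1 := key x hx2
  have e2 := key x₀ hC.self_of_nhds
  rw [dist_eq_norm] at hx1 ⊢
  have : ⟪h, F x⟫_ℂ - ⟪h, F x₀⟫_ℂ = (⟪h, F x⟫_ℂ - ⟪y, F x⟫_ℂ) + (⟪y, F x⟫_ℂ - ⟪y, F x₀⟫_ℂ)
      - (⟪h, F x₀⟫_ℂ - ⟪y, F x₀⟫_ℂ) := by ring
  rw [this]
  refine (norm_sub_le _ _).trans_lt ?_
  have := norm_add_le (⟪h, F x⟫_ℂ - ⟪y, F x⟫_ℂ) (⟪y, F x⟫_ℂ - ⟪y, F x₀⟫_ℂ)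
  linarith

end HilbertSpace

/-! ### Hilbert–Schmidt criterion for operators given by inner products -/

section Carleman

variable {X : Type*} [MeasurableSpace X] {μ : Measure X}

/-- An operator `f ↦ ⟨k(·), f⟩` of Carleman type is Hilbert–Schmidt if and only if `k` is square
integrable. -/
theorem exists_hilbertSchmidt_iff_lintegral_lt_top [Countable (onbIndex (Lp ℂ 2 μ))]
    (k : X → Lp ℂ 2 μ) (hk : ∀ f, AEStronglyMeasurable (fun x => ⟪k x, f⟫_ℂ) μ) :
    (∃ S : Lp ℂ 2 μ →L[ℂ] Lp ℂ 2 μ, IsHilbertSchmidt S ∧ ∀ f, S f =ᵐ[μ] fun x => ⟪k x, f⟫_ℂ) ↔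
      ∫⁻ x, ‖k x‖ₑ ^ 2 ∂μ < ∞ := by
  -- Parseval at each point and the exchange of sum and integral; countability of the basis enters
  -- here.
  have key : ∑' n, ∫⁻ x, ‖⟪k x, onb (Lp ℂ 2 μ) n⟫_ℂ‖ₑ ^ 2 ∂μ = ∫⁻ x, ‖k x‖ₑ ^ 2 ∂μ := by
    rw [← lintegral_tsum fun n => (hk _).enorm.pow_const 2]
    refine lintegral_congr fun x => ?_
    rw [enorm_sq_eq_tsum_inner (onb (Lp ℂ 2 μ))]
    refine tsum_congr fun n => ?_
    rw [← inner_conj_symm, RCLike.enorm_conj]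
  have hnorm : ∀ (u : X → ℂ) (v : Lp ℂ 2 μ), v =ᵐ[μ] u → ‖v‖ₑ ^ 2 = ∫⁻ x, ‖u x‖ₑ ^ 2 ∂μ := by
    intro u v huv
    rw [Lp.enorm_def, eLpNorm_congr_ae huv, eLpNorm_eq_lintegral_rpow_enorm_toReal (by simp) (by simp)]
    rw [← ENNReal.rpow_natCast, ← ENNReal.rpow_mul]
    simp
  constructor
  · rintro ⟨S, hS, hSf⟩
    rw [← key]
    refine lt_of_eq_of_lt (tsum_congr fun n => ?_) hS
    exact (hnorm _ _ (hSf _)).symm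
  · intro h
    -- Pointwise Cauchy–Schwarz, which makes the operator bounded by the square root of `∫ ‖k‖²`.
    have hbd : ∀ f : Lp ℂ 2 μ, ∫⁻ x, ‖⟪k x, f⟫_ℂ‖ₑ ^ 2 ∂μ ≤
        (∫⁻ x, ‖k x‖ₑ ^ 2 ∂μ) * ‖f‖ₑ ^ 2 := by
      intro f
      rw [← lintegral_mul_const' _ _ (by simp)]
      refine lintegral_mono fun x => ?_
      rw [← mul_pow]
      gcongr
      simpa [enorm_eq_nnnorm, ← ENNReal.coe_mul] using nnnorm_inner_le_nnnorm (𝕜 := ℂ) (k x) f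
    have hmem : ∀ f : Lp ℂ 2 μ, MemLp (fun x => ⟪k x, f⟫_ℂ) 2 μ := by
      intro f
      refine ⟨hk f, ?_⟩
      rw [eLpNorm_lt_top_iff_lintegral_rpow_enorm_lt_top (by simp) (by simp)]
      have := (hbd f).trans_lt (ENNReal.mul_lt_top h (by simp))
      simpa using this
    let S₀ : Lp ℂ 2 μ →ₗ[ℂ] Lp ℂ 2 μ :=
      { toFun := fun f => (hmem f).toLp
        map_add' := fun f g => by
          rw [← MemLp.toLp_add]
          exact MemLp.toLp_congr _ _ (Eventually.of_forall fun x => by simp [inner_add_right])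
        map_smul' := fun c f => by
          rw [RingHom.id_apply, ← MemLp.toLp_const_smul]
          exact MemLp.toLp_congr _ _ (Eventually.of_forall fun x => by simp [inner_smul_right]) }
    have hSae : ∀ f, S₀ f =ᵐ[μ] fun x => ⟪k x, f⟫_ℂ := fun f => MemLp.coeFn_toLp (hmem f)
    let S := S₀.mkContinuous (Real.sqrt (∫⁻ x, ‖k x‖ₑ ^ 2 ∂μ).toReal) (fun f => by
      have h1 := hnorm _ _ (hSae f)
      have h2 := hbd f
      rw [← h1] at h2
      have h3 := ENNReal.toReal_mono (ENNReal.mul_ne_top h.ne (by simp)) h2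
      rw [ENNReal.toReal_mul, ENNReal.toReal_pow, ENNReal.toReal_pow, toReal_enorm, toReal_enorm] at h3
      refine abs_le_of_sq_le_sq' ?_ (by positivity) |>.2
      rwa [mul_pow, Real.sq_sqrt ENNReal.toReal_nonneg])
    refine ⟨S, ?_, hSae⟩
    have : hsNormSq S = ∫⁻ x, ‖k x‖ₑ ^ 2 ∂μ := by
      rw [← key]
      exact tsum_congr fun n => hnorm _ _ (hSae _)
    rw [IsHilbertSchmidt, this]
    exact h

end Carleman

end AffPoincare

end

noncomputable section

namespace AffPoincare

open Filter Topology

/-! ### Complex conjugation and the bilinear pairing on `L²` -/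

section StarLp

variable {X : Type*} [MeasurableSpace X] {μ : Measure X}

lemma inner_eq_integral (f g : Lp ℂ 2 μ) : ⟪f, g⟫_ℂ = ∫ x, conj (f x) * g x ∂μ := by
  rw [L2.inner_def]
  exact integral_congr_ae (Eventually.of_forall fun x => by simp [mul_comm])

/-- Conjugating the first slot yields the symmetric bilinear pairing, the one for which the Fourier
transform is its own transpose. -/
lemma inner_star_eq_integral (f g : Lp ℂ 2 μ) : ⟪star f, g⟫_ℂ = ∫ x, f x * g x ∂μ := by
  rw [inner_eq_integral]
  refine integral_congr_ae ?_
  filter_upwards [Lp.coeFn_star f] with x hx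
  rw [hx]; simp

lemma inner_star_comm (f g : Lp ℂ 2 μ) : ⟪star f, g⟫_ℂ = ⟪star g, f⟫_ℂ := by
  simp only [inner_star_eq_integral, mul_comm]

lemma inner_star_star (f g : Lp ℂ 2 μ) : ⟪star f, star g⟫_ℂ = ⟪g, f⟫_ℂ := by
  rw [inner_star_comm, star_star]

lemma norm_star_Lp (f : Lp ℂ 2 μ) : ‖star f‖ = ‖f‖ := by
  have h := congrArg Complex.re (inner_star_star f f)
  have e : ∀ g : Lp ℂ 2 μ, (⟪g, g⟫_ℂ).re = ‖g‖ ^ 2 := fun g => inner_self_eq_norm_sq (𝕜 := ℂ) g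
  rw [e, e] at h
  exact (sq_eq_sq₀ (norm_nonneg _) (norm_nonneg _)).1 h

lemma star_add_Lp (f g : Lp ℂ 2 μ) : star (f + g) = star f + star g := by
  refine Lp.ext ?_
  filter_upwards [Lp.coeFn_star (f + g), Lp.coeFn_add f g, Lp.coeFn_add (star f) (star g),
    Lp.coeFn_star f, Lp.coeFn_star g] with x h1 h2 h3 h4 h5
  simp only [Pi.add_apply, Pi.star_apply] at h2 h3 h4 h5 h1
  rw [h1, h3, h2, h4, h5, star_add]

lemma star_smul_Lp (c : ℂ) (f : Lp ℂ 2 μ) : star (c • f) = conj c • star f := by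
  refine Lp.ext ?_
  filter_upwards [Lp.coeFn_star (c • f), Lp.coeFn_smul c f, Lp.coeFn_smul (conj c) (star f),
    Lp.coeFn_star f] with x h1 h2 h3 h4
  rw [h1, h3]
  simp [h2, h4]

/-- The complex conjugate of a Hilbert basis is a Hilbert basis. -/
lemma exists_hilbertBasis_star {ι : Type*} (b : HilbertBasis ι ℂ (Lp ℂ 2 μ)) :
    ∃ c : HilbertBasis ι ℂ (Lp ℂ 2 μ), ∀ i, c i = star (b i) := by
  classical
  have ho : Orthonormal ℂ fun i => star (b i) := by
    rw [orthonormal_iff_ite]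
    intro i j
    rw [inner_star_star, orthonormal_iff_ite.1 b.orthonormal]
    simp [eq_comm]
  have ht : (Submodule.span ℂ (Set.range fun i => star (b i)))ᗮ = ⊥ := by
    rw [Submodule.eq_bot_iff]
    intro x hx
    have h : star x = 0 := HilbertBasis.vec_ext b fun i => by
      rw [inner_zero_right, ← star_star (b i), inner_star_star, ← inner_conj_symm]
      rw [hx _ (Submodule.subset_span ⟨i, rfl⟩), map_zero]
    rw [← norm_eq_zero, ← norm_star_Lp, h, norm_zero]
  exact ⟨HilbertBasis.mkOfOrthogonalEqBot ho ht, fun i => by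
    rw [HilbertBasis.coe_mkOfOrthogonalEqBot]⟩

end StarLp

/-! ### Isometries `k ↦ w · (k ∘ Ψ)` from changes of variables -/

section WeightedComposition

variable {Z X : Type*} [MeasurableSpace Z] [MeasurableSpace X] {ζ : Measure Z} {μ : Measure X}

/-- The operator `k ↦ w · (k ∘ Ψ)` is isometric from `L² (μ)` to `L² (ζ)`. -/
structure IsWeightedComp (ζ : Measure Z) (μ : Measure X) (w : Z → ℂ) (Ψ : Z → X) : Prop where
  measurable_weight : Measurable w
  measurable_map : Measurable Ψ
  map_eq : Measure.map Ψ (ζ.withDensity fun z => ‖w z‖ₑ ^ 2) = μ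

namespace IsWeightedComp

variable {w : Z → ℂ} {Ψ : Z → X} (h : IsWeightedComp ζ μ w Ψ)

include h in
-- `Ψ` controls null sets only where the weight is nonzero; elsewhere both products vanish.
lemma congr_ae {k k' : X → ℂ} (hk : k =ᵐ[μ] k') :
    (fun z => w z * k (Ψ z)) =ᵐ[ζ] fun z => w z * k' (Ψ z) := by
  rw [← h.map_eq] at hk
  have h2 := ae_of_ae_map h.measurable_map.aemeasurable hk
  rw [ae_withDensity_iff (h.measurable_weight.enorm.pow_const 2)] at h2
  filter_upwards [h2] with z hz
  by_cases hw : w z = 0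
  · simp [hw]
  · rw [hz (by simpa using hw)]

include h in
lemma lintegral_eq {k : X → ℝ≥0∞} (hk : AEMeasurable k μ) :
    ∫⁻ z, ‖w z‖ₑ ^ 2 * k (Ψ z) ∂ζ = ∫⁻ x, k x ∂μ := by
  rw [← h.map_eq] at hk ⊢
  rw [lintegral_map' hk h.measurable_map.aemeasurable,
    lintegral_withDensity_eq_lintegral_mul_non_measurable₀]
  · rfl
  · exact (h.measurable_weight.enorm.pow_const 2).aemeasurable
  · exact Eventually.of_forall fun z => by simp

include h in
lemma memLp {k : X → ℂ} (hk : MemLp k 2 μ) :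
    MemLp (fun z => w z * k (Ψ z)) 2 ζ ∧
      eLpNorm (fun z => w z * k (Ψ z)) 2 ζ = eLpNorm k 2 μ := by
  have hn : eLpNorm (fun z => w z * k (Ψ z)) 2 ζ = eLpNorm k 2 μ := by
    rw [eLpNorm_eq_lintegral_rpow_enorm_toReal (by simp) (by simp),
      eLpNorm_eq_lintegral_rpow_enorm_toReal (by simp) (by simp), ← h.lintegral_eq]
    · congr 1
      refine lintegral_congr fun z => ?_
      simp [enorm_mul, mul_pow]
    · exact hk.1.enorm.pow_const _
  refine ⟨⟨?_, hn ▸ hk.2⟩, hn⟩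
  have hm := hk.1.stronglyMeasurable_mk
  exact ((h.measurable_weight.mul (hm.measurable.comp h.measurable_map)).aestronglyMeasurable).congr
    (h.congr_ae hk.1.ae_eq_mk).symm

/-- The isometry `k ↦ w · (k ∘ Ψ)`. -/
def toIsometry : Lp ℂ 2 μ →ₗᵢ[ℂ] Lp ℂ 2 ζ where
  toFun k := (h.memLp (Lp.memLp k)).1.toLp
  map_add' k l := by
    rw [← MemLp.toLp_add]
    refine MemLp.toLp_congr _ _ ((h.congr_ae (Lp.coeFn_add k l)).trans ?_)
    exact Eventually.of_forall fun z => by simp [mul_add]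
  map_smul' c k := by
    rw [RingHom.id_apply, ← MemLp.toLp_const_smul]
    refine MemLp.toLp_congr _ _ ((h.congr_ae (Lp.coeFn_smul c k)).trans ?_)
    exact Eventually.of_forall fun z => by simp; ring
  norm_map' k := by
    change ‖(h.memLp (Lp.memLp k)).1.toLp‖ = ‖k‖
    rw [Lp.norm_toLp, (h.memLp (Lp.memLp k)).2, Lp.norm_def]

lemma coeFn_toIsometry (k : Lp ℂ 2 μ) : h.toIsometry k =ᵐ[ζ] fun z => w z * k (Ψ z) :=
  MemLp.coeFn_toLp (h.memLp (Lp.memLp k)).1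

end IsWeightedComp

end WeightedComposition

/-! ### Elementary tensors in `L²` of a product -/

section Tensor

variable {X Y : Type*} [MeasurableSpace X] [MeasurableSpace Y] {μ : Measure X} {ν : Measure Y}

lemma memLp_two_mul_prod [SFinite μ] [SFinite ν] {u : X → ℂ} {v : Y → ℂ} (hu : MemLp u 2 μ)
    (hv : MemLp v 2 ν) : MemLp (fun p : X × Y => u p.1 * v p.2) 2 (μ.prod ν) := by
  have hm : AEStronglyMeasurable (fun p : X × Y => u p.1 * v p.2) (μ.prod ν) :=
    (hu.1.comp_fst).mul (hv.1.comp_snd)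
  rw [memLp_two_iff_integrable_sq_norm hm]
  have h := ((memLp_two_iff_integrable_sq_norm hu.1).1 hu).mul_prod
    ((memLp_two_iff_integrable_sq_norm hv.1).1 hv)
  refine h.congr (Eventually.of_forall fun p => ?_)
  simp [mul_pow]

variable [SFinite μ] [SFinite ν]

/-- The elementary tensor `(x, y) ↦ u x * v y`. -/
def tensorFun (u : Lp ℂ 2 μ) (v : Lp ℂ 2 ν) : Lp ℂ 2 (μ.prod ν) :=
  (memLp_two_mul_prod (Lp.memLp u) (Lp.memLp v)).toLp

lemma coeFn_tensorFun (u : Lp ℂ 2 μ) (v : Lp ℂ 2 ν) :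
    tensorFun u v =ᵐ[μ.prod ν] fun p => u p.1 * v p.2 := MemLp.coeFn_toLp _

lemma ae_fst {p : X → Prop} (h : ∀ᵐ x ∂μ, p x) : ∀ᵐ z ∂(μ.prod ν), p z.1 :=
  Measure.quasiMeasurePreserving_fst.ae h

lemma ae_snd {p : Y → Prop} (h : ∀ᵐ x ∂ν, p x) : ∀ᵐ z ∂(μ.prod ν), p z.2 :=
  Measure.quasiMeasurePreserving_snd.ae h

lemma inner_tensorFun (u u' : Lp ℂ 2 μ) (v v' : Lp ℂ 2 ν) :
    ⟪tensorFun u v, tensorFun u' v'⟫_ℂ = ⟪u, u'⟫_ℂ * ⟪v, v'⟫_ℂ := by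
  rw [inner_eq_integral, inner_eq_integral, inner_eq_integral, ← integral_prod_mul]
  refine integral_congr_ae ?_
  filter_upwards [coeFn_tensorFun u v, coeFn_tensorFun u' v'] with p h1 h2
  rw [h1, h2, map_mul]; ring

lemma norm_tensorFun (u : Lp ℂ 2 μ) (v : Lp ℂ 2 ν) : ‖tensorFun u v‖ = ‖u‖ * ‖v‖ := by
  have h := inner_tensorFun u u v v
  simp only [inner_self_eq_norm_sq_to_K] at h
  have h' : ‖tensorFun u v‖ ^ 2 = (‖u‖ * ‖v‖) ^ 2 := by
    rw [mul_pow]; exact_mod_cast h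
  exact (sq_eq_sq₀ (norm_nonneg _) (by positivity)).1 h'

lemma star_tensorFun (u : Lp ℂ 2 μ) (v : Lp ℂ 2 ν) :
    star (tensorFun u v) = tensorFun (star u) (star v) := by
  refine Lp.ext ?_
  filter_upwards [Lp.coeFn_star (tensorFun u v), coeFn_tensorFun u v,
    coeFn_tensorFun (star u) (star v), ae_fst (Lp.coeFn_star u), ae_snd (Lp.coeFn_star v)]
    with p h1 h2 h3 h4 h5
  rw [h1, h3, h4, h5, Pi.star_apply, h2]
  simp [mul_comm]

/-- The elementary tensor as a bounded bilinear map. -/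
def tensorL : Lp ℂ 2 μ →L[ℂ] Lp ℂ 2 ν →L[ℂ] Lp ℂ 2 (μ.prod ν) :=
  LinearMap.mkContinuous₂ (LinearMap.mk₂ ℂ (tensorFun (μ := μ) (ν := ν))
    (fun u u' v => by
      refine Lp.ext ?_
      filter_upwards [coeFn_tensorFun (u + u') v, coeFn_tensorFun u v, coeFn_tensorFun u' v,
        Lp.coeFn_add (tensorFun u v) (tensorFun u' v), ae_fst (Lp.coeFn_add u u')]
        with p h1 h2 h3 h4 h5
      simp only [Pi.add_apply] at h4 h5
      rw [h1, h4, h2, h3, h5, add_mul])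
    (fun c u v => by
      refine Lp.ext ?_
      filter_upwards [coeFn_tensorFun (c • u) v, coeFn_tensorFun u v,
        Lp.coeFn_smul c (tensorFun u v), ae_fst (Lp.coeFn_smul c u)] with p h1 h2 h3 h4
      simp only [Pi.smul_apply] at h3 h4
      rw [h1, h3, h2, h4, smul_mul_assoc])
    (fun u v v' => by
      refine Lp.ext ?_
      filter_upwards [coeFn_tensorFun u (v + v'), coeFn_tensorFun u v, coeFn_tensorFun u v',
        Lp.coeFn_add (tensorFun u v) (tensorFun u v'), ae_snd (Lp.coeFn_add v v')]
        with p h1 h2 h3 h4 h5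
      simp only [Pi.add_apply] at h4 h5
      rw [h1, h4, h2, h3, h5, mul_add])
    (fun c u v => by
      refine Lp.ext ?_
      filter_upwards [coeFn_tensorFun u (c • v), coeFn_tensorFun u v,
        Lp.coeFn_smul c (tensorFun u v), ae_snd (Lp.coeFn_smul c v)] with p h1 h2 h3 h4
      simp only [Pi.smul_apply] at h3 h4
      rw [h1, h3, h2, h4, mul_smul_comm])) 1
    (fun u v => by rw [LinearMap.mk₂_apply, norm_tensorFun, one_mul])

lemma tensorL_apply (u : Lp ℂ 2 μ) (v : Lp ℂ 2 ν) : tensorL u v = tensorFun u v := rfl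

/-- A function whose integrals over all rectangles of finite measure vanish is zero. -/
lemma ae_eq_zero_of_setIntegral_prod_eq_zero [SigmaFinite μ] [SigmaFinite ν] {G : X × Y → ℂ}
    (hG : ∀ S T, MeasurableSet S → MeasurableSet T → μ S < ∞ → ν T < ∞ →
      IntegrableOn G (S ×ˢ T) (μ.prod ν) ∧ ∫ p in S ×ˢ T, G p ∂(μ.prod ν) = 0) :
    G =ᵐ[μ.prod ν] 0 := by
  have hn : ∀ n, G =ᵐ[(μ.prod ν).restrict (spanningSets μ n ×ˢ spanningSets ν n)] 0 := by
    intro n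
    set A := spanningSets μ n
    set B := spanningSets ν n
    have hA : MeasurableSet A := measurableSet_spanningSets μ n
    have hB : MeasurableSet B := measurableSet_spanningSets ν n
    have hA' : μ A < ∞ := measure_spanningSets_lt_top μ n
    have hB' : ν B < ∞ := measure_spanningSets_lt_top ν n
    have hi : Integrable G ((μ.prod ν).restrict (A ×ˢ B)) := (hG A B hA hB hA' hB').1
    have h0 : ∫ p in A ×ˢ B, G p ∂(μ.prod ν) = 0 := (hG A B hA hB hA' hB').2
    refine hi.ae_eq_zero_of_forall_setIntegral_eq_zero fun s hs hfin => ?_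
    -- The induction passes through sets built from others, so the induction statement keeps only
    -- the integral.
    clear hfin
    -- Rectangles form a generating π-system. Complements are handled by the vanishing of the
    -- integral over the whole box `A × B`.
    induction s, hs using MeasurableSpace.induction_on_inter generateFrom_prod.symm
      isPiSystem_prod with
    | empty => simp
    | basic t ht =>
      obtain ⟨S, hS, T, hT, rfl⟩ := ht
      have hS : MeasurableSet S := hS
      have hT : MeasurableSet T := hT
      rw [Measure.restrict_restrict (hS.prod hT), Set.prod_inter_prod]
      exact (hG _ _ (hS.inter hA) (hT.inter hB) ((measure_mono Set.inter_subset_right).trans_lt hA')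
        ((measure_mono Set.inter_subset_right).trans_lt hB')).2
    | compl t ht IH =>
      have h1 := integral_add_compl ht hi
      rw [IH, h0, zero_add] at h1
      exact h1
    | iUnion f hd hf IH =>
      rw [integral_iUnion hf hd hi.integrableOn]
      exact (tsum_congr fun n => IH n).trans tsum_zero
  have hU : ⋃ n, spanningSets μ n ×ˢ spanningSets ν n = Set.univ := by
    rw [← Set.univ_prod_univ, ← iUnion_spanningSets μ, ← iUnion_spanningSets ν]
    exact Set.iUnion_prod_of_monotone (monotone_spanningSets μ) (monotone_spanningSets ν)
  have := (ae_restrict_iUnion_iff (μ := μ.prod ν)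
    (fun n => spanningSets μ n ×ˢ spanningSets ν n) (fun p => G p = 0)).2 hn
  rwa [hU, Measure.restrict_univ] at this

/-- Pairing with tensors of indicator functions yields the integrals over rectangles of finite
measure. -/
lemma eq_zero_of_inner_tensorFun_eq_zero [SigmaFinite μ] [SigmaFinite ν] {G : Lp ℂ 2 (μ.prod ν)}
    (hG : ∀ u v, ⟪tensorFun u v, G⟫_ℂ = 0) : G = 0 := by
  refine (Lp.eq_zero_iff_ae_eq_zero).2 (ae_eq_zero_of_setIntegral_prod_eq_zero ?_)
  intro S T hS hT hS' hT'
  have hST : (μ.prod ν) (S ×ˢ T) < ∞ := by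
    rw [Measure.prod_prod]; exact ENNReal.mul_lt_top hS' hT'
  refine ⟨integrableOn_Lp_of_measure_ne_top G (by norm_num) hST.ne, ?_⟩
  have h := hG (indicatorConstLp 2 hS hS'.ne 1) (indicatorConstLp 2 hT hT'.ne 1)
  rw [inner_eq_integral] at h
  rw [← h, ← integral_indicator (hS.prod hT)]
  refine integral_congr_ae ?_
  filter_upwards [coeFn_tensorFun (indicatorConstLp 2 hS hS'.ne 1)
    (indicatorConstLp 2 hT hT'.ne (1 : ℂ)),
    ae_fst (indicatorConstLp_coeFn (p := 2) (hs := hS) (hμs := hS'.ne) (c := (1 : ℂ))),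
    ae_snd (indicatorConstLp_coeFn (p := 2) (hs := hT) (hμs := hT'.ne) (c := (1 : ℂ)))]
    with p h1 h2 h3
  rw [h1, h2, h3]
  by_cases hp1 : p.1 ∈ S <;> by_cases hp2 : p.2 ∈ T <;> simp [Set.indicator, hp1, hp2]

end Tensor

/-! ### Orthonormal bases from tensor products -/

section TensorBasis

variable {I : Type*} {L : Type*} [NormedAddCommGroup L] [InnerProductSpace ℂ L] [CompleteSpace L]
  {H K : I → Type*} [∀ i, NormedAddCommGroup (H i)] [∀ i, InnerProductSpace ℂ (H i)]
  [∀ i, CompleteSpace (H i)]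
  [∀ i, NormedAddCommGroup (K i)] [∀ i, InnerProductSpace ℂ (K i)]
  [∀ i, CompleteSpace (K i)]
  {ι κ : I → Type*}

/-- Mutually orthogonal tensor product maps that are jointly total turn Hilbert bases into a
Hilbert basis. -/
lemma exists_hilbertBasis_tensor (T : ∀ i, H i →L[ℂ] K i →L[ℂ] L)
    (hT : ∀ i x y x' y', ⟪T i x y, T i x' y'⟫_ℂ = ⟪x, x'⟫_ℂ * ⟪y, y'⟫_ℂ)
    (hT' : ∀ i j x y x' y', i ≠ j → ⟪T i x y, T j x' y'⟫_ℂ = 0)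
    (htot : ∀ z, (∀ i x y, ⟪T i x y, z⟫_ℂ = 0) → z = 0)
    (b : ∀ i, HilbertBasis (ι i) ℂ (H i)) (c : ∀ i, HilbertBasis (κ i) ℂ (K i)) :
    ∃ B : HilbertBasis (Σ i, ι i × κ i) ℂ L, ∀ i m n, B ⟨i, m, n⟩ = T i (b i m) (c i n) := by
  classical
  set v : (Σ i, ι i × κ i) → L := fun p => T p.1 (b p.1 p.2.1) (c p.1 p.2.2) with hv
  have ho : Orthonormal ℂ v := by
    rw [orthonormal_iff_ite]
    rintro ⟨i, m, n⟩ ⟨j, m', n'⟩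
    by_cases hij : i = j
    · subst hij
      simp only [hv]
      rw [hT, orthonormal_iff_ite.1 (b i).orthonormal, orthonormal_iff_ite.1 (c i).orthonormal]
      by_cases h1 : m = m' <;> by_cases h2 : n = n' <;> simp [h1, h2]
    · simp only [hv]
      rw [hT' _ _ _ _ _ _ hij, if_neg]
      intro h
      exact hij (congrArg Sigma.fst h)
  have ht : (Submodule.span ℂ (Set.range v))ᗮ = ⊥ := by
    rw [Submodule.eq_bot_iff]
    intro z hz
    refine htot z fun i x y => ?_
    have h1 : ∀ m n, ⟪z, T i (b i m) (c i n)⟫_ℂ = 0 := by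
      intro m n
      rw [← inner_conj_symm, hz _ (Submodule.subset_span ⟨⟨i, m, n⟩, rfl⟩), map_zero]
    -- A bounded bilinear form vanishing on pairs of basis vectors vanishes identically: the second
    -- variable is freed first, then the first.
    have h2 : ∀ m, (innerSL ℂ z).comp (T i (b i m)) = 0 := fun m =>
      HilbertBasis.clm_ext (c i) fun n => by simpa using h1 m n
    have h3 : (innerSL ℂ z).comp ((T i).flip y) = 0 :=
      HilbertBasis.clm_ext (b i) fun m => by
        simpa using congrArg (fun A => A y) (h2 m)
    have h4 : ⟪z, T i x y⟫_ℂ = 0 := by simpa using congrArg (fun A => A x) h3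
    rw [← inner_conj_symm, h4, map_zero]
  exact ⟨HilbertBasis.mkOfOrthogonalEqBot ho ht, fun i m n => by
    rw [HilbertBasis.coe_mkOfOrthogonalEqBot]⟩

end TensorBasis

end AffPoincare

end

noncomputable section

namespace AffPoincare

open Filter Topology FourierTransform

section WeightedCompositionInverse

variable {Z X : Type*} [MeasurableSpace Z] [MeasurableSpace X] {ζ : Measure Z} {μ : Measure X}

lemma IsWeightedComp.toIsometry_toIsometry {W : Type*} [MeasurableSpace W] {η : Measure W}
    {w : Z → ℂ} {Ψ : Z → X} {w' : X → ℂ} {Ψ' : X → W}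
    (h : IsWeightedComp ζ μ w Ψ) (h' : IsWeightedComp μ η w' Ψ') (k : Lp ℂ 2 η) :
    h.toIsometry (h'.toIsometry k) =ᵐ[ζ] fun z => w z * (w' (Ψ z) * k (Ψ' (Ψ z))) :=
  (h.coeFn_toIsometry _).trans (h.congr_ae (h'.coeFn_toIsometry k))

end WeightedCompositionInverse

/-! ### Extending a unitary operator to a tensor product -/

section TensorExtension

lemma HilbertBasis.exists_unitary {ι H : Type*} [NormedAddCommGroup H] [InnerProductSpace ℂ H]
    [CompleteSpace H] (B B' : HilbertBasis ι ℂ H) : ∃ U : H ≃ₗᵢ[ℂ] H, ∀ k, U (B k) = B' k := by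
  classical
  refine ⟨B.repr.trans B'.repr.symm, fun k => ?_⟩
  rw [LinearIsometryEquiv.trans_apply, B.repr_self, B'.repr_symm_single]

lemma HilbertBasis.exists_image {ι H : Type*} [NormedAddCommGroup H] [InnerProductSpace ℂ H]
    [CompleteSpace H] (B : HilbertBasis ι ℂ H) (M : H ≃ₗᵢ[ℂ] H) :
    ∃ B' : HilbertBasis ι ℂ H, ∀ k, B' k = M (B k) := by
  classical
  refine ⟨HilbertBasis.ofRepr (M.symm.trans B.repr), fun k => ?_⟩
  rw [← HilbertBasis.repr_symm_single, ← HilbertBasis.repr_symm_single]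
  rfl

lemma HilbertBasis.inner_ext {ι H : Type*} [NormedAddCommGroup H] [InnerProductSpace ℂ H]
    [CompleteSpace H] (B : HilbertBasis ι ℂ H) (U : H ≃ₗᵢ[ℂ] H) {a b : H}
    (h : ∀ k, ⟪a, U (B k)⟫_ℂ = ⟪b, B k⟫_ℂ) (x : H) : ⟪a, U x⟫_ℂ = ⟪b, x⟫_ℂ := by
  have := HilbertBasis.clm_ext B
    (A := (innerSL ℂ a).comp (U.toLinearIsometry.toContinuousLinearMap)) (B := innerSL ℂ b)
    (fun k => by simpa using h k)
  simpa using DFunLike.congr_fun this x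

variable {X Y : Type*} [MeasurableSpace X] [MeasurableSpace Y] {μ : Measure X} {ν : Measure Y}
  [SigmaFinite μ] [SigmaFinite ν]

lemma exists_hilbertBasis_tensorFun {ι κ : Type*} (b : HilbertBasis ι ℂ (Lp ℂ 2 μ))
    (c : HilbertBasis κ ℂ (Lp ℂ 2 ν)) :
    ∃ B : HilbertBasis (Σ _ : Unit, ι × κ) ℂ (Lp ℂ 2 (μ.prod ν)),
      ∀ i m n, B ⟨i, m, n⟩ = tensorFun (b m) (c n) :=
  exists_hilbertBasis_tensor (I := Unit) (H := fun _ => Lp ℂ 2 μ) (K := fun _ => Lp ℂ 2 ν)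
    (fun _ => tensorL) (fun _ x y x' y' => inner_tensorFun x x' y y')
    (fun i j _ _ _ _ hij => absurd rfl hij)
    (fun z hz => eq_zero_of_inner_tensorFun_eq_zero fun u v => hz () u v) (fun _ => b) (fun _ => c)

/-- A unitary operator on `L² (μ)` that is symmetric for the bilinear pairing extends to
`L² (μ ⊗ ν)`, acting in the first variable. -/
lemma exists_tensor_extension (M : Lp ℂ 2 μ ≃ₗᵢ[ℂ] Lp ℂ 2 μ)
    (hM : ∀ w u, ⟪star (M w), u⟫_ℂ = ⟪star w, M u⟫_ℂ) :
    ∃ U : Lp ℂ 2 (μ.prod ν) ≃ₗᵢ[ℂ] Lp ℂ 2 (μ.prod ν),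
      ∀ G u v, ⟪star (tensorFun u v), U G⟫_ℂ = ⟪star (tensorFun (M u) v), G⟫_ℂ := by
  -- `U` is the unitary that carries the basis `eₘ ⊗ fₙ` to the basis `M eₘ ⊗ fₙ`.
  obtain ⟨b', hb'⟩ := HilbertBasis.exists_image (onb (Lp ℂ 2 μ)) M
  obtain ⟨B, hB⟩ := exists_hilbertBasis_tensorFun (onb (Lp ℂ 2 μ)) (onb (Lp ℂ 2 ν))
  obtain ⟨B', hB'⟩ := exists_hilbertBasis_tensorFun b' (onb (Lp ℂ 2 ν))
  obtain ⟨U, hU⟩ := HilbertBasis.exists_unitary B B'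
  refine ⟨U, fun G u v => HilbertBasis.inner_ext B U ?_ G⟩
  rintro ⟨i, m, n⟩
  rw [hU, hB, hB', hb', star_tensorFun, star_tensorFun, inner_tensorFun, inner_tensorFun, hM]

end TensorExtension

/-! ### The Minkowski–Fourier transform on `L²` of the plane -/

/-- The map `(x₁, x₂) ↦ (c x₁, -c x₂)`. -/
def scaledRefl (c : ℝ) : Plane →ₗ[ℝ] Plane := Matrix.toEuclideanLin !![c, 0; 0, -c]

lemma scaledRefl_apply_zero (c : ℝ) (x : Plane) : scaledRefl c x 0 = c * x 0 := by
  simp [scaledRefl, Matrix.toEuclideanLin, Matrix.toLpLin, dotProduct, Fin.sum_univ_two]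

lemma scaledRefl_apply_one (c : ℝ) (x : Plane) : scaledRefl c x 1 = -c * x 1 := by
  simp [scaledRefl, Matrix.toEuclideanLin, Matrix.toLpLin, dotProduct, Fin.sum_univ_two]

lemma det_scaledRefl (c : ℝ) : LinearMap.det (scaledRefl c) = -c ^ 2 := by
  rw [scaledRefl, Matrix.toEuclideanLin, LinearMap.det_toLpLin, Matrix.det_fin_two_of]
  ring

/-- The map has Jacobian `c²` in absolute value, which the squared weight cancels. -/
lemma isWeightedComp_scaledRefl {c : ℝ} (hc : 0 < c) :
    IsWeightedComp (volume : Measure Plane) (volume : Measure Plane) (fun _ => (c : ℂ))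
      (scaledRefl c) where
  measurable_weight := measurable_const
  measurable_map := (scaledRefl c).continuous_of_finiteDimensional.measurable
  map_eq := by
    have hdet : LinearMap.det (scaledRefl c) ≠ 0 := by rw [det_scaledRefl]; simp [hc.ne']
    rw [withDensity_const, Measure.map_smul,
      Measure.map_linearMap_addHaar_eq_smul_addHaar (volume : Measure Plane) hdet, smul_smul,
      det_scaledRefl, inv_neg, abs_neg, abs_of_pos (by positivity)]
    have : ‖(c : ℂ)‖ₑ = ENNReal.ofReal c := by
      rw [← ofReal_norm, Complex.norm_real, Real.norm_of_nonneg hc.le]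
    rw [this, ← ENNReal.ofReal_pow hc.le, ← ENNReal.ofReal_mul (by positivity),
      mul_inv_cancel₀ (by positivity), ENNReal.ofReal_one, one_smul]

/-- The dilated reflection on `L²`. -/
def scaledReflLp {c : ℝ} (hc : 0 < c) : L2Plane ≃ₗᵢ[ℂ] L2Plane :=
  LinearIsometryEquiv.ofSurjective (isWeightedComp_scaledRefl hc).toIsometry fun k => by
    refine ⟨(isWeightedComp_scaledRefl (inv_pos.2 hc)).toIsometry k, Lp.ext ?_⟩
    refine (IsWeightedComp.toIsometry_toIsometry _ _ k).trans (Eventually.of_forall fun x => ?_)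
    have : scaledRefl c⁻¹ (scaledRefl c x) = x := by
      ext i
      fin_cases i
      · simp [scaledRefl_apply_zero, hc.ne']
      · simp [scaledRefl_apply_one, hc.ne']
    have hc' : (c : ℂ) ≠ 0 := by exact_mod_cast hc.ne'
    simp only [this]
    push_cast
    rw [← mul_assoc, mul_inv_cancel₀ hc', one_mul]

/-- The inverse Minkowski–Fourier integral. -/
def minkInt (f : Plane → ℂ) (x : Plane) : ℂ :=
  (1 / (2 * Real.pi) : ℝ) * ∫ ξ : Plane, Complex.exp (-(Complex.I * mink ξ x)) * f ξ

lemma inv_two_pi_pos : 0 < 1 / (2 * Real.pi) := by positivity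

/-- The reflection changes the Minkowski form into the Euclidean one, and the dilation by `1 / 2π`
absorbs the `2π` in the exponent of the usual Fourier transform. -/
lemma mink_eq_inner (x y : Plane) :
    mink x y = 2 * Real.pi * ⟪x, scaledRefl (1 / (2 * Real.pi)) y⟫_ℝ := by
  have := Real.pi_ne_zero
  simp [mink, PiLp.inner_apply, Fin.sum_univ_two, scaledRefl_apply_zero, scaledRefl_apply_one]
  field_simp
  ring

lemma minkInt_eq_fourier (f : Plane → ℂ) (x : Plane) :
    minkInt f x = (1 / (2 * Real.pi) : ℝ) * 𝓕 f (scaledRefl (1 / (2 * Real.pi)) x) := by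
  rw [minkInt, Real.fourier_eq']
  congr 2
  ext ξ
  rw [mink_eq_inner, smul_eq_mul]
  congr 2
  push_cast; ring

/-- Fubini, together with the symmetry of the Minkowski form in its two arguments. -/
lemma integral_minkInt_mul (f g : Plane → ℂ) (hf : Integrable f) (hg : Integrable g) :
    ∫ x, minkInt f x * g x = ∫ x, f x * minkInt g x := by
  set L : Plane →ₗ[ℝ] Plane →ₗ[ℝ] ℝ :=
    (innerₗ Plane).compl₂ (scaledRefl (1 / (2 * Real.pi))) with hL
  have hL' : ∀ x y, L x y = ⟪x, scaledRefl (1 / (2 * Real.pi)) y⟫_ℝ := fun x y => rfl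
  have hflip : L.flip = L := by
    ext x y
    simp only [LinearMap.flip_apply, hL', PiLp.inner_apply, Fin.sum_univ_two, scaledRefl_apply_zero,
      scaledRefl_apply_one]
    simp
    ring
  have hcont : Continuous fun p : Plane × Plane => L p.1 p.2 := by
    have := (scaledRefl (1 / (2 * Real.pi))).continuous_of_finiteDimensional
    simp only [hL']
    fun_prop
  have h := VectorFourier.integral_fourierIntegral_smul_eq_flip (μ := (volume : Measure Plane))
    (ν := (volume : Measure Plane)) Real.continuous_fourierChar hcont hf hg
  rw [hflip] at h
  have e : ∀ (f : Plane → ℂ) x, minkInt f x = (1 / (2 * Real.pi) : ℝ) *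
      VectorFourier.fourierIntegral Real.fourierChar volume L f x := by
    intro f x
    rw [minkInt_eq_fourier]
    rfl
  simp only [e, mul_assoc, integral_const_mul, mul_left_comm _ ((1 / (2 * Real.pi) : ℝ) : ℂ)]
  congr 1

/-- The inverse Minkowski–Fourier transform on `L²`. -/
def minkL2 : L2Plane ≃ₗᵢ[ℂ] L2Plane :=
  (Lp.fourierTransformₗᵢ Plane ℂ).trans (scaledReflLp inv_two_pi_pos)

lemma coeFn_schwartz (u : 𝓢(Plane, ℂ)) :
    (u.toLp 2 (volume : Measure Plane) : L2Plane) =ᵐ[volume] u :=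
  u.coeFn_toLp 2 volume

lemma minkL2_toLp (u : 𝓢(Plane, ℂ)) : minkL2 (u.toLp 2) =ᵐ[volume] minkFourierInv u := by
  have h1 : Lp.fourierTransformₗᵢ Plane ℂ (u.toLp 2) = (𝓕 u).toLp 2 := SchwartzMap.toLp_fourier_eq u
  have h2 := (isWeightedComp_scaledRefl inv_two_pi_pos).coeFn_toIsometry ((𝓕 u).toLp 2)
  have h3 := (isWeightedComp_scaledRefl inv_two_pi_pos).congr_ae (coeFn_schwartz (𝓕 u))
  have h4 : minkL2 (u.toLp 2) =
      (isWeightedComp_scaledRefl inv_two_pi_pos).toIsometry ((𝓕 u).toLp 2) := by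
    rw [← h1]; rfl
  rw [h4]
  refine h2.trans (h3.trans (Eventually.of_forall fun x => ?_))
  change _ = minkInt u x
  rw [minkInt_eq_fourier, SchwartzMap.fourier_coe]

lemma eq_of_schwartz {F G : L2Plane → ℂ} (hF : Continuous F) (hG : Continuous G)
    (h : ∀ u : 𝓢(Plane, ℂ), F (u.toLp 2) = G (u.toLp 2)) (u : L2Plane) : F u = G u := by
  have hd : DenseRange (SchwartzMap.toLpCLM ℝ ℂ 2 (volume : Measure Plane)) :=
    SchwartzMap.denseRange_toLpCLM (by simp)
  exact congrFun (hd.equalizer hF hG (funext h)) u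

/-- For Schwartz functions this is the Fubini identity for the integral transform; density then
extends it one argument at a time. -/
lemma inner_star_minkL2 (w u : L2Plane) : ⟪star (minkL2 w), u⟫_ℂ = ⟪star w, minkL2 u⟫_ℂ := by
  have h1 : ∀ w u : 𝓢(Plane, ℂ),
      ⟪star (minkL2 (w.toLp 2)), u.toLp 2⟫_ℂ = ⟪star (w.toLp 2), minkL2 (u.toLp 2)⟫_ℂ := by
    intro w u
    rw [inner_star_eq_integral, inner_star_eq_integral]
    have h := integral_minkInt_mul w u w.integrable u.integrable
    refine Eq.trans (integral_congr_ae ?_) (h.trans (integral_congr_ae ?_))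
    · filter_upwards [minkL2_toLp w, coeFn_schwartz u] with x h1 h2
      rw [h1, h2]; rfl
    · filter_upwards [minkL2_toLp u, coeFn_schwartz w] with x h1 h2
      rw [h1, h2]; rfl
  have h2 : ∀ (w : 𝓢(Plane, ℂ)) (u : L2Plane),
      ⟪star (minkL2 (w.toLp 2)), u⟫_ℂ = ⟪star (w.toLp 2), minkL2 u⟫_ℂ := fun w =>
    eq_of_schwartz (continuous_const.inner continuous_id)
      (continuous_const.inner minkL2.continuous) (h1 w)
  have h3 := eq_of_schwartz (F := fun w => ⟪star u, minkL2 w⟫_ℂ)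
    (G := fun w => ⟪star (minkL2 u), w⟫_ℂ) (continuous_const.inner minkL2.continuous)
    (continuous_const.inner continuous_id) (fun w => by
      rw [inner_star_comm, inner_star_comm (minkL2 u)]; exact h2 w u) w
  rw [inner_star_comm, inner_star_comm w]
  exact h3

/-! ### The partial transform in the first variable -/

section Partial

variable {Y : Type} [MeasurableSpace Y] (ν : Measure Y) [SigmaFinite ν]

/-- The inverse Minkowski–Fourier transform in the first variable on `L²`. -/
def partialMink :
    Lp ℂ 2 ((volume : Measure Plane).prod ν) ≃ₗᵢ[ℂ] Lp ℂ 2 ((volume : Measure Plane).prod ν) :=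
  (exists_tensor_extension (ν := ν) minkL2 inner_star_minkL2).choose

lemma inner_star_partialMink (G : Lp ℂ 2 ((volume : Measure Plane).prod ν)) (u : L2Plane)
    (v : Lp ℂ 2 ν) :
    ⟪star (tensorFun u v), partialMink ν G⟫_ℂ = ⟪star (tensorFun (minkL2 u) v), G⟫_ℂ :=
  (exists_tensor_extension (ν := ν) minkL2 inner_star_minkL2).choose_spec G u v

variable {ν}

lemma integral_Lp_mul_tensor (F : Lp ℂ 2 ((volume : Measure Plane).prod ν))
    {u : Plane → ℂ} {v : Y → ℂ} {u' : L2Plane} {v' : Lp ℂ 2 ν} (hu : u' =ᵐ[volume] u)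
    (hv : v' =ᵐ[ν] v) :
    ∫ p, F p * (u p.1 * v p.2) ∂((volume : Measure Plane).prod ν) =
      ⟪star (tensorFun u' v'), F⟫_ℂ := by
  rw [inner_star_eq_integral]
  refine integral_congr_ae ?_
  filter_upwards [coeFn_tensorFun u' v', ae_fst hu, ae_snd hv] with p h2 h3 h4
  rw [h2, h3, h4, mul_comm]

lemma integral_mul_tensor {G : Plane × Y → ℂ} (hG : MemLp G 2 ((volume : Measure Plane).prod ν))
    {u : Plane → ℂ} {v : Y → ℂ} {u' : L2Plane} {v' : Lp ℂ 2 ν} (hu : u' =ᵐ[volume] u)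
    (hv : v' =ᵐ[ν] v) :
    ∫ p, G p * (u p.1 * v p.2) ∂((volume : Measure Plane).prod ν) =
      ⟪star (tensorFun u' v'), hG.toLp⟫_ℂ := by
  rw [← integral_Lp_mul_tensor hG.toLp hu hv]
  refine integral_congr_ae ?_
  filter_upwards [hG.coeFn_toLp] with p h1
  rw [h1]

lemma eq_of_inner_schwartz_tensor {Z Z' : Lp ℂ 2 ((volume : Measure Plane).prod ν)}
    (h : ∀ (u : 𝓢(Plane, ℂ)) (v : Lp ℂ 2 ν),
      ⟪star (tensorFun (u.toLp 2) v), Z⟫_ℂ = ⟪star (tensorFun (u.toLp 2) v), Z'⟫_ℂ) : Z = Z' := by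
  rw [← sub_eq_zero]
  refine eq_zero_of_inner_tensorFun_eq_zero fun u v => ?_
  rw [inner_sub_right, sub_eq_zero, ← star_star (tensorFun u v), star_tensorFun,
    inner_star_comm, inner_star_comm _ Z']
  refine eq_of_schwartz (F := fun u => ⟪star Z, tensorL u (star v)⟫_ℂ)
    (G := fun u => ⟪star Z', tensorL u (star v)⟫_ℂ)
    (continuous_const.inner (tensorL.flip (star v)).continuous)
    (continuous_const.inner (tensorL.flip (star v)).continuous) (fun u => ?_) (star u)
  rw [tensorL_apply, inner_star_comm, inner_star_comm Z']
  exact h u _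

/-- The unitary partial transform satisfies the transposition formula, so the chosen function
satisfies it too. Tensors with a Schwartz first factor are total, so the formula has at most one
solution up to null sets. -/
lemma partialFourierInv_ae_eq {G : Plane × Y → ℂ}
    (hG : MemLp G 2 ((volume : Measure Plane).prod ν)) :
    MemLp (partialFourierInv ν G) 2 ((volume : Measure Plane).prod ν) ∧
    partialFourierInv ν G =ᵐ[(volume : Measure Plane).prod ν] partialMink ν hG.toLp := by
  obtain ⟨F, hF⟩ : ∃ F, F = partialMink ν hG.toLp := ⟨_, rfl⟩
  have hF' : ∀ u v, ⟪star (tensorFun u v), F⟫_ℂ = ⟪star (tensorFun (minkL2 u) v), hG.toLp⟫_ℂ :=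
    fun u v => by rw [hF, inner_star_partialMink]
  rw [← hF]
  have hex : IsPartialFourierInv ν G F := by
    refine ⟨Lp.memLp _, fun u v hv => ?_⟩
    have e1 := integral_mul_tensor hG (minkL2_toLp u) hv.coeFn_toLp
    have e2 := integral_Lp_mul_tensor F (coeFn_schwartz u) hv.coeFn_toLp
    rw [e1, e2, hF']
  have hspec : IsPartialFourierInv ν G (partialFourierInv ν G) :=
    Classical.epsilon_spec (p := fun G' => IsPartialFourierInv ν G G') ⟨_, hex⟩
  obtain ⟨hm, hspec⟩ := hspec
  generalize partialFourierInv ν G = G' at hm hspec ⊢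
  refine ⟨hm, ?_⟩
  have h1 : ∀ (u : 𝓢(Plane, ℂ)) (v : Lp ℂ 2 ν), ⟪star (tensorFun (u.toLp 2) v), hm.toLp⟫_ℂ =
      ⟪star (tensorFun (u.toLp 2) v), F⟫_ℂ := by
    intro u v
    have e1 := hspec u v (Lp.memLp v)
    have e2 := integral_mul_tensor hG (minkL2_toLp u) (EventuallyEq.refl _ v)
    have e3 := integral_mul_tensor hm (coeFn_schwartz u) (EventuallyEq.refl _ v)
    rw [hF', ← e2, ← e1, ← e3]
  rw [← eq_of_inner_schwartz_tensor h1]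
  exact hm.coeFn_toLp.symm

end Partial

end AffPoincare

end

noncomputable section

namespace AffPoincare

open Filter Topology

/-! ### Partial transforms given by absolutely convergent integrals -/

section Fiber

variable {Y : Type} [MeasurableSpace Y] {ν : Measure Y} [SigmaFinite ν]

lemma continuous_mink : Continuous fun p : Plane × Plane => mink p.1 p.2 := by
  unfold mink; fun_prop

lemma norm_exp_mink (ξ x : Plane) : ‖Complex.exp (-(Complex.I * mink ξ x))‖ = 1 := by
  rw [show -(Complex.I * (mink ξ x : ℂ)) = ((-mink ξ x : ℝ) : ℂ) * Complex.I by push_cast; ring,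
    Complex.norm_exp_ofReal_mul_I]

lemma stronglyMeasurable_minkInt_fiber {G : Plane × Y → ℂ} (hm : Measurable G) :
    StronglyMeasurable fun p : Plane × Y => minkInt (fun x => G (x, p.2)) p.1 := by
  unfold minkInt
  refine StronglyMeasurable.mul stronglyMeasurable_const ?_
  have h1 : Measurable fun z : (Plane × Y) × Plane => Complex.exp (-(Complex.I * mink z.2 z.1.1)) := by
    have : Measurable fun z : (Plane × Y) × Plane => mink z.2 z.1.1 :=
      continuous_mink.measurable.comp (measurable_snd.prodMk (measurable_fst.comp measurable_fst))
    fun_prop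
  have h2 : Measurable fun z : (Plane × Y) × Plane => G (z.2, z.1.2) :=
    hm.comp (measurable_snd.prodMk (measurable_snd.comp measurable_fst))
  exact (h1.mul h2).stronglyMeasurable.integral_prod_right'

lemma norm_minkInt_le (f : Plane → ℂ) (x : Plane) : ‖minkInt f x‖ ≤ ∫ y, ‖f y‖ := by
  rw [minkInt, norm_mul]
  have h1 : ‖((1 / (2 * Real.pi) : ℝ) : ℂ)‖ ≤ 1 := by
    rw [Complex.norm_real, Real.norm_of_nonneg (by positivity), div_le_one (by positivity)]
    linarith [Real.pi_gt_three]
  have h2 : ‖∫ ξ : Plane, Complex.exp (-(Complex.I * mink ξ x)) * f ξ‖ ≤ ∫ y, ‖f y‖ := by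
    refine (norm_integral_le_integral_norm _).trans_eq (integral_congr_ae ?_)
    exact Eventually.of_forall fun ξ => by simp only [norm_mul, norm_exp_mink, one_mul]
  calc _ ≤ 1 * ∫ y, ‖f y‖ := mul_le_mul h1 h2 (norm_nonneg _) zero_le_one
    _ = _ := one_mul _

lemma memLp_minkFourierInv (u : 𝓢(Plane, ℂ)) : MemLp (minkFourierInv u) 2 volume :=
  (memLp_congr_ae (minkL2_toLp u)).1 (Lp.memLp _)

/-- Two functions with the same pairings against tensors of test functions and indicators agree. -/
lemma ae_eq_zero_of_integral_schwartz_indicator {X : Plane × Y → ℂ}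
    (hX : ∀ S T, MeasurableSet S → MeasurableSet T → (volume : Measure Plane) S < ∞ → ν T < ∞ →
      IntegrableOn X (S ×ˢ T) ((volume : Measure Plane).prod ν))
    (h : ∀ (u : 𝓢(Plane, ℂ)) (T : Set Y), HasCompactSupport u → MeasurableSet T → ν T < ∞ →
      ∫ p, X p * (u p.1 * T.indicator 1 p.2) ∂((volume : Measure Plane).prod ν) = 0)
    (hi : ∀ (u : 𝓢(Plane, ℂ)) (T : Set Y), HasCompactSupport u → MeasurableSet T → ν T < ∞ →
      Integrable (fun p => X p * (u p.1 * T.indicator 1 p.2)) ((volume : Measure Plane).prod ν)) :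
    X =ᵐ[(volume : Measure Plane).prod ν] 0 := by
  refine ae_eq_zero_of_setIntegral_prod_eq_zero fun S T hS hT hS' hT' =>
    ⟨hX S T hS hT hS' hT', ?_⟩
  -- Integrating out `T` leaves a locally integrable function on the plane that annihilates all
  -- smooth functions of compact support.
  have hN : ∀ᵐ ξ ∂(volume : Measure Plane), ∫ y in T, X (ξ, y) ∂ν = 0 := by
    refine ae_eq_zero_of_integral_contDiff_smul_eq_zero ?_ ?_
    · rw [MeasureTheory.locallyIntegrable_iff]
      intro K hK
      have h1 := hX K T hK.measurableSet hT hK.measure_lt_top hT'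
      rw [IntegrableOn, ← Measure.prod_restrict] at h1
      exact h1.integral_prod_left
    · intro g hg hgc
      have hgc' : HasCompactSupport fun x => (g x : ℂ) := hgc.comp_left (g := fun r : ℝ => (r : ℂ)) (by simp)
      have hgd : ContDiff ℝ ((⊤ : ℕ∞) : WithTop ℕ∞) fun x => (g x : ℂ) := Complex.ofRealCLM.contDiff.comp hg
      obtain ⟨u, hu⟩ : ∃ u : 𝓢(Plane, ℂ), ∀ x, u x = (g x : ℂ) :=
        ⟨hgc'.toSchwartzMap hgd, fun x => rfl⟩
      have huc : HasCompactSupport u := by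
        rw [show (u : Plane → ℂ) = fun x => (g x : ℂ) from funext hu]; exact hgc'
      have e := h u T huc hT hT'
      rw [integral_prod _ (hi u T huc hT hT')] at e
      simp only [hu] at e
      rw [← e]
      refine integral_congr_ae (Eventually.of_forall fun x => ?_)
      change g x • ∫ y in T, X (x, y) ∂ν = ∫ y, X (x, y) * ((g x : ℂ) * T.indicator 1 y) ∂ν
      rw [← integral_indicator hT, ← integral_smul]
      refine integral_congr_ae (Eventually.of_forall fun y => ?_)
      by_cases hy : y ∈ T <;> simp [hy, mul_comm]
  rw [setIntegral_prod _ (hX S T hS hT hS' hT')]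
  rw [integral_congr_ae (ae_restrict_of_ae hN)]
  simp

/-- On functions with uniformly integrable fibers the `L²` transform is given by the integral. -/
lemma partialMink_ae_eq_of_fiber {G : Plane × Y → ℂ} (hm : Measurable G)
    (hG : MemLp G 2 ((volume : Measure Plane).prod ν)) (C : ℝ)
    (hC : ∀ y, Integrable (fun x => G (x, y)) ∧ ∫ x, ‖G (x, y)‖ ≤ C) :
    partialMink ν hG.toLp =ᵐ[(volume : Measure Plane).prod ν]
      fun p => minkInt (fun x => G (x, p.2)) p.1 := by
  obtain ⟨F, hF⟩ : ∃ F, F = partialMink ν hG.toLp := ⟨_, rfl⟩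
  have hF' : ∀ u v, ⟪star (tensorFun u v), F⟫_ℂ = ⟪star (tensorFun (minkL2 u) v), hG.toLp⟫_ℂ :=
    fun u v => by rw [hF, inner_star_partialMink]
  rw [← hF]
  set J : Plane × Y → ℂ := fun p => minkInt (fun x => G (x, p.2)) p.1 with hJ
  have hJm : StronglyMeasurable J := stronglyMeasurable_minkInt_fiber hm
  have hJb : ∀ p, ‖J p‖ ≤ C := fun p => (norm_minkInt_le _ _).trans (hC p.2).2
  have hind : ∀ T : Set Y, MeasurableSet T → ν T < ∞ → MemLp (T.indicator (1 : Y → ℂ)) 2 ν :=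
    fun T hT hT' => memLp_indicator_const 2 hT 1 (Or.inr hT'.ne)
  have hFi : ∀ (u : 𝓢(Plane, ℂ)) (T : Set Y), MeasurableSet T → ν T < ∞ →
      Integrable (fun p => F p * (u p.1 * T.indicator 1 p.2)) ((volume : Measure Plane).prod ν) :=
    fun u T hT hT' => (Lp.memLp F).integrable_mul (memLp_two_mul_prod (u.memLp 2) (hind T hT hT'))
  have hti : ∀ (u : 𝓢(Plane, ℂ)) (T : Set Y), MeasurableSet T → ν T < ∞ →
      Integrable (fun p : Plane × Y => u p.1 * T.indicator (1 : Y → ℂ) p.2)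
        ((volume : Measure Plane).prod ν) := fun u T hT hT' =>
    u.integrable.mul_prod ((integrable_indicator_iff hT).2 (integrableOn_const hT'.ne))
  have hJi : ∀ (u : 𝓢(Plane, ℂ)) (T : Set Y), MeasurableSet T → ν T < ∞ →
      Integrable (fun p => J p * (u p.1 * T.indicator 1 p.2)) ((volume : Measure Plane).prod ν) :=
    fun u T hT hT' => (hti u T hT hT').bdd_mul hJm.aestronglyMeasurable (Eventually.of_forall hJb)
  have hkey : ∀ (u : 𝓢(Plane, ℂ)) (T : Set Y), MeasurableSet T → ν T < ∞ →
      ∫ p, J p * (u p.1 * T.indicator 1 p.2) ∂((volume : Measure Plane).prod ν) =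
        ∫ p, F p * (u p.1 * T.indicator 1 p.2) ∂((volume : Measure Plane).prod ν) := by
    intro u T hT hT'
    have e1 := integral_mul_tensor hG (minkL2_toLp u) (hind T hT hT').coeFn_toLp
    have e2 := integral_Lp_mul_tensor F (coeFn_schwartz u) (hind T hT hT').coeFn_toLp
    have hGi : Integrable (fun p => G p * (minkFourierInv u p.1 * T.indicator 1 p.2))
        ((volume : Measure Plane).prod ν) :=
      hG.integrable_mul (memLp_two_mul_prod (memLp_minkFourierInv u) (hind T hT hT'))
    -- With `Y` as the outer variable, the transposition formula for integrable functions applies on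
    -- each fibre.
    rw [e2, hF', ← e1, integral_prod_symm _ (hJi u T hT hT'), integral_prod_symm _ hGi]
    refine integral_congr_ae (Eventually.of_forall fun y => ?_)
    have e3 := integral_minkInt_mul (fun x => G (x, y)) u (hC y).1 u.integrable
    simp only [← mul_assoc, integral_mul_const]
    congr 1
  have hres : (fun p => J p - F p) =ᵐ[(volume : Measure Plane).prod ν] 0 := by
    refine ae_eq_zero_of_integral_schwartz_indicator ?_ ?_ ?_
    · intro S T hS hT hS' hT'
      have hST : ((volume : Measure Plane).prod ν) (S ×ˢ T) < ∞ := by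
        rw [Measure.prod_prod]; exact ENNReal.mul_lt_top hS' hT'
      refine Integrable.sub ?_ (integrableOn_Lp_of_measure_ne_top F (by norm_num) hST.ne)
      have := Measure.integrableOn_of_bounded hST.ne hJm.aestronglyMeasurable
        (Eventually.of_forall hJb)
      exact this
    · intro u T _ hT hT'
      simp only [sub_mul]
      rw [integral_sub (hJi u T hT hT') (hFi u T hT hT'), hkey u T hT hT', sub_self]
    · intro u T _ hT hT'
      simp only [sub_mul]
      exact (hJi u T hT hT').sub (hFi u T hT hT')
  filter_upwards [hres] with p hp
  exact (sub_eq_zero.1 hp).symm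

end Fiber

end AffPoincare

end

noncomputable section

namespace AffPoincare

open Filter Topology

/-! ### Hyperbolic polar coordinates on a cone -/

section ConeCoordinates

lemma dilRotMap_apply_zero (y : DilRot) (x : Plane) :
    dilRotMap y x 0 = y.1 * (Real.cosh y.2 * x 0 - Real.sinh y.2 * x 1) := by
  simp [dilRotMap, hypRot_apply_zero, sub_eq_add_neg]

lemma dilRotMap_apply_one (y : DilRot) (x : Plane) :
    dilRotMap y x 1 = y.1 * (Real.cosh y.2 * x 1 - Real.sinh y.2 * x 0) := by
  simp [dilRotMap, hypRot_apply_one, neg_add_eq_sub]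

lemma mink_dilRotMap (y : DilRot) (x : Plane) :
    mink (dilRotMap y x) (dilRotMap y x) = (y.1 : ℝ) ^ 2 * mink x x := by
  simp only [mink, dilRotMap_apply_zero, dilRotMap_apply_one]
  linear_combination (y.1 : ℝ) ^ 2 * (x 0 * x 0 - x 1 * x 1) * Real.cosh_sq y.2

lemma mink_self_ne_zero {i : Fin 2 × Fin 2} {x : Plane} (h : x ∈ cone i) : mink x x ≠ 0 := by
  obtain ⟨i, j⟩ := i
  unfold mink
  fin_cases i <;> fin_cases j <;>
    simp only [cone, Set.mem_ofPred_eq, Fin.isValue, Fin.mk_zero, Fin.mk_one, Fin.zero_eta] at h <;>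
    nlinarith [h.1]

lemma dilParam_dilRotMap {x : Plane} (hx : mink x x ≠ 0) (y : DilRot) :
    dilParam x (dilRotMap y x) = y.1 := by
  have ha : 0 < (y.1 : ℝ) := y.1.2
  rw [dilParam, mink_dilRotMap, mul_div_cancel_right₀ _ hx, Real.sqrt_sq ha.le]

lemma rotParam_dilRotMap {x : Plane} (hx : mink x x ≠ 0) (y : DilRot) :
    rotParam x (dilRotMap y x) = y.2 := by
  have ha : 0 < (y.1 : ℝ) := y.1.2
  rw [rotParam, dilParam_dilRotMap hx, dilRotMap_apply_zero, dilRotMap_apply_one]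
  rw [show (x 1 * (↑y.1 * (Real.cosh y.2 * x 0 - Real.sinh y.2 * x 1)) -
      x 0 * (↑y.1 * (Real.cosh y.2 * x 1 - Real.sinh y.2 * x 0))) =
      Real.sinh y.2 * ((y.1 : ℝ) * mink x x) by unfold mink; ring,
    mul_div_cancel_right₀ _ (mul_ne_zero ha.ne' hx), Real.arsinh_sinh]

/-- The parameters `(c, t)` with `ξ = c Λ_{-t} x`, extended to all pairs of points. -/
def coneParam (p : Plane × Plane) : DilRot :=
  (⟨if 0 < dilParam p.1 p.2 then dilParam p.1 p.2 else 1, by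
    split_ifs with h
    · exact h
    · exact (one_pos : (0 : ℝ) < 1)⟩, rotParam p.1 p.2)

lemma coneParam_dilRotMap {x : Plane} (hx : mink x x ≠ 0) (y : DilRot) :
    coneParam (x, dilRotMap y x) = y := by
  have ha : 0 < (y.1 : ℝ) := y.1.2
  refine Prod.ext (Subtype.ext ?_) ?_
  · simp [coneParam, dilParam_dilRotMap hx, ha]
  · simp [coneParam, rotParam_dilRotMap hx]

lemma coneParam_eq {x ξ : Plane} (h : ∃ i, x ∈ cone i ∧ ξ ∈ cone i) :
    coneParam (x, ξ) = (⟨dilParam x ξ, dilParam_pos h⟩, rotParam x ξ) :=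
  Prod.ext (Subtype.ext (by simp [coneParam, dilParam_pos h])) rfl

lemma dilRotMap_coneParam {i : Fin 2 × Fin 2} {x ξ : Plane} (hx : x ∈ cone i) (hξ : ξ ∈ cone i) :
    dilRotMap (coneParam (x, ξ)) x = ξ := by
  rw [coneParam_eq ⟨i, hx, hξ⟩, dilRotMap_param ⟨i, hx, hξ⟩]

lemma measurable_mink : Measurable fun p : Plane × Plane => mink p.1 p.2 :=
  continuous_mink.measurable

lemma measurable_mink_self : Measurable fun p : Plane => mink p p :=
  measurable_mink.comp (measurable_id.prodMk measurable_id)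

lemma measurable_coneParam : Measurable coneParam := by
  have h1 : Measurable fun p : Plane × Plane => dilParam p.1 p.2 :=
    ((measurable_mink_self.comp measurable_snd).div
      (measurable_mink_self.comp measurable_fst)).sqrt
  have c : ∀ k : Fin 2, Measurable fun x : Plane => x k := fun k => by fun_prop
  have h2 : Measurable fun p : Plane × Plane => rotParam p.1 p.2 := by
    refine Real.continuous_arsinh.measurable.comp
      (Measurable.div ?_ (h1.mul (measurable_mink_self.comp measurable_fst)))
    exact (((c 1).comp measurable_fst).mul ((c 0).comp measurable_snd)).sub
      (((c 0).comp measurable_fst).mul ((c 1).comp measurable_snd))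
  exact (Measurable.subtype_mk (Measurable.ite (measurableSet_lt measurable_const h1) h1
    measurable_const)).prodMk h2

lemma continuous_dilRotMap : Continuous fun p : Plane × DilRot => dilRotMap p.2 p.1 := by
  have h : (fun p : Plane × DilRot => dilRotMap p.2 p.1) = fun p : Plane × DilRot =>
      !₂[(p.2.1 : ℝ) * (Real.cosh p.2.2 * p.1 0 - Real.sinh p.2.2 * p.1 1),
        (p.2.1 : ℝ) * (Real.cosh p.2.2 * p.1 1 - Real.sinh p.2.2 * p.1 0)] := by
    ext p k
    fin_cases k
    · simp [dilRotMap_apply_zero]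
    · simp [dilRotMap_apply_one]
  rw [h]
  refine (PiLp.continuous_toLp 2 (fun _ : Fin 2 => ℝ)).comp (continuous_pi fun k => ?_)
  have := Real.continuous_cosh
  have := Real.continuous_sinh
  fin_cases k <;> simp <;> fun_prop

lemma measurable_dilRot_density : Measurable fun y : DilRot => 1 / (y.1 : ℝ) ^ 3 := by
  fun_prop

instance instSigmaFiniteComap :
    SigmaFinite ((volume : Measure ℝ).comap ((↑) : Set.Ioi (0 : ℝ) → ℝ)) := by
  refine SigmaFinite.of_map _ (f := ((↑) : Set.Ioi (0 : ℝ) → ℝ)) measurable_subtype_coe.aemeasurable ?_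
  rw [map_comap_subtype_coe measurableSet_Ioi]
  infer_instance

instance instSigmaFiniteDilRotMeasure : SigmaFinite dilRotMeasure := by
  unfold dilRotMeasure
  exact SigmaFinite.withDensity_of_ne_top (Eventually.of_forall fun y => ENNReal.ofReal_ne_top)

/-- Moves the integral from the subtype of positive numbers to a subset of `ℝ × ℝ`, where the change
of variables formula is available. -/
lemma lintegral_dilRotMeasure {f : ℝ × ℝ → ℝ≥0∞} (hf : Measurable f) :
    ∫⁻ y, f (y.1, y.2) ∂dilRotMeasure =
      ∫⁻ p in Set.Ioi (0 : ℝ) ×ˢ Set.univ, ENNReal.ofReal (1 / p.1 ^ 3) * f p := by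
  have hm : Measurable fun y : DilRot => ((y.1 : ℝ), y.2) :=
    (measurable_subtype_coe.comp measurable_fst).prodMk measurable_snd
  have hd : Measurable fun p : ℝ × ℝ => ENNReal.ofReal (1 / p.1 ^ 3) := by fun_prop
  have hw := lintegral_withDensity_eq_lintegral_mul
    (((volume : Measure ℝ).comap ((↑) : Set.Ioi (0 : ℝ) → ℝ)).prod (volume : Measure ℝ))
    measurable_dilRot_density.ennreal_ofReal (hf.comp hm)
  refine Eq.trans hw ?_
  have h : Measure.map (fun y : DilRot => ((y.1 : ℝ), y.2))
      (((volume : Measure ℝ).comap ((↑) : Set.Ioi (0 : ℝ) → ℝ)).prod (volume : Measure ℝ)) =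
      (volume : Measure (ℝ × ℝ)).restrict (Set.Ioi (0 : ℝ) ×ˢ Set.univ) := by
    have := Measure.map_prod_map ((volume : Measure ℝ).comap ((↑) : Set.Ioi (0 : ℝ) → ℝ))
      (volume : Measure ℝ) (measurable_subtype_coe (p := fun x => x ∈ Set.Ioi (0 : ℝ))) measurable_id
    rw [Measure.map_id, map_comap_subtype_coe measurableSet_Ioi] at this
    rw [Measure.volume_eq_prod, ← Measure.prod_restrict, Measure.restrict_univ, this]
    rfl
  rw [← h]
  exact (lintegral_map (hd.mul hf) hm).symm

/-- The point with the given coordinates. -/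
def planePt (p : ℝ × ℝ) : Plane := !₂[p.1, p.2]

lemma measurePreserving_planePt : MeasurePreserving planePt volume volume := by
  have h1 := (volume_preserving_finTwoArrow ℝ).symm
  have h2 := PiLp.volume_preserving_toLp (Fin 2)
  have h3 := h2.comp h1
  have h4 : planePt = WithLp.toLp 2 ∘ MeasurableEquiv.finTwoArrow.symm := by
    ext p k
    fin_cases k <;> simp [planePt, MeasurableEquiv.finTwoArrow]
  rw [h4]
  exact h3

/-- Hyperbolic polar coordinates, relative to a base point. -/
def hypCoord (x : Plane) (p : ℝ × ℝ) : ℝ × ℝ :=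
  (p.1 * (Real.cosh p.2 * x 0 - Real.sinh p.2 * x 1),
    p.1 * (Real.cosh p.2 * x 1 - Real.sinh p.2 * x 0))

/-- The derivative of `hypCoord`. -/
def fderivHypCoord (x : Plane) (p : ℝ × ℝ) : ℝ × ℝ →L[ℝ] ℝ × ℝ :=
  (Matrix.toLin (.finTwoProd ℝ) (.finTwoProd ℝ)
    !![Real.cosh p.2 * x 0 - Real.sinh p.2 * x 1, p.1 * (Real.sinh p.2 * x 0 - Real.cosh p.2 * x 1);
      Real.cosh p.2 * x 1 - Real.sinh p.2 * x 0,
      p.1 * (Real.sinh p.2 * x 1 - Real.cosh p.2 * x 0)]).toContinuousLinearMap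

lemma hasFDerivAt_hypCoord (x : Plane) (p : ℝ × ℝ) :
    HasFDerivAt (hypCoord x) (fderivHypCoord x p) p := by
  unfold fderivHypCoord
  rw [Matrix.toLin_finTwoProd_toContinuousLinearMap]
  have hd : ∀ r s : ℝ, HasDerivAt (fun t => Real.cosh t * r - Real.sinh t * s)
      (Real.sinh p.2 * r - Real.cosh p.2 * s) p.2 := fun r s =>
    ((Real.hasDerivAt_cosh p.2).mul_const r).sub ((Real.hasDerivAt_sinh p.2).mul_const s)
  have key := HasFDerivAt.prodMk (𝕜 := ℝ)
    ((hasFDerivAt_fst (p := p)).mul ((hd (x 0) (x 1)).comp_hasFDerivAt p hasFDerivAt_snd))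
    ((hasFDerivAt_fst (p := p)).mul ((hd (x 1) (x 0)).comp_hasFDerivAt p hasFDerivAt_snd))
  refine key.congr_fderiv ?_
  ext <;> simp

lemma det_fderivHypCoord (x : Plane) (p : ℝ × ℝ) :
    (fderivHypCoord x p).det = -(p.1 * mink x x) := by
  unfold fderivHypCoord mink
  simp only [LinearMap.det_toContinuousLinearMap, LinearMap.det_toLin, Matrix.det_fin_two_of]
  linear_combination (-(p.1 * (x 0 * x 0 - x 1 * x 1))) * Real.cosh_sq p.2

lemma planePt_hypCoord (x : Plane) (a : Set.Ioi (0 : ℝ)) (t : ℝ) :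
    planePt (hypCoord x (a, t)) = dilRotMap (a, t) x := by
  ext k
  fin_cases k
  · simp [planePt, hypCoord, dilRotMap_apply_zero]
  · simp [planePt, hypCoord, dilRotMap_apply_one]

lemma continuous_hypCoord (x : Plane) : Continuous (hypCoord x) :=
  continuous_iff_continuousAt.2 fun p => (hasFDerivAt_hypCoord x p).continuousAt

/-- The dilations and hyperbolic rotations act simply transitively on each cone. The orbit map at
`x` has Jacobian `a |⟨x; x⟩|`, and the density `a⁻³` raises the power of `a` to four. -/
lemma lintegral_dilRotMap {i : Fin 2 × Fin 2} {x : Plane} (hx : x ∈ cone i) {f : Plane → ℝ≥0∞}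
    (hf : Measurable f) :
    ∫⁻ y, ENNReal.ofReal (|mink x x| * (y.1 : ℝ) ^ 4) * f (dilRotMap y x) ∂dilRotMeasure =
      ∫⁻ ξ in cone i, f ξ := by
  have hx0 := mink_self_ne_zero hx
  have hpm : Measurable planePt := measurePreserving_planePt.measurable
  have himg : hypCoord x '' (Set.Ioi (0 : ℝ) ×ˢ Set.univ) = planePt ⁻¹' cone i := by
    ext q
    constructor
    · rintro ⟨⟨a, t⟩, ⟨ha, _⟩, rfl⟩
      have := planePt_hypCoord x ⟨a, ha⟩ t
      change planePt (hypCoord x (a, t)) ∈ cone i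
      simp only at this
      rw [this, dilRotMap_mem_cone]
      exact hx
    · intro hq
      have hq : planePt q ∈ cone i := hq
      refine ⟨((coneParam (x, planePt q)).1, (coneParam (x, planePt q)).2),
        ⟨(coneParam (x, planePt q)).1.2, trivial⟩, ?_⟩
      have h1 := planePt_hypCoord x (coneParam (x, planePt q)).1 (coneParam (x, planePt q)).2
      have h2 : dilRotMap ((coneParam (x, planePt q)).1, (coneParam (x, planePt q)).2) x =
        planePt q := dilRotMap_coneParam hx hq
      rw [h2] at h1
      refine Prod.ext ?_ ?_
      · simpa [planePt] using congrArg (fun z : Plane => z 0) h1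
      · simpa [planePt] using congrArg (fun z : Plane => z 1) h1
  -- `coneParam` recovers the parameters from the image point.
  have hinj : Set.InjOn (hypCoord x) (Set.Ioi (0 : ℝ) ×ˢ Set.univ) := by
    rintro ⟨a, t⟩ ⟨ha, _⟩ ⟨a', t'⟩ ⟨ha', _⟩ h
    have h1 := planePt_hypCoord x ⟨a, ha⟩ t
    have h2 := planePt_hypCoord x ⟨a', ha'⟩ t'
    simp only at h1 h2
    have h3 : dilRotMap (⟨a, ha⟩, t) x = dilRotMap (⟨a', ha'⟩, t') x := by rw [← h1, ← h2, h]
    have h4 := congrArg (fun z => coneParam (x, z)) h3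
    simp only [coneParam_dilRotMap hx0, Prod.mk.injEq, Subtype.mk.injEq] at h4
    exact Prod.ext h4.1 h4.2
  have hs : MeasurableSet (Set.Ioi (0 : ℝ) ×ˢ (Set.univ : Set ℝ)) :=
    measurableSet_Ioi.prod MeasurableSet.univ
  have hcv := lintegral_image_eq_lintegral_abs_det_fderiv_mul (volume : Measure (ℝ × ℝ)) hs
    (fun p _ => (hasFDerivAt_hypCoord x p).hasFDerivWithinAt) hinj (fun p => f (planePt p))
  rw [himg] at hcv
  have hR : ∫⁻ ξ in cone i, f ξ = ∫⁻ p in planePt ⁻¹' cone i, f (planePt p) :=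
    (measurePreserving_planePt.setLIntegral_comp_preimage (measurableSet_cone i) hf).symm
  rw [hR, hcv]
  have hL := lintegral_dilRotMeasure (f := fun p => ENNReal.ofReal (|mink x x| * p.1 ^ 4) *
    f (planePt (hypCoord x p))) (by
      have := (continuous_hypCoord x).measurable
      refine Measurable.mul (by fun_prop) (hf.comp (hpm.comp this)))
  simp only [planePt_hypCoord] at hL
  refine Eq.trans hL (setLIntegral_congr_fun hs ?_)
  rintro ⟨a, t⟩ ⟨ha, _⟩
  have ha : 0 < a := ha
  simp only [det_fderivHypCoord]
  rw [← mul_assoc, ← ENNReal.ofReal_mul (by positivity), abs_neg, abs_mul, abs_of_pos ha]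
  congr 2
  field_simp

end ConeCoordinates

end AffPoincare

end

noncomputable section

namespace AffPoincare

open Filter Topology

/-! ### Kernels on the cones and functions on the group -/

section ConeIsometries

/-- The Lebesgue measure on a cone. -/
abbrev coneMeasure (i : Fin 2 × Fin 2) : Measure Plane := (volume : Measure Plane).restrict (cone i)

open Classical in
/-- The weight `|⟨x; x⟩|^{1/2} a²` on the points over a cone. -/
def orbitWeight (i : Fin 2 × Fin 2) (p : PGroup) : ℂ :=
  if p.1 ∈ cone i then ((Real.sqrt |mink p.1 p.1| * (p.2.1 : ℝ) ^ 2 : ℝ) : ℂ) else 0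

/-- The map `(x, a, θ) ↦ (x, a Λ_{-θ} x)`. -/
def orbitMap (p : PGroup) : Plane × Plane := (p.1, dilRotMap p.2 p.1)

lemma measurable_orbitMap : Measurable orbitMap :=
  measurable_fst.prodMk continuous_dilRotMap.measurable

lemma measurable_orbitWeight (i : Fin 2 × Fin 2) : Measurable (orbitWeight i) := by
  unfold orbitWeight
  refine Measurable.ite (measurable_fst (measurableSet_cone i)) ?_ measurable_const
  have h1 : Measurable fun p : PGroup => |mink p.1 p.1| :=
    (measurable_mink_self.comp measurable_fst).norm
  have h2 : Measurable fun p : PGroup => (p.2.1 : ℝ) :=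
    measurable_subtype_coe.comp (measurable_fst.comp measurable_snd)
  fun_prop

lemma enorm_orbitWeight_sq (i : Fin 2 × Fin 2) (p : PGroup) :
    ‖orbitWeight i p‖ₑ ^ 2 =
      (cone i).indicator (fun x => ENNReal.ofReal (|mink x x| * (p.2.1 : ℝ) ^ 4)) p.1 := by
  by_cases h : p.1 ∈ cone i
  · rw [orbitWeight, if_pos h, Set.indicator_of_mem h, ← ofReal_norm, Complex.norm_real,
      Real.norm_of_nonneg (by positivity), ← ENNReal.ofReal_pow (by positivity), mul_pow,
      Real.sq_sqrt (abs_nonneg _), ← pow_mul]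
  · rw [orbitWeight, if_neg h, Set.indicator_of_notMem h]; simp

/-- For each fixed `x` in the cone this is the change of variables along the orbit of `x`, tested on
rectangles. -/
lemma isWeightedComp_orbit (i : Fin 2 × Fin 2) :
    IsWeightedComp haar ((coneMeasure i).prod (coneMeasure i)) (orbitWeight i) orbitMap where
  measurable_weight := measurable_orbitWeight i
  measurable_map := measurable_orbitMap
  map_eq := by
    symm
    refine Measure.prod_eq fun S T hS hT => ?_
    have hw : Measurable fun p => ‖orbitWeight i p‖ₑ ^ 2 :=
      (measurable_orbitWeight i).enorm.pow_const 2
    rw [Measure.map_apply measurable_orbitMap (hS.prod hT),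
      withDensity_apply _ (measurable_orbitMap (hS.prod hT)),
      ← lintegral_indicator (measurable_orbitMap (hS.prod hT)), haar,
      lintegral_prod _ (hw.indicator (measurable_orbitMap (hS.prod hT))).aemeasurable]
    have h1 : ∀ x, ∫⁻ y, (orbitMap ⁻¹' S ×ˢ T).indicator (fun p => ‖orbitWeight i p‖ₑ ^ 2) (x, y)
        ∂dilRotMeasure = (S ∩ cone i).indicator (fun _ => coneMeasure i T) x := by
      intro x
      by_cases hx : x ∈ S ∩ cone i
      · have h2 := lintegral_dilRotMap hx.2 (f := T.indicator 1) (measurable_one.indicator hT)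
        rw [Set.indicator_of_mem hx, ← lintegral_indicator_one hT, ← h2]
        refine lintegral_congr fun y => ?_
        by_cases hy : dilRotMap y x ∈ T
        · rw [Set.indicator_of_mem (show (x, y) ∈ orbitMap ⁻¹' S ×ˢ T from ⟨hx.1, hy⟩),
            enorm_orbitWeight_sq, Set.indicator_of_mem hx.2, Set.indicator_of_mem hy]
          simp
        · rw [Set.indicator_of_notMem (fun h : (x, y) ∈ orbitMap ⁻¹' S ×ˢ T => hy h.2),
            Set.indicator_of_notMem hy]
          simp
      · rw [Set.indicator_of_notMem hx]
        refine (lintegral_congr fun y => ?_).trans lintegral_zero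
        by_cases hxy : (x, y) ∈ orbitMap ⁻¹' S ×ˢ T
        · rw [Set.indicator_of_mem hxy, enorm_orbitWeight_sq,
            Set.indicator_of_notMem (fun h : (x, y).1 ∈ cone i => hx ⟨hxy.1, h⟩)]
        · rw [Set.indicator_of_notMem hxy]
    simp only [h1]
    rw [lintegral_indicator (hS.inter (measurableSet_cone i)), setLIntegral_const,
      Measure.restrict_apply hS, mul_comm]

/-- The weight `|⟨x; x⟩|^{1/2} / |⟨ξ; ξ⟩|`. -/
def kernelWeight (p : Plane × Plane) : ℂ :=
  ((Real.sqrt |mink p.1 p.1| / |mink p.2 p.2| : ℝ) : ℂ)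

/-- The map `(x, c Λ_{-t} x) ↦ (x, c, t)`. -/
def kernelMap (p : Plane × Plane) : PGroup := (p.1, coneParam p)

lemma measurable_kernelMap : Measurable kernelMap := measurable_fst.prodMk measurable_coneParam

lemma measurable_kernelWeight : Measurable kernelWeight := by
  unfold kernelWeight
  have h1 : Measurable fun p : Plane × Plane => |mink p.1 p.1| :=
    (measurable_mink_self.comp measurable_fst).norm
  have h2 : Measurable fun p : Plane × Plane => |mink p.2 p.2| :=
    (measurable_mink_self.comp measurable_snd).norm
  fun_prop

lemma kernelMap_orbitMap {i : Fin 2 × Fin 2} {p : PGroup} (hp : p.1 ∈ cone i) :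
    kernelMap (orbitMap p) = p :=
  Prod.ext rfl (coneParam_dilRotMap (mink_self_ne_zero hp) p.2)

lemma orbitWeight_mul_kernelWeight {i : Fin 2 × Fin 2} {p : PGroup} (hp : p.1 ∈ cone i) :
    orbitWeight i p * kernelWeight (orbitMap p) = 1 := by
  have h0 : 0 < |mink p.1 p.1| := abs_pos.2 (mink_self_ne_zero hp)
  have ha : 0 < (p.2.1 : ℝ) := p.2.1.2
  rw [orbitWeight, if_pos hp, kernelWeight, orbitMap, mink_dilRotMap, ← Complex.ofReal_mul,
    ← Complex.ofReal_one]
  congr 1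
  rw [abs_mul, abs_of_pos (pow_pos ha 2)]
  have := Real.mul_self_sqrt h0.le
  field_simp
  nlinarith

/-- No second Jacobian is needed: pulled back to the group along the orbit map, the two weights are
reciprocal and the two maps cancel. -/
lemma isWeightedComp_kernel (i : Fin 2 × Fin 2) :
    IsWeightedComp ((coneMeasure i).prod (coneMeasure i)) ((coneMeasure i).prod dilRotMeasure)
      kernelWeight kernelMap where
  measurable_weight := measurable_kernelWeight
  measurable_map := measurable_kernelMap
  map_eq := by
    ext A hA
    have hw : Measurable fun p => ‖kernelWeight p‖ₑ ^ 2 := measurable_kernelWeight.enorm.pow_const 2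
    have hc : MeasurableSet (cone i ×ˢ (Set.univ : Set DilRot)) :=
      (measurableSet_cone i).prod MeasurableSet.univ
    have hr : (coneMeasure i).prod dilRotMeasure = haar.restrict (cone i ×ˢ Set.univ) := by
      rw [haar, ← Measure.prod_restrict, Measure.restrict_univ]
    rw [Measure.map_apply measurable_kernelMap hA, withDensity_apply _ (measurable_kernelMap hA),
      ← lintegral_indicator (measurable_kernelMap hA),
      ← (isWeightedComp_orbit i).lintegral_eq (hw.indicator (measurable_kernelMap hA)).aemeasurable,
      hr, Measure.restrict_apply hA, ← lintegral_indicator_one (hA.inter hc)]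
    refine lintegral_congr fun p => ?_
    by_cases hp : p.1 ∈ cone i
    · have h1 := orbitWeight_mul_kernelWeight hp
      by_cases hpA : p ∈ A
      · rw [Set.indicator_of_mem (show orbitMap p ∈ kernelMap ⁻¹' A by
          rw [Set.mem_preimage, kernelMap_orbitMap hp]; exact hpA),
          Set.indicator_of_mem (show p ∈ A ∩ cone i ×ˢ Set.univ from ⟨hpA, hp, trivial⟩),
          ← mul_pow, ← enorm_mul, h1]
        simp
      · rw [Set.indicator_of_notMem (show orbitMap p ∉ kernelMap ⁻¹' A by
          rw [Set.mem_preimage, kernelMap_orbitMap hp]; exact hpA),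
          Set.indicator_of_notMem (fun h : p ∈ A ∩ cone i ×ˢ Set.univ => hpA h.1), mul_zero]
    · rw [Set.indicator_of_notMem (fun h : p ∈ A ∩ cone i ×ˢ Set.univ => hp h.2.1), orbitWeight,
        if_neg hp]
      simp

/-- The isometry from kernels on a cone to functions on the group. -/
abbrev orbitIso (i : Fin 2 × Fin 2) : Lp ℂ 2 ((coneMeasure i).prod (coneMeasure i)) →ₗᵢ[ℂ] L2Group :=
  (isWeightedComp_orbit i).toIsometry

/-- The isometry from functions on the part of the group over a cone to kernels on the cone. -/
abbrev kernelIso (i : Fin 2 × Fin 2) :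
    Lp ℂ 2 ((coneMeasure i).prod dilRotMeasure) →ₗᵢ[ℂ]
      Lp ℂ 2 ((coneMeasure i).prod (coneMeasure i)) :=
  (isWeightedComp_kernel i).toIsometry

lemma prod_coneMeasure (i : Fin 2 × Fin 2) :
    (coneMeasure i).prod dilRotMeasure = haar.restrict (cone i ×ˢ Set.univ) := by
  rw [haar, ← Measure.prod_restrict, Measure.restrict_univ]

lemma memLp_coneRestrict (i : Fin 2 × Fin 2) (β : L2Group) :
    MemLp β 2 ((coneMeasure i).prod dilRotMeasure) := by
  rw [prod_coneMeasure]
  exact (Lp.memLp β).restrict _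

/-- Restriction to the part of the group over a cone. -/
def coneRestrict (i : Fin 2 × Fin 2) (β : L2Group) : Lp ℂ 2 ((coneMeasure i).prod dilRotMeasure) :=
  (memLp_coneRestrict i β).toLp

lemma measurableSet_coneProd (i : Fin 2 × Fin 2) :
    MeasurableSet (cone i ×ˢ (Set.univ : Set DilRot)) :=
  (measurableSet_cone i).prod MeasurableSet.univ

lemma coeFn_coneRestrict (i : Fin 2 × Fin 2) (β : L2Group) :
    ∀ᵐ p ∂haar, p.1 ∈ cone i → coneRestrict i β p = β p := by
  have h := (memLp_coneRestrict i β).coeFn_toLp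
  have h' : coneRestrict i β =ᵐ[haar.restrict (cone i ×ˢ Set.univ)] β := by
    rw [← prod_coneMeasure]; exact h
  rw [EventuallyEq, ae_restrict_iff' (measurableSet_coneProd i)] at h'
  filter_upwards [h'] with p hp hc
  exact hp ⟨hc, trivial⟩

lemma orbitIso_kernelIso (i : Fin 2 × Fin 2) (β : L2Group) :
    ∀ᵐ p ∂haar, p.1 ∈ cone i → orbitIso i (kernelIso i (coneRestrict i β)) p = β p := by
  have h := (isWeightedComp_orbit i).toIsometry_toIsometry (isWeightedComp_kernel i)
    (coneRestrict i β)
  filter_upwards [h, coeFn_coneRestrict i β] with p h1 h2 hp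
  rw [h1, kernelMap_orbitMap hp, ← mul_assoc, orbitWeight_mul_kernelWeight hp, one_mul, h2 hp]

lemma orbitIso_eq_zero (i : Fin 2 × Fin 2) (k : Lp ℂ 2 ((coneMeasure i).prod (coneMeasure i))) :
    ∀ᵐ p ∂haar, p.1 ∉ cone i → orbitIso i k p = 0 := by
  filter_upwards [(isWeightedComp_orbit i).coeFn_toIsometry k] with p h1 hp
  rw [h1, orbitWeight, if_neg hp, zero_mul]

/-- Identifies the adjoint of `orbitIso`: restrict to the part of the group over the cone, then use
the inverse coordinates. -/
lemma inner_orbitIso (i : Fin 2 × Fin 2) (k : Lp ℂ 2 ((coneMeasure i).prod (coneMeasure i)))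
    (β : L2Group) : ⟪orbitIso i k, β⟫_ℂ = ⟪k, kernelIso i (coneRestrict i β)⟫_ℂ := by
  rw [← (orbitIso i).inner_map_map, inner_eq_integral, inner_eq_integral]
  refine integral_congr_ae ?_
  filter_upwards [orbitIso_eq_zero i k, orbitIso_kernelIso i β] with p h1 h2
  by_cases hp : p.1 ∈ cone i
  · rw [h2 hp]
  · rw [h1 hp]; simp

lemma cone_disjoint {i j : Fin 2 × Fin 2} {x : Plane} (hi : x ∈ cone i) (hj : x ∈ cone j) :
    i = j := by
  obtain ⟨i, i'⟩ := i
  obtain ⟨j, j'⟩ := j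
  fin_cases i <;> fin_cases i' <;> fin_cases j <;> fin_cases j' <;>
    simp only [cone, Set.mem_ofPred_eq, Fin.isValue, Fin.mk_zero, Fin.mk_one, Fin.zero_eta]
      at hi hj <;> first | rfl | (exfalso; linarith [hi.1, hi.2, hj.1, hj.2])

/-- The cones miss only the two light lines `x₁ = ±x₂`, kernels of nonzero linear forms. -/
lemma ae_mem_cone : ∀ᵐ x : Plane, ∃ i, x ∈ cone i := by
  have hnull : ∀ s : ℝ, ∀ᵐ x : Plane, x 0 + s * x 1 ≠ 0 := by
    intro s
    set f : Plane →ₗ[ℝ] ℝ := (innerₗ Plane) !₂[1, s] with hf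
    have hfa : ∀ x, f x = x 0 + s * x 1 := by
      intro x
      simp [hf, PiLp.inner_apply, Fin.sum_univ_two, mul_comm]
    have hne : LinearMap.ker f ≠ ⊤ := by
      intro h
      have : f !₂[1, 0] = 0 := by
        rw [← LinearMap.mem_ker, h]; trivial
      rw [hfa] at this
      simp at this
    have h0 := Measure.addHaar_submodule (volume : Measure Plane) (LinearMap.ker f) hne
    rw [ae_iff]
    convert h0 using 2
    ext x
    simp [LinearMap.mem_ker, hfa]
  filter_upwards [hnull 1, hnull (-1)] with x h1 h2
  have h3 : x 0 ^ 2 ≠ x 1 ^ 2 := by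
    intro h
    have : (x 0 + 1 * x 1) * (x 0 + -1 * x 1) = 0 := by ring_nf; linarith
    rcases mul_eq_zero.1 this with h | h
    · exact h1 h
    · exact h2 h
  rcases lt_or_gt_of_ne h3 with h | h
  · rcases lt_trichotomy (x 1) 0 with h' | h' | h'
    · exact ⟨(1, 1), h, h'⟩
    · exfalso; rw [h'] at h; nlinarith [sq_nonneg (x 0)]
    · exact ⟨(0, 1), h, h'⟩
  · rcases lt_trichotomy (x 0) 0 with h' | h' | h'
    · exact ⟨(1, 0), h, h'⟩
    · exfalso; rw [h'] at h; nlinarith [sq_nonneg (x 1)]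
    · exact ⟨(0, 0), h, h'⟩

/-- The function `(x, a, θ) ↦ |⟨x; x⟩|^{1/2} a² φ (x) ψ (a Λ_{-θ} x)` over a cone. -/
def coneTensor (i : Fin 2 × Fin 2) : L2Cone i →L[ℂ] L2Cone i →L[ℂ] L2Group :=
  (ContinuousLinearMap.compL ℂ (L2Cone i) _ L2Group (orbitIso i).toContinuousLinearMap).comp tensorL

lemma coneTensor_apply (i : Fin 2 × Fin 2) (φ ψ : L2Cone i) :
    coneTensor i φ ψ = orbitIso i (tensorFun φ ψ) := rfl

lemma inner_coneTensor (i : Fin 2 × Fin 2) (φ ψ φ' ψ' : L2Cone i) :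
    ⟪coneTensor i φ ψ, coneTensor i φ' ψ'⟫_ℂ = ⟪φ, φ'⟫_ℂ * ⟪ψ, ψ'⟫_ℂ := by
  rw [coneTensor_apply, coneTensor_apply, (orbitIso i).inner_map_map, inner_tensorFun]

lemma norm_coneTensor (i : Fin 2 × Fin 2) (φ ψ : L2Cone i) :
    ‖coneTensor i φ ψ‖ = ‖φ‖ * ‖ψ‖ := by
  rw [coneTensor_apply, (orbitIso i).norm_map, norm_tensorFun]

lemma inner_coneTensor_of_ne {i j : Fin 2 × Fin 2} (hij : i ≠ j) (φ ψ : L2Cone i)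
    (φ' ψ' : L2Cone j) : ⟪coneTensor i φ ψ, coneTensor j φ' ψ'⟫_ℂ = 0 := by
  rw [inner_eq_integral, coneTensor_apply, coneTensor_apply]
  refine integral_eq_zero_of_ae ?_
  filter_upwards [orbitIso_eq_zero i (tensorFun φ ψ), orbitIso_eq_zero j (tensorFun φ' ψ')]
    with p h1 h2
  by_cases hp : p.1 ∈ cone i
  · rw [h2 fun h => hij (cone_disjoint hp h)]; simp
  · rw [h1 hp]; simp

/-- Totality on each cone forces `β` to vanish over that cone, and the cones cover almost every
point. -/
lemma eq_zero_of_inner_coneTensor {β : L2Group}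
    (h : ∀ i φ ψ, ⟪coneTensor i φ ψ, β⟫_ℂ = 0) : β = 0 := by
  have h1 : ∀ i, coneRestrict i β = 0 := by
    intro i
    have : kernelIso i (coneRestrict i β) = 0 := eq_zero_of_inner_tensorFun_eq_zero fun u v => by
      rw [← inner_orbitIso, ← coneTensor_apply]
      exact h i u v
    rw [← norm_eq_zero, ← (kernelIso i).norm_map, this, norm_zero]
  have h2 : ∀ i, ∀ᵐ p ∂haar, p.1 ∈ cone i → β p = 0 := by
    intro i
    have h3 := orbitIso_kernelIso i β
    rw [h1, map_zero, map_zero] at h3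
    filter_upwards [h3, Lp.coeFn_zero ℂ 2 haar] with p h4 h5 hp
    rw [← h4 hp, h5]; rfl
  rw [Lp.eq_zero_iff_ae_eq_zero]
  have h6 : ∀ᵐ p ∂haar, ∃ i, p.1 ∈ cone i := ae_fst ae_mem_cone
  filter_upwards [ae_all_iff.2 h2, h6] with p h7 h8
  obtain ⟨i, hi⟩ := h8
  exact h7 i hi

/-- Hilbert bases on the cones give a Hilbert basis on the group. -/
lemma exists_hilbertBasis_coneTensor {ι κ : Fin 2 × Fin 2 → Type*}
    (b : ∀ i, HilbertBasis (ι i) ℂ (L2Cone i)) (c : ∀ i, HilbertBasis (κ i) ℂ (L2Cone i)) :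
    ∃ B : HilbertBasis (Σ i, ι i × κ i) ℂ L2Group,
      ∀ i m n, B ⟨i, m, n⟩ = coneTensor i (b i m) (c i n) :=
  exists_hilbertBasis_tensor (H := L2Cone) (K := L2Cone) coneTensor
    (fun i x y x' y' => inner_coneTensor i x y x' y')
    (fun i j x y x' y' hij => inner_coneTensor_of_ne hij x y x' y')
    (fun z hz => eq_zero_of_inner_coneTensor hz) b c

end ConeIsometries

end AffPoincare

end

noncomputable section

namespace AffPoincare

open Filter Topology

/-! ### Unitarity of the representations -/

section Unitarity

lemma mink_dilRotMap_dilRotMap (y : DilRot) (x z : Plane) :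
    mink (dilRotMap y x) (dilRotMap y z) = (y.1 : ℝ) ^ 2 * mink x z := by
  simp only [mink, dilRotMap_apply_zero, dilRotMap_apply_one]
  linear_combination (y.1 : ℝ) ^ 2 * (x 0 * z 0 - x 1 * z 1) * Real.cosh_sq y.2

lemma coeFn_rep (g : PGroup) (i : Fin 2 × Fin 2) (φ : L2Cone i) :
    rep g i φ =ᵐ[coneMeasure i] repFun g φ :=
  (eLpNorm_repFun g i φ).1.coeFn_toLp

/-- The inverse of a group element. -/
def groupInv (g : PGroup) : PGroup :=
  (-((1 / (g.2.1 : ℝ) ^ 2) • dilRotMap g.2 g.1), (⟨(g.2.1 : ℝ)⁻¹, Set.mem_Ioi.2 (inv_pos.2 (Set.mem_Ioi.1 g.2.1.2))⟩, -g.2.2))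

lemma dilRotMap_groupInv (g : PGroup) (x : Plane) :
    dilRotMap (groupInv g).2 (dilRotMap g.2 x) = x := by
  have ha : (g.2.1 : ℝ) ≠ 0 := (show (0 : ℝ) < g.2.1 from g.2.1.2).ne'
  have hc := Real.cosh_sq g.2.2
  ext k
  fin_cases k
  · simp [groupInv, dilRotMap_apply_zero, dilRotMap_apply_one]
    field_simp
    linear_combination x 0 * hc
  · simp [groupInv, dilRotMap_apply_zero, dilRotMap_apply_one]
    field_simp
    linear_combination x 1 * hc

lemma mink_groupInv (g : PGroup) (x : Plane) :
    mink (dilRotMap g.2 x) (groupInv g).1 = -mink x g.1 := by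
  have ha : (g.2.1 : ℝ) ≠ 0 := (show (0 : ℝ) < g.2.1 from g.2.1.2).ne'
  have h : ∀ (u v : Plane) (c : ℝ), mink u (-(c • v)) = -(c * mink u v) := by
    intro u v c; simp [mink]; ring
  rw [groupInv, h, mink_dilRotMap_dilRotMap]
  field_simp

/-- Supplies surjectivity, so the isometries `π(g)` are unitary and `π(g)*` is a two-sided inverse.
-/
lemma rep_groupInv (g : PGroup) (i : Fin 2 × Fin 2) (φ : L2Cone i) :
    rep g i (rep (groupInv g) i φ) = φ := by
  refine Lp.ext ?_
  refine (coeFn_rep g i _).trans ((repFun_congr g i (coeFn_rep (groupInv g) i φ)).trans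
    (Eventually.of_forall fun x => ?_))
  have ha : ((g.2.1 : ℝ) : ℂ) ≠ 0 := by
    exact_mod_cast (show (0 : ℝ) < g.2.1 from g.2.1.2).ne'
  have h2 : ((groupInv g).2.1 : ℝ) = (g.2.1 : ℝ)⁻¹ := rfl
  simp only [repFun, dilRotMap_groupInv, mink_groupInv, h2]
  push_cast
  rw [mul_neg, Complex.exp_neg]
  field_simp

lemma repAdj_rep (g : PGroup) (i : Fin 2 × Fin 2) (φ : L2Cone i) :
    repAdj g i (rep g i φ) = φ := by
  refine ext_inner_left ℂ fun ψ => ?_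
  rw [repAdj, ContinuousLinearMap.adjoint_inner_right]
  exact (rep g i).inner_map_map ψ φ

lemma rep_repAdj (g : PGroup) (i : Fin 2 × Fin 2) (φ : L2Cone i) :
    rep g i (repAdj g i φ) = φ := by
  conv_lhs => rw [← rep_groupInv g i φ, repAdj_rep, rep_groupInv]

lemma norm_repAdj (g : PGroup) (i : Fin 2 × Fin 2) (φ : L2Cone i) : ‖repAdj g i φ‖ = ‖φ‖ := by
  rw [← (rep g i).norm_map, rep_repAdj]

lemma inner_repAdj (g : PGroup) (i : Fin 2 × Fin 2) (φ ψ : L2Cone i) :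
    ⟪ψ, repAdj g i φ⟫_ℂ = ⟪rep g i ψ, φ⟫_ℂ := by
  rw [repAdj, ContinuousLinearMap.adjoint_inner_right]; rfl

lemma inner_repAdj_left (g : PGroup) (i : Fin 2 × Fin 2) (φ ψ : L2Cone i) :
    ⟪repAdj g i φ, ψ⟫_ℂ = ⟪φ, rep g i ψ⟫_ℂ := by
  rw [repAdj, ContinuousLinearMap.adjoint_inner_left]; rfl

lemma hsNormSq_repAdj_comp (g : PGroup) (i : Fin 2 × Fin 2) (A : L2Cone i →L[ℂ] L2Cone i) :
    hsNormSq (repAdj g i ∘L A) = hsNormSq A := by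
  rw [← hsNormSq_isometry_comp (rep g i) (repAdj g i ∘L A)]
  congr 1
  ext1 φ
  exact rep_repAdj g i (A φ)

lemma hsNormSq_comp_repAdj (g : PGroup) (i : Fin 2 × Fin 2) (A : L2Cone i →L[ℂ] L2Cone i) :
    hsNormSq (A ∘L repAdj g i) = hsNormSq A := by
  rw [← hsNormSq_adjoint, ContinuousLinearMap.adjoint_comp, repAdj,
    ContinuousLinearMap.adjoint_adjoint, hsNormSq_isometry_comp, hsNormSq_adjoint]

end Unitarity

/-! ### Strong continuity of the representations -/

section Continuity

instance instLocallyCompactSpacePGroup : LocallyCompactSpace PGroup := by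
  have : LocallyCompactSpace (Set.Ioi (0 : ℝ)) := isOpen_Ioi.locallyCompactSpace
  infer_instance

lemma exists_continuous_approx (i : Fin 2 × Fin 2) (φ : L2Cone i) {ε : ℝ} (hε : 0 < ε) :
    ∃ (φ' : L2Cone i) (f : Plane → ℂ), Continuous f ∧ HasCompactSupport f ∧
      φ' =ᵐ[coneMeasure i] f ∧ ‖φ - φ'‖ ≤ ε := by
  obtain ⟨f, hf1, hf2, hf3, hf4⟩ := (Lp.memLp φ).exists_hasCompactSupport_eLpNorm_sub_le
    (by simp) (ε := ENNReal.ofReal ε) (by simpa using hε)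
  refine ⟨hf4.toLp, f, hf3, hf1, hf4.coeFn_toLp, ?_⟩
  have h : φ - hf4.toLp = ((Lp.memLp φ).sub hf4).toLp := by
    rw [MemLp.toLp_sub (Lp.memLp φ) hf4, Lp.toLp_coeFn]
  rw [h, Lp.norm_toLp]
  exact ENNReal.toReal_le_of_le_ofReal hε.le hf2

/-- The compact support of `h` confines the integral to a fixed compact set, on which the integrand
is jointly continuous. -/
lemma continuous_inner_rep_of_continuous (i : Fin 2 × Fin 2) {φ ψ : L2Cone i} {f h : Plane → ℂ}
    (hf : Continuous f) (hh : Continuous h) (hhc : HasCompactSupport h)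
    (hφ : φ =ᵐ[coneMeasure i] f) (hψ : ψ =ᵐ[coneMeasure i] h) :
    Continuous fun g => ⟪ψ, rep g i φ⟫_ℂ := by
  have h1 : ∀ g, ⟪ψ, rep g i φ⟫_ℂ = ∫ x in tsupport h, conj (h x) * repFun g f x ∂coneMeasure i := by
    intro g
    rw [setIntegral_eq_integral_of_forall_compl_eq_zero fun x hx => by
      rw [image_eq_zero_of_notMem_tsupport hx]; simp, inner_eq_integral]
    refine integral_congr_ae ?_
    filter_upwards [hψ, coeFn_rep g i φ, repFun_congr g i hφ] with x e1 e2 e3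
    rw [e1, e2, e3]
  simp only [h1]
  refine continuous_parametric_integral_of_continuous (f := fun g x => conj (h x) * repFun g f x)
    ?_ hhc.isCompact
  have hd : Continuous fun p : PGroup × Plane => dilRotMap p.1.2 p.2 :=
    continuous_dilRotMap.comp (continuous_snd.prodMk (continuous_snd.comp continuous_fst))
  have hm : Continuous fun p : PGroup × Plane => mink p.2 p.1.1 :=
    continuous_mink.comp (continuous_snd.prodMk (continuous_fst.comp continuous_fst))
  have ha : Continuous fun p : PGroup × Plane => (p.1.2.1 : ℝ) := by fun_prop
  unfold repFun Function.uncurry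
  fun_prop

/-- Since `π(g)` is isometric, the error of replacing both vectors by continuous ones is uniform in
`g`. -/
lemma continuous_inner_rep (i : Fin 2 × Fin 2) (φ ψ : L2Cone i) :
    Continuous fun g => ⟪ψ, rep g i φ⟫_ℂ := by
  refine continuous_of_uniform_approx_of_continuous fun u hu => ?_
  obtain ⟨ε, hε, hεu⟩ := Metric.mem_uniformity_dist.1 hu
  obtain ⟨ψ', h, hh, hhc, hψ, hd1⟩ := exists_continuous_approx i ψ
    (ε := ε / (3 * (‖φ‖ + 1))) (by positivity)
  obtain ⟨φ', f, hf, -, hφ, hd2⟩ := exists_continuous_approx i φ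
    (ε := ε / (3 * (‖ψ'‖ + 1))) (by positivity)
  refine ⟨fun g => ⟪ψ', rep g i φ'⟫_ℂ, continuous_inner_rep_of_continuous i hf hh hhc hφ hψ,
    fun g => hεu ?_⟩
  have e : ⟪ψ, rep g i φ⟫_ℂ - ⟪ψ', rep g i φ'⟫_ℂ =
      ⟪ψ - ψ', rep g i φ⟫_ℂ + ⟪ψ', rep g i (φ - φ')⟫_ℂ := by
    rw [map_sub, inner_sub_left, inner_sub_right]; ring
  rw [dist_eq_norm, e]
  have b1 : ‖⟪ψ - ψ', rep g i φ⟫_ℂ‖ ≤ ε / 3 := by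
    refine (norm_inner_le_norm _ _).trans ?_
    rw [(rep g i).norm_map]
    calc ‖ψ - ψ'‖ * ‖φ‖ ≤ ε / (3 * (‖φ‖ + 1)) * (‖φ‖ + 1) := by gcongr; linarith
      _ = ε / 3 := by field_simp
  have b2 : ‖⟪ψ', rep g i (φ - φ')⟫_ℂ‖ ≤ ε / 3 := by
    refine (norm_inner_le_norm _ _).trans ?_
    rw [(rep g i).norm_map]
    calc ‖ψ'‖ * ‖φ - φ'‖ ≤ (‖ψ'‖ + 1) * (ε / (3 * (‖ψ'‖ + 1))) := by gcongr; linarith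
      _ = ε / 3 := by field_simp
  linarith [norm_add_le ⟪ψ - ψ', rep g i φ⟫_ℂ ⟪ψ', rep g i (φ - φ')⟫_ℂ]

/-- A weakly continuous map of constant norm is continuous. -/
lemma WeaklyContinuous.continuous_of_norm_eq {X H : Type*} [TopologicalSpace X]
    [NormedAddCommGroup H] [InnerProductSpace ℂ H] {F : X → H}
    (hF : WeaklyContinuous F) {c : ℝ} (hc : ∀ x, ‖F x‖ = c) : Continuous F := by
  rw [continuous_iff_continuousAt]
  intro x₀
  rw [ContinuousAt, tendsto_iff_norm_sub_tendsto_zero]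
  have h1 : ∀ x, ‖F x - F x₀‖ = Real.sqrt (2 * c ^ 2 - 2 * (⟪F x₀, F x⟫_ℂ).re) := by
    intro x
    rw [← Real.sqrt_sq (norm_nonneg (F x - F x₀)), @norm_sub_sq ℂ, hc, hc, ← inner_conj_symm]
    simp only [RCLike.re_to_complex, Complex.conj_re]
    congr 1; ring
  simp only [h1]
  have h2 : Continuous fun x => Real.sqrt (2 * c ^ 2 - 2 * (⟪F x₀, F x⟫_ℂ).re) :=
    (continuous_const.sub (continuous_const.mul (Complex.continuous_re.comp (hF (F x₀))))).sqrt
  have h3 := h2.tendsto x₀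
  rw [← h1 x₀, sub_self, norm_zero] at h3
  exact h3

/-- Weak continuity upgrades to norm continuity because the norm of `π(g)* φ` is constant. -/
lemma continuous_repAdj (i : Fin 2 × Fin 2) (φ : L2Cone i) : Continuous fun g => repAdj g i φ := by
  refine WeaklyContinuous.continuous_of_norm_eq (fun ψ => ?_) (fun g => norm_repAdj g i φ)
  have h := (continuous_inner_rep i ψ φ).star
  refine h.congr fun g => ?_
  rw [inner_repAdj, ← inner_conj_symm (rep g i ψ) φ]
  rfl

end Continuity

/-! ### Plancherel formula for the group Fourier transform -/

section GroupFourier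

/-- The explicit bound is what gives the `L¹` norms of fibres below a constant independent of the
fibre. -/
lemma integrable_mul_and_bound {X : Type*} [MeasurableSpace X] {μ : Measure X} {f g : X → ℂ}
    (hf : MemLp f 2 μ) (hg : MemLp g 2 μ) : Integrable (fun x => f x * g x) μ ∧
      ∫ x, ‖f x * g x‖ ∂μ ≤ (∫ x, ‖f x‖ ^ 2 ∂μ + ∫ x, ‖g x‖ ^ 2 ∂μ) / 2 := by
  have hi : Integrable (fun x => f x * g x) μ := hf.integrable_mul hg
  refine ⟨hi, ?_⟩
  have h1 := (memLp_two_iff_integrable_sq_norm hf.1).1 hf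
  have h2 := (memLp_two_iff_integrable_sq_norm hg.1).1 hg
  rw [← integral_add h1 h2, ← integral_div]
  refine integral_mono hi.norm ((h1.add h2).div_const 2) fun x => ?_
  simp only [norm_mul]
  nlinarith [sq_nonneg (‖f x‖ - ‖g x‖)]

lemma integral_norm_sq_Lp {X : Type*} [MeasurableSpace X] {μ : Measure X} (f : Lp ℂ 2 μ) :
    ∫ x, ‖f x‖ ^ 2 ∂μ = ‖f‖ ^ 2 := by
  have h1 := inner_eq_integral f f
  rw [inner_self_eq_norm_sq_to_K] at h1
  have h2 : ∫ x, conj (f x) * f x ∂μ = ((∫ x, ‖f x‖ ^ 2 ∂μ : ℝ) : ℂ) := by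
    rw [← integral_complex_ofReal]
    refine integral_congr_ae (Eventually.of_forall fun x => ?_)
    simp only [RCLike.conj_mul]
    norm_cast
  rw [h2] at h1
  rw [← Complex.ofReal_inj, ← h1]
  push_cast; rfl

lemma IsWeightedComp.ae_comp {Z X : Type*} [MeasurableSpace Z] [MeasurableSpace X] {ζ : Measure Z}
    {μ : Measure X} {w : Z → ℂ} {Ψ : Z → X} (h : IsWeightedComp ζ μ w Ψ) {p : X → Prop}
    (hp : ∀ᵐ x ∂μ, p x) : ∀ᵐ z ∂ζ, w z ≠ 0 → p (Ψ z) := by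
  rw [← h.map_eq] at hp
  have h2 := ae_of_ae_map h.measurable_map.aemeasurable hp
  rw [ae_withDensity_iff (h.measurable_weight.enorm.pow_const 2)] at h2
  filter_upwards [h2] with z hz hw
  exact hz (by simpa using hw)

lemma orbitWeight_ne_zero {i : Fin 2 × Fin 2} {p : PGroup} (hp : p.1 ∈ cone i) :
    orbitWeight i p ≠ 0 :=
  left_ne_zero_of_mul_eq_one (orbitWeight_mul_kernelWeight hp)

open Classical in
/-- The function `(x, a, θ) ↦ a ψ (x) conj (φ (a Λ_{-θ} x))` over a cone. -/
def coeffFun (i : Fin 2 × Fin 2) (ψ φ : L2Cone i) (p : PGroup) : ℂ :=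
  if p.1 ∈ cone i then ψ p.1 * ((p.2.1 : ℝ) * conj (φ (dilRotMap p.2 p.1))) else 0

lemma measurable_coeffFun (i : Fin 2 × Fin 2) (ψ φ : L2Cone i) : Measurable (coeffFun i ψ φ) := by
  unfold coeffFun
  have h1 : Measurable ψ := (Lp.stronglyMeasurable ψ).measurable
  have h2 : Measurable φ := (Lp.stronglyMeasurable φ).measurable
  have h3 : Measurable fun p : PGroup => (p.2.1 : ℝ) :=
    measurable_subtype_coe.comp (measurable_fst.comp measurable_snd)
  refine Measurable.ite (measurable_fst (measurableSet_cone i)) ?_ measurable_const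
  exact (h1.comp measurable_fst).mul ((Complex.measurable_ofReal.comp h3).mul
    ((Complex.continuous_conj.measurable).comp (h2.comp continuous_dilRotMap.measurable)))

/-- On the cone the fibre is `ψ` times the conjugate of `π(0, y) φ`, a vector of the same norm as
`φ`, so the bound does not depend on `y`. -/
lemma coeffFun_fiber (i : Fin 2 × Fin 2) (ψ φ : L2Cone i) (y : DilRot) :
    Integrable (fun x => coeffFun i ψ φ (x, y)) ∧
      ∫ x, ‖coeffFun i ψ φ (x, y)‖ ≤ (‖ψ‖ ^ 2 + ‖φ‖ ^ 2) / 2 := by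
  have h := integrable_mul_and_bound (Lp.memLp ψ) (Lp.memLp (star (rep (0, y) i φ)))
  rw [integral_norm_sq_Lp, integral_norm_sq_Lp, norm_star_Lp, (rep (0, y) i).norm_map] at h
  have e : (fun x => coeffFun i ψ φ (x, y)) = (cone i).indicator
      (fun x => ψ x * ((y.1 : ℝ) * conj (φ (dilRotMap y x)))) := by
    ext x
    by_cases hx : x ∈ cone i <;> simp [coeffFun, hx]
  have e2 : (fun x => ψ x * star (rep (0, y) i φ) x) =ᵐ[coneMeasure i]
      fun x => ψ x * ((y.1 : ℝ) * conj (φ (dilRotMap y x))) := by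
    filter_upwards [Lp.coeFn_star (rep (0, y) i φ), coeFn_rep (0, y) i φ] with x h1 h2
    rw [h1, Pi.star_apply, h2]
    simp [repFun, mink]
  constructor
  · rw [e, integrable_indicator_iff (measurableSet_cone i)]
    exact h.1.congr e2
  · refine le_trans (le_of_eq ?_) h.2
    have e3 : (fun x => ‖coeffFun i ψ φ (x, y)‖) = (cone i).indicator
        (fun x => ‖ψ x * ((y.1 : ℝ) * conj (φ (dilRotMap y x)))‖) := by
      ext x
      rw [congrFun e x, norm_indicator_eq_indicator_norm]
    rw [e3, integral_indicator (measurableSet_cone i)]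
    refine integral_congr_ae ?_
    filter_upwards [e2] with x hx
    rw [hx]

lemma minkInt_coeffFun (i : Fin 2 × Fin 2) (ψ φ : L2Cone i) (g : PGroup) :
    minkInt (fun x => coeffFun i ψ φ (x, g.2)) g.1 =
      (1 / (2 * Real.pi) : ℝ) * ⟪rep g i φ, ψ⟫_ℂ := by
  rw [minkInt]
  congr 1
  have e : (fun x => Complex.exp (-(Complex.I * mink x g.1)) * coeffFun i ψ φ (x, g.2)) =
      (cone i).indicator (fun x => conj (repFun g φ x) * ψ x) := by
    ext x
    by_cases hx : x ∈ cone i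
    · simp only [coeffFun, hx, if_true, Set.indicator_of_mem, repFun, map_mul, Complex.conj_ofReal,
        ← Complex.exp_conj, Complex.conj_I]
      rw [neg_mul]; ring
    · simp [coeffFun, hx]
  rw [e, integral_indicator (measurableSet_cone i), inner_eq_integral]
  refine integral_congr_ae ?_
  filter_upwards [coeFn_rep g i φ] with x hx
  rw [hx]

/-- At `a Λ_{-θ} x` the Duflo–Moore factor equals `(2π)⁻¹ a |⟨x; x⟩|^{1/2}`. It uses up the orbit
weight `|⟨x; x⟩|^{1/2} a²` and leaves `2π a`, the scalar of the representation. -/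
lemma coneTensor_ae_eq (i : Fin 2 × Fin 2) {φ φ' : L2Cone i} (hφ : IsDuflo i φ φ') (ψ : L2Cone i) :
    coneTensor i ψ (star φ) =ᵐ[haar] fun p => ((2 * Real.pi : ℝ) : ℂ) * coeffFun i ψ φ' p := by
  have h1 := (isWeightedComp_orbit i).coeFn_toIsometry (tensorFun ψ (star φ))
  have h2 := (isWeightedComp_orbit i).congr_ae (coeFn_tensorFun ψ (star φ))
  have h3 := (isWeightedComp_orbit i).ae_comp (ae_snd (μ := coneMeasure i) (Lp.coeFn_star φ))
  have h4 := (isWeightedComp_orbit i).ae_comp (ae_snd (μ := coneMeasure i) hφ)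
  rw [coneTensor_apply]
  filter_upwards [h1, h2, h3, h4] with p e1 e2 e3 e4
  rw [e1, e2]
  by_cases hp : p.1 ∈ cone i
  · have e5 := e3 (orbitWeight_ne_zero hp)
    have e6 := e4 (orbitWeight_ne_zero hp)
    rw [e5, coeffFun, if_pos hp, orbitWeight, if_pos hp]
    simp only [orbitMap] at e6 ⊢
    have ha : 0 < (p.2.1 : ℝ) := p.2.1.2
    rw [e6, mink_dilRotMap, abs_mul, abs_of_pos (pow_pos ha 2), Real.sqrt_mul (by positivity),
      Real.sqrt_sq ha.le]
    simp only [Pi.star_apply, map_mul, Complex.conj_ofReal, RCLike.star_def]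
    push_cast
    have : (Real.pi : ℂ) ≠ 0 := by exact_mod_cast Real.pi_ne_zero
    field_simp
  · rw [coeffFun, if_neg hp, orbitWeight, if_neg hp]; simp

/-- The inverse Minkowski–Fourier transform in the translation variable of the group. -/
def groupMink : L2Group ≃ₗᵢ[ℂ] L2Group := partialMink dilRotMeasure

/-- The coefficients of the representation as a partial Fourier transform. -/
lemma groupMink_coneTensor (i : Fin 2 × Fin 2) {φ φ' : L2Cone i} (hφ : IsDuflo i φ φ')
    (ψ : L2Cone i) :
    groupMink (coneTensor i ψ (star φ)) =ᵐ[haar] fun g => ⟪rep g i φ', ψ⟫_ℂ := by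
  have h1 := coneTensor_ae_eq i hφ ψ
  have hpi : ((2 * Real.pi : ℝ) : ℂ) ≠ 0 := by
    exact_mod_cast (by positivity : (2 * Real.pi : ℝ) ≠ 0)
  have hG : MemLp (coeffFun i ψ φ') 2 haar := by
    refine ((Lp.memLp (coneTensor i ψ (star φ))).const_smul ((2 * Real.pi : ℝ) : ℂ)⁻¹).ae_eq ?_
    filter_upwards [h1] with p hp
    rw [Pi.smul_apply, hp, smul_eq_mul, inv_mul_cancel_left₀ hpi]
  have h2 : coneTensor i ψ (star φ) = ((2 * Real.pi : ℝ) : ℂ) • hG.toLp := by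
    refine Lp.ext ?_
    filter_upwards [h1, hG.coeFn_toLp, Lp.coeFn_smul ((2 * Real.pi : ℝ) : ℂ) hG.toLp]
      with p e1 e2 e3
    rw [e1, e3, Pi.smul_apply, e2, smul_eq_mul]
  have h3 : groupMink hG.toLp =ᵐ[haar] fun p => minkInt (fun x => coeffFun i ψ φ' (x, p.2)) p.1 :=
    partialMink_ae_eq_of_fiber (ν := dilRotMeasure) (measurable_coeffFun i ψ φ') hG _
      (coeffFun_fiber i ψ φ')
  rw [h2, map_smul]
  filter_upwards [h3, Lp.coeFn_smul ((2 * Real.pi : ℝ) : ℂ) (groupMink hG.toLp)]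
    with g e1 e2
  rw [e2, Pi.smul_apply, e1, minkInt_coeffFun, smul_eq_mul, ← mul_assoc, ← Complex.ofReal_mul,
    mul_one_div_cancel (by positivity)]
  simp

/-- The operator with coefficients `⟨coneTensor ψ (star φ), β⟩`. -/
lemma exists_coneOp (i : Fin 2 × Fin 2) (β : L2Group) :
    ∃ B : L2Cone i →L[ℂ] L2Cone i, ∀ ψ φ, ⟪ψ, B φ⟫_ℂ = ⟪coneTensor i ψ (star φ), β⟫_ℂ := by
  refine exists_clm_of_sesq _ ?_ ?_ ?_ ?_ ‖β‖ ?_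
  · intro x x' y
    rw [map_add, _root_.add_apply, inner_add_left]
  · intro x y y'
    rw [star_add_Lp, map_add, inner_add_left]
  · intro c x y
    rw [map_smul, _root_.smul_apply, inner_smul_left]
  · intro c x y
    rw [star_smul_Lp, map_smul, inner_smul_left, Complex.conj_conj]
  · intro x y
    refine (norm_inner_le_norm _ _).trans (le_of_eq ?_)
    rw [norm_coneTensor, norm_star_Lp]; ring

/-- The operator with coefficients `⟨coneTensor (star φ) ψ, β⟩`. -/
lemma exists_coneOp' (i : Fin 2 × Fin 2) (β : L2Group) :
    ∃ B : L2Cone i →L[ℂ] L2Cone i, ∀ ψ φ, ⟪ψ, B φ⟫_ℂ = ⟪coneTensor i (star φ) ψ, β⟫_ℂ := by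
  refine exists_clm_of_sesq _ ?_ ?_ ?_ ?_ ‖β‖ ?_
  · intro x x' y
    rw [map_add, inner_add_left]
  · intro x y y'
    rw [star_add_Lp, map_add, _root_.add_apply, inner_add_left]
  · intro c x y
    rw [map_smul, inner_smul_left]
  · intro c x y
    rw [star_smul_Lp, map_smul, _root_.smul_apply, inner_smul_left, Complex.conj_conj]
  · intro x y
    refine (norm_inner_le_norm _ _).trans (le_of_eq ?_)
    rw [norm_coneTensor, norm_star_Lp]; ring

/-- An operator is determined by its values on the domain of the Duflo–Moore operator. -/
lemma clm_ext_of_isDuflo (i : Fin 2 × Fin 2) {A B : L2Cone i →L[ℂ] L2Cone i}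
    (h : ∀ φ φ', IsDuflo i φ φ' → A φ = B φ) : A = B := by
  set s : Plane → ℝ := fun x => 1 / (2 * Real.pi) * Real.sqrt |mink x x| with hs
  have hs0 : ∀ x, 0 ≤ s x := fun x => by positivity
  have hsm : Measurable s := by
    have : Measurable fun p : Plane => |mink p p| := measurable_mink_self.norm
    simp only [hs]; fun_prop
  suffices hz : ∀ w : L2Cone i, (∀ φ φ', IsDuflo i φ φ' → ⟪w, φ⟫_ℂ = 0) → w = 0 by
    rw [← sub_eq_zero, ← (ContinuousLinearMap.adjoint).map_eq_zero_iff]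
    ext1 ψ
    refine hz _ fun φ φ' hφ => ?_
    rw [ContinuousLinearMap.adjoint_inner_left, _root_.sub_apply, h φ φ' hφ, sub_self,
      inner_zero_right]
  intro w hw
  -- The test vector `w / (1 + s)` lies in the domain because `s / (1 + s) ≤ 1`; its pairing with
  -- `w` is `∫ |w|² / (1 + s)`, whose weight is strictly positive.
  have hm1 : MemLp (fun x => ((1 / (1 + s x) : ℝ) : ℂ) * w x) 2 (coneMeasure i) := by
    refine (Lp.memLp w).of_le ((Complex.measurable_ofReal.comp (by fun_prop)).aestronglyMeasurable.mul
      (Lp.aestronglyMeasurable w)) (Eventually.of_forall fun x => ?_)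
    rw [norm_mul, Complex.norm_real, Real.norm_of_nonneg (by have := hs0 x; positivity)]
    refine mul_le_of_le_one_left (norm_nonneg _) ?_
    rw [div_le_one (by linarith [hs0 x])]
    linarith [hs0 x]
  have hm2 : MemLp (fun x => ((s x / (1 + s x) : ℝ) : ℂ) * w x) 2 (coneMeasure i) := by
    refine (Lp.memLp w).of_le ((Complex.measurable_ofReal.comp (by fun_prop)).aestronglyMeasurable.mul
      (Lp.aestronglyMeasurable w)) (Eventually.of_forall fun x => ?_)
    rw [norm_mul, Complex.norm_real, Real.norm_of_nonneg (by have := hs0 x; positivity)]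
    refine mul_le_of_le_one_left (norm_nonneg _) ?_
    rw [div_le_one (by linarith [hs0 x])]
    linarith [hs0 x]
  have hd : IsDuflo i hm1.toLp hm2.toLp := by
    unfold IsDuflo
    filter_upwards [hm1.coeFn_toLp, hm2.coeFn_toLp] with x h1 h2
    rw [h1, h2, ← mul_assoc, ← Complex.ofReal_mul, mul_one_div]
  have h0 := hw _ _ hd
  have hu := hm1.coeFn_toLp
  rw [inner_eq_integral] at h0
  generalize hm1.toLp = u at h0 hu
  have h1 : ∫ x, conj (w x) * u x ∂coneMeasure i =
      ((∫ x, 1 / (1 + s x) * ‖w x‖ ^ 2 ∂coneMeasure i : ℝ) : ℂ) := by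
    rw [← integral_complex_ofReal]
    refine integral_congr_ae ?_
    filter_upwards [hu] with x hx
    rw [hx, mul_left_comm, RCLike.conj_mul]
    push_cast; rfl
  rw [h1, Complex.ofReal_eq_zero, integral_eq_zero_iff_of_nonneg
    (fun x => by have := hs0 x; positivity)] at h0
  · rw [Lp.eq_zero_iff_ae_eq_zero]
    filter_upwards [h0] with x hx
    have h3 : 0 < 1 / (1 + s x) := by have := hs0 x; positivity
    have h4 : 1 / (1 + s x) * ‖w x‖ ^ 2 = 0 := hx
    have h5 := (mul_eq_zero.1 h4).resolve_left h3.ne'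
    simpa using h5
  · have h6 := (memLp_two_iff_integrable_sq_norm (Lp.aestronglyMeasurable w)).1 (Lp.memLp w)
    refine h6.mono' (by
      exact (Measurable.aestronglyMeasurable (by fun_prop)).mul h6.aestronglyMeasurable)
      (Eventually.of_forall fun x => ?_)
    rw [Real.norm_of_nonneg (by have := hs0 x; positivity)]
    refine mul_le_of_le_one_left (by positivity) ?_
    rw [div_le_one (by linarith [hs0 x])]
    linarith [hs0 x]

/-- The operator with these coefficients satisfies the defining weak integral, by unitarity of
`groupMink` and `groupMink_coneTensor`; density of the Duflo–Moore domain makes it the only one. -/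
lemma inner_groupFourier (f : L2Group) (i : Fin 2 × Fin 2) (ψ φ : L2Cone i) :
    ⟪ψ, groupFourier f i φ⟫_ℂ =
      ⟪coneTensor i ψ (star φ), groupMink.symm f⟫_ℂ := by
  obtain ⟨B, hB⟩ := exists_coneOp i (groupMink.symm f)
  have hBf : IsGroupFourier f i B := by
    intro φ φ' hφ ψ
    rw [hB, ← groupMink.inner_map_map, LinearIsometryEquiv.apply_symm_apply,
      inner_eq_integral]
    refine integral_congr_ae ?_
    filter_upwards [groupMink_coneTensor i hφ ψ] with g hg
    rw [hg, inner_conj_symm, mul_comm]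
  have hspec : IsGroupFourier f i (groupFourier f i) :=
    Classical.epsilon_spec (p := fun B => IsGroupFourier f i B) ⟨B, hBf⟩
  have : groupFourier f i = B := clm_ext_of_isDuflo i fun φ φ' hφ =>
    ext_inner_left ℂ fun ψ => by rw [hspec φ φ' hφ ψ, hBf φ φ' hφ ψ]
  rw [this, hB]

end GroupFourier

end AffPoincare

end

noncomputable section

namespace AffPoincare

open Filter Topology

/-! ### The twisting operator -/

section Twist

/-- The change of variables of the twisting operator. -/
def twistMap (p : Plane × Plane) : Plane × Plane :=
  (p.2 + (1 / 2 : ℝ) • p.1, p.2 - (1 / 2 : ℝ) • p.1)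

/-- The map factors as the shear `(q, x) ↦ (q, x + q/2)`, a swap, and `(y, q) ↦ (y, y - q)`. -/
lemma measurePreserving_twistMap :
    MeasurePreserving twistMap ((volume : Measure Plane).prod volume)
      ((volume : Measure Plane).prod volume) := by
  have h1 : MeasurePreserving (fun p : Plane × Plane => (p.1, p.2 + (1 / 2 : ℝ) • p.1))
      ((volume : Measure Plane).prod volume) ((volume : Measure Plane).prod volume) :=
    (MeasurePreserving.id (volume : Measure Plane)).skew_product
      (g := fun q x : Plane => x + (1 / 2 : ℝ) • q) (by
        have : Continuous (Function.uncurry fun q x : Plane => x + (1 / 2 : ℝ) • q) := by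
          unfold Function.uncurry; fun_prop
        exact this.measurable)
      (Eventually.of_forall fun q => map_add_right_eq_self volume _)
  have h2 : MeasurePreserving (fun p : Plane × Plane => (p.1, p.1 - p.2))
      ((volume : Measure Plane).prod volume) ((volume : Measure Plane).prod volume) :=
    (MeasurePreserving.id (volume : Measure Plane)).skew_product
      (g := fun y q : Plane => y - q) (by
        have : Continuous (Function.uncurry fun y q : Plane => y - q) := by
          unfold Function.uncurry; fun_prop
        exact this.measurable)
      (Eventually.of_forall fun y => (Measure.measurePreserving_sub_left volume y).map_eq)
  have h3 := h2.comp ((Measure.measurePreserving_swap).comp h1)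
  convert h3 using 1
  ext p : 1
  refine Prod.ext rfl ?_
  change p.2 - (1 / 2 : ℝ) • p.1 = p.2 + (1 / 2 : ℝ) • p.1 - p.1
  module

lemma isWeightedComp_of_measurePreserving {Z X : Type*} [MeasurableSpace Z] [MeasurableSpace X]
    {ζ : Measure Z} {μ : Measure X} {Ψ : Z → X} (h : MeasurePreserving Ψ ζ μ) :
    IsWeightedComp ζ μ (fun _ => 1) Ψ where
  measurable_weight := measurable_const
  measurable_map := h.measurable
  map_eq := by simp [h.map_eq]

lemma isWeightedComp_twist : IsWeightedComp ((volume : Measure Plane).prod volume)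
    ((volume : Measure Plane).prod volume) (fun _ => 1) twistMap :=
  isWeightedComp_of_measurePreserving measurePreserving_twistMap

/-- The twisting operator on `L²`. -/
abbrev twistIso : Lp ℂ 2 ((volume : Measure Plane).prod (volume : Measure Plane)) →ₗᵢ[ℂ]
    Lp ℂ 2 ((volume : Measure Plane).prod (volume : Measure Plane)) :=
  isWeightedComp_twist.toIsometry

/-- In dimension two the Jacobian is `s²`. Negative `s` matters: both `x + q/2` and `x - q/2` occur.
-/
lemma isWeightedComp_affine (x : Plane) {s : ℝ} (hs : s ≠ 0) :
    IsWeightedComp (volume : Measure Plane) (volume : Measure Plane) (fun _ => (s : ℂ))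
      (fun q => x + s • q) where
  measurable_weight := measurable_const
  measurable_map := by fun_prop
  map_eq := by
    have h1 : Measure.map (fun q : Plane => x + s • q) volume =
        ENNReal.ofReal (s ^ 2)⁻¹ • (volume : Measure Plane) := by
      have h2 := Measure.map_addHaar_smul (volume : Measure Plane) hs
      have h3 : (fun q : Plane => x + s • q) = (fun z => x + z) ∘ fun q => s • q := rfl
      rw [h3, ← Measure.map_map (by fun_prop) (by fun_prop), h2, Measure.map_smul,
        map_add_left_eq_self, finrank_euclideanSpace_fin, abs_of_nonneg (by positivity)]
    rw [withDensity_const, Measure.map_smul, h1, smul_smul, ← ofReal_norm, Complex.norm_real,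
      ← ENNReal.ofReal_pow (norm_nonneg _), Real.norm_eq_abs, sq_abs,
      ← ENNReal.ofReal_mul (by positivity), mul_inv_cancel₀ (by positivity), ENNReal.ofReal_one,
      one_smul]

lemma integral_norm_sq_affine (u : L2Plane) (x : Plane) {s : ℝ} (hs : s ≠ 0) :
    MemLp (fun q => (s : ℂ) * u (x + s • q)) 2 volume ∧
      ∫ q, ‖(s : ℂ) * u (x + s • q)‖ ^ 2 = ‖u‖ ^ 2 := by
  have h := isWeightedComp_affine x hs
  refine ⟨(h.memLp (Lp.memLp u)).1, ?_⟩
  rw [← h.toIsometry.norm_map, ← integral_norm_sq_Lp]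
  refine integral_congr_ae ?_
  filter_upwards [h.coeFn_toIsometry u] with q hq
  rw [hq]

end Twist

/-! ### Weyl transforms as integral operators -/

section Wigner

/-- The conjugate of the integrand of the Wigner transform. -/
def wignerFun (u v : L2Plane) (p : Plane × Plane) : ℂ :=
  conj (u (p.2 + (1 / 2 : ℝ) • p.1)) * v (p.2 - (1 / 2 : ℝ) • p.1)

lemma measurable_wignerFun (u v : L2Plane) : Measurable (wignerFun u v) := by
  have h1 : Measurable u := (Lp.stronglyMeasurable u).measurable
  have h2 : Measurable v := (Lp.stronglyMeasurable v).measurable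
  have h3 := measurePreserving_twistMap.measurable
  exact (Complex.continuous_conj.measurable.comp (h1.comp (measurable_fst.comp h3))).mul
    (h2.comp (measurable_snd.comp h3))

lemma twistIso_tensorFun (u v : L2Plane) :
    twistIso (tensorFun (star u) v) =ᵐ[(volume : Measure Plane).prod volume] wignerFun u v := by
  refine (isWeightedComp_twist.coeFn_toIsometry _).trans
    ((isWeightedComp_twist.congr_ae (k' := fun p => conj (u p.1) * v p.2) ?_).trans
      (Eventually.of_forall fun p => by simp [twistMap, wignerFun]))
  filter_upwards [coeFn_tensorFun (star u) v, ae_fst (Lp.coeFn_star u)] with p h1 h2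
  rw [h1, h2]; rfl

lemma wignerFun_fiber (u v : L2Plane) (x : Plane) :
    Integrable (fun q => wignerFun u v (q, x)) ∧
      ∫ q, ‖wignerFun u v (q, x)‖ ≤ 2 * (‖u‖ ^ 2 + ‖v‖ ^ 2) := by
  obtain ⟨a1, a2⟩ := integral_norm_sq_affine u x (s := 1 / 2) (by norm_num)
  obtain ⟨b1, b2⟩ := integral_norm_sq_affine v x (s := -(1 / 2)) (by norm_num)
  obtain ⟨c1, c2⟩ := integrable_mul_and_bound a1.star b1
  -- The weights `1/2` and `-1/2` multiply to `-1/4`; removing this factor turns the bound `(‖u‖² +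
  -- ‖v‖²) / 2` into `2 (‖u‖² + ‖v‖²)`.
  have hn : ∀ q, star (fun q => ((1 / 2 : ℝ) : ℂ) * u (x + (1 / 2 : ℝ) • q)) q *
      (((-(1 / 2) : ℝ) : ℂ) * v (x + (-(1 / 2) : ℝ) • q)) = -(1 / 4) * wignerFun u v (q, x) := by
    intro q
    simp only [wignerFun, Pi.star_apply, RCLike.star_def, map_mul, Complex.conj_ofReal, neg_smul,
      ← sub_eq_add_neg]
    push_cast; ring
  have a3 : ∫ q, ‖star (fun q => ((1 / 2 : ℝ) : ℂ) * u (x + (1 / 2 : ℝ) • q)) q‖ ^ 2 = ‖u‖ ^ 2 := by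
    rw [← a2]
    exact integral_congr_ae (Eventually.of_forall fun q => by
      simp only [Pi.star_apply, norm_star])
  rw [a3, b2] at c2
  simp only [hn] at c1 c2
  constructor
  · refine (c1.const_mul (-4)).congr (Eventually.of_forall fun q => ?_)
    simp only
    ring
  · have h4 : ∀ q, ‖-(1 / 4 : ℂ) * wignerFun u v (q, x)‖ = 1 / 4 * ‖wignerFun u v (q, x)‖ := by
      intro q
      rw [norm_mul]; norm_num
    simp only [h4] at c2
    rw [integral_const_mul] at c2
    linarith

lemma partialMink_wignerFun (u v : L2Plane) :
    partialMink volume (twistIso (tensorFun (star u) v)) =ᵐ[(volume : Measure Plane).prod volume]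
      fun p => minkInt (fun q => wignerFun u v (q, p.2)) p.1 := by
  have hG : MemLp (wignerFun u v) 2 ((volume : Measure Plane).prod volume) :=
    (Lp.memLp _).ae_eq (twistIso_tensorFun u v)
  have h : twistIso (tensorFun (star u) v) = hG.toLp := by
    refine Lp.ext ((twistIso_tensorFun u v).trans hG.coeFn_toLp.symm)
  rw [h]
  exact partialMink_ae_eq_of_fiber (measurable_wignerFun u v) hG _ (wignerFun_fiber u v)

lemma reflPt_eq (ξ : Plane) : !₂[-ξ 0, ξ 1] = scaledRefl (-1) ξ := by
  ext k
  fin_cases k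
  · simp [scaledRefl_apply_zero]
  · simp [scaledRefl_apply_one]

/-- Explains the reflected variable `ξ̃`: `⟨q; ξ̃⟩ = -ξ · q`, so it converts the Minkowski phase
into the Euclidean one, with the sign that conjugation requires. -/
lemma conj_wigner (u v : L2Plane) (x ξ : Plane) :
    wigner u v x ξ = conj (minkInt (fun q => wignerFun u v (q, x)) (scaledRefl (-1) ξ)) := by
  rw [wigner, minkInt, map_mul, Complex.conj_ofReal, ← integral_conj]
  congr 1
  refine integral_congr_ae (Eventually.of_forall fun q => ?_)
  have h : mink q (scaledRefl (-1) ξ) = -⟪ξ, q⟫_ℝ := by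
    simp [mink, scaledRefl_apply_zero, scaledRefl_apply_one, PiLp.inner_apply, Fin.sum_univ_two]
    ring
  simp only [wignerFun, map_mul, ← Complex.exp_conj, map_neg, Complex.conj_I, Complex.conj_ofReal,
    Complex.conj_conj, h]
  push_cast
  rw [← mul_assoc]
  ring_nf

lemma measurePreserving_reflSwap :
    MeasurePreserving (fun p : Plane × Plane => (scaledRefl (-1) p.2, p.1))
      ((volume : Measure Plane).prod volume) ((volume : Measure Plane).prod volume) := by
  have h1 : MeasurePreserving (scaledRefl (-1)) (volume : Measure Plane) volume := by
    refine ⟨(scaledRefl (-1)).continuous_of_finiteDimensional.measurable, ?_⟩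
    have hdet : LinearMap.det (scaledRefl (-1)) ≠ 0 := by rw [det_scaledRefl]; simp
    rw [Measure.map_linearMap_addHaar_eq_smul_addHaar (volume : Measure Plane) hdet, det_scaledRefl]
    simp
  exact (h1.prod (MeasurePreserving.id volume)).comp Measure.measurePreserving_swap

variable {K : Plane → Plane → ℂ}

/-- The Weyl symbol of a kernel. -/
def kernelSymbol (K : Plane → Plane → ℂ) (x ξ : Plane) : ℂ :=
  partialFourierInv (volume : Measure Plane)
    (fun p : Plane × Plane => twist K p.2 p.1) (!₂[-ξ 0, ξ 1], x)

lemma integral_reflSwap_mul_wigner {P : Plane × Plane → ℂ}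
    (hP : AEStronglyMeasurable P ((volume : Measure Plane).prod volume)) (u v : L2Plane) :
    ∫ p : Plane × Plane, P (!₂[-p.2 0, p.2 1], p.1) * wigner u v p.1 p.2 =
      ∫ p, P p * conj (minkInt (fun q => wignerFun u v (q, p.2)) p.1)
        ∂((volume : Measure Plane).prod volume) := by
  have hfm : AEStronglyMeasurable
      (fun p => P p * conj (minkInt (fun q => wignerFun u v (q, p.2)) p.1))
      ((volume : Measure Plane).prod volume) :=
    hP.mul (Complex.continuous_conj.comp_aestronglyMeasurable
      (stronglyMeasurable_minkInt_fiber (measurable_wignerFun u v)).aestronglyMeasurable)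
  have h3 := measurePreserving_reflSwap
  rw [← h3.map_eq] at hfm
  have h4 := integral_map h3.measurable.aemeasurable hfm
  rw [h3.map_eq] at h4
  rw [h4, Measure.volume_eq_prod]
  refine integral_congr_ae (Eventually.of_forall fun p => ?_)
  simp only [conj_wigner, reflPt_eq]

lemma twistIso_kernel {k : Lp ℂ 2 ((volume : Measure Plane).prod (volume : Measure Plane))}
    (hk : k =ᵐ[(volume : Measure Plane).prod volume] fun p : Plane × Plane => K p.1 p.2) :
    twistIso k =ᵐ[(volume : Measure Plane).prod volume]
      fun p : Plane × Plane => twist K p.2 p.1 := by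
  refine (isWeightedComp_twist.coeFn_toIsometry _).trans
    ((isWeightedComp_twist.congr_ae hk).trans (Eventually.of_forall fun p => ?_))
  simp [twistMap, twist]

lemma partialFourierInv_twist
    {k : Lp ℂ 2 ((volume : Measure Plane).prod (volume : Measure Plane))}
    (hk : k =ᵐ[(volume : Measure Plane).prod volume] fun p : Plane × Plane => K p.1 p.2) :
    partialFourierInv (volume : Measure Plane) (fun p : Plane × Plane => twist K p.2 p.1)
      =ᵐ[(volume : Measure Plane).prod volume] partialMink volume (twistIso k) ∧
    AEStronglyMeasurable
      (partialFourierInv (volume : Measure Plane) (fun p : Plane × Plane => twist K p.2 p.1))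
      ((volume : Measure Plane).prod volume) := by
  have h1 := twistIso_kernel hk
  have hT : MemLp (fun p : Plane × Plane => twist K p.2 p.1) 2
      ((volume : Measure Plane).prod volume) := (Lp.memLp _).ae_eq h1
  have hTe : hT.toLp = twistIso k := Lp.ext (hT.coeFn_toLp.trans h1.symm)
  obtain ⟨hP, hPe⟩ := partialFourierInv_ae_eq hT
  rw [hTe] at hPe
  exact ⟨hPe, hP.1⟩

/-- The Moyal identity: symbol and Wigner transform arise from `K` and a tensor by the same two
isometries, twisting and the partial transform, which therefore drop out of the pairing. -/
lemma integral_kernelSymbol_mul_wigner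
    {k : Lp ℂ 2 ((volume : Measure Plane).prod (volume : Measure Plane))}
    (hk : k =ᵐ[(volume : Measure Plane).prod volume] fun p : Plane × Plane => K p.1 p.2)
    (u v : L2Plane) :
    ∫ p : Plane × Plane, kernelSymbol K p.1 p.2 * wigner u v p.1 p.2 =
      ⟪tensorFun (star u) v, k⟫_ℂ := by
  obtain ⟨hPe, hP⟩ := partialFourierInv_twist hk
  refine (integral_reflSwap_mul_wigner hP u v).trans ?_
  have h1 := partialMink_wignerFun u v
  have e : ⟪tensorFun (star u) v, k⟫_ℂ = ⟪partialMink volume (twistIso (tensorFun (star u) v)),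
      partialMink volume (twistIso k)⟫_ℂ := by
    rw [LinearIsometryEquiv.inner_map_map, LinearIsometry.inner_map_map]
  rw [e, inner_eq_integral]
  generalize partialMink volume (twistIso (tensorFun (star u) v)) = F at h1
  generalize partialMink volume (twistIso k) = G at hPe
  refine integral_congr_ae ?_
  filter_upwards [hPe, h1] with p e1 e2
  rw [e2, ← e1, mul_comm]

/-- The right-hand side is a bounded sesquilinear form, so a Weyl transform exists, and its defining
formula fixes every matrix entry of the chosen one. -/
lemma inner_weyl_kernelSymbol
    {k : Lp ℂ 2 ((volume : Measure Plane).prod (volume : Measure Plane))}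
    (hk : k =ᵐ[(volume : Measure Plane).prod volume] fun p : Plane × Plane => K p.1 p.2)
    (u v : L2Plane) :
    ⟪v, weyl (kernelSymbol K) u⟫_ℂ =
      (1 / (2 * Real.pi) : ℝ) * ⟪tensorFun (star u) v, k⟫_ℂ := by
  obtain ⟨W, hW⟩ : ∃ W : L2Plane →L[ℂ] L2Plane, ∀ v u, ⟪v, W u⟫_ℂ =
      (1 / (2 * Real.pi) : ℝ) * ⟪tensorFun (star u) v, k⟫_ℂ := by
    refine exists_clm_of_sesq _ ?_ ?_ ?_ ?_ (1 / (2 * Real.pi) * ‖k‖) ?_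
    · intro x x' y
      rw [← tensorL_apply, map_add, inner_add_left, mul_add]; rfl
    · intro x y y'
      rw [← tensorL_apply, star_add_Lp, map_add, _root_.add_apply, inner_add_left, mul_add]; rfl
    · intro c x y
      rw [← tensorL_apply, map_smul, inner_smul_left, mul_left_comm]; rfl
    · intro c x y
      rw [← tensorL_apply, star_smul_Lp, map_smul, _root_.smul_apply, inner_smul_left,
        Complex.conj_conj, mul_left_comm]; rfl
    · intro x y
      rw [norm_mul, Complex.norm_real, Real.norm_of_nonneg (by positivity), mul_assoc, mul_assoc]
      gcongr
      refine (norm_inner_le_norm _ _).trans (le_of_eq ?_)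
      rw [norm_tensorFun, norm_star_Lp]; ring
  have hWW : IsWeyl (kernelSymbol K) W := fun u v => by
    rw [hW, integral_kernelSymbol_mul_wigner hk]
  have hspec : IsWeyl (kernelSymbol K) (weyl (kernelSymbol K)) :=
    Classical.epsilon_spec (p := fun W => IsWeyl (kernelSymbol K) W) ⟨W, hWW⟩
  rw [hspec, ← hWW, hW]

end Wigner

/-! ### The kernels `K_{g,β}` on the cones -/

section KernelOf

lemma prod_restrict_cone (i : Fin 2 × Fin 2) :
    (coneMeasure i).prod (coneMeasure i) =
      ((volume : Measure Plane).prod volume).restrict (cone i ×ˢ cone i) :=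
  Measure.prod_restrict _ _

/-- The scalar factor of the kernels. -/
def kernelConst (g : PGroup) : ℝ := (modular g) ^ (1 / 2 : ℝ) / (2 * Real.pi)

lemma kernelOf_ae_eq (g : PGroup) (α : L2Group) (i : Fin 2 × Fin 2) :
    (fun p : Plane × Plane => kernelOf g α p.1 p.2) =ᵐ[(coneMeasure i).prod (coneMeasure i)]
      ((kernelConst g : ℂ) • kernelIso i (coneRestrict i (groupMink α)) :
        Lp ℂ 2 ((coneMeasure i).prod (coneMeasure i))) := by
  have h0 := (partialFourierInv_ae_eq (ν := dilRotMeasure) (Lp.memLp α)).2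
  have h1 : partialFourierInv dilRotMeasure α =ᵐ[haar] groupMink α := by
    have e : (Lp.memLp α).toLp = α := Lp.toLp_coeFn α (Lp.memLp α)
    have h2 : partialFourierInv dilRotMeasure α =ᵐ[haar] groupMink (Lp.memLp α).toLp := h0
    rwa [e] at h2
  have h2 : partialFourierInv dilRotMeasure α =ᵐ[(coneMeasure i).prod dilRotMeasure]
      coneRestrict i (groupMink α) := by
    have h2 : ∀ F : PGroup → ℂ, (∀ᵐ p ∂haar, p.1 ∈ cone i → F p = groupMink α p) →
        partialFourierInv dilRotMeasure α =ᵐ[(coneMeasure i).prod dilRotMeasure] F := by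
      intro F hF
      rw [prod_coneMeasure, EventuallyEq, ae_restrict_iff' (measurableSet_coneProd i)]
      filter_upwards [h1, hF] with p e1 e2 hp
      rw [e1, e2 hp.1]
    exact h2 _ (coeFn_coneRestrict i (groupMink α))
  have h3 := (isWeightedComp_kernel i).congr_ae h2
  have h4 := (isWeightedComp_kernel i).coeFn_toIsometry (coneRestrict i (groupMink α))
  have h5 : ∀ᵐ p ∂((coneMeasure i).prod (coneMeasure i)), p ∈ cone i ×ˢ cone i := by
    rw [prod_restrict_cone]
    exact ae_restrict_mem ((measurableSet_cone i).prod (measurableSet_cone i))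
  filter_upwards [h3, h4, h5, Lp.coeFn_smul (kernelConst g : ℂ)
    (kernelIso i (coneRestrict i (groupMink α)))] with p e3 e4 e5 e6
  rw [e6, Pi.smul_apply, e4, ← e3, kernelOf, dif_pos ⟨i, e5⟩, kernelMap, coneParam_eq ⟨i, e5⟩,
    kernelWeight, kernelConst, smul_eq_mul, ← mul_assoc, ← Complex.ofReal_mul]

lemma kernelOf_eq_zero (g : PGroup) (α : L2Group) {x ξ : Plane}
    (h : ¬∃ i, x ∈ cone i ∧ ξ ∈ cone i) : kernelOf g α x ξ = 0 := dif_neg h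

/-- The kernel is the sum of its restrictions to the four disjoint sets `C × C`, each square
integrable by the isometry `kernelIso`. -/
lemma memLp_kernelOf (g : PGroup) (α : L2Group) :
    MemLp (fun p : Plane × Plane => kernelOf g α p.1 p.2) 2
      ((volume : Measure Plane).prod volume) := by
  have h1 : ∀ i, MemLp ((cone i ×ˢ cone i).indicator fun p : Plane × Plane => kernelOf g α p.1 p.2) 2
      ((volume : Measure Plane).prod volume) := by
    intro i
    rw [memLp_indicator_iff_restrict ((measurableSet_cone i).prod (measurableSet_cone i)),
      ← prod_restrict_cone]
    exact (Lp.memLp _).ae_eq (kernelOf_ae_eq g α i).symm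
  have h2 : (fun p : Plane × Plane => kernelOf g α p.1 p.2) = fun p => ∑ i,
      (cone i ×ˢ cone i).indicator (fun p : Plane × Plane => kernelOf g α p.1 p.2) p := by
    ext p
    by_cases h : ∃ i, p.1 ∈ cone i ∧ p.2 ∈ cone i
    · obtain ⟨i, hi⟩ := h
      rw [Finset.sum_eq_single i, Set.indicator_of_mem (show p ∈ cone i ×ˢ cone i from hi)]
      · intro j _ hj
        exact Set.indicator_of_notMem (fun hp => hj (cone_disjoint hp.1 hi.1)) _
      · simp
    · rw [kernelOf_eq_zero g α h, Finset.sum_eq_zero]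
      intro i _
      exact Set.indicator_of_notMem (fun hp : p ∈ cone i ×ˢ cone i => h ⟨i, hp⟩) _
  rw [h2]
  exact memLp_finsetSum _ fun i _ => h1 i

/-- Restriction of a function on the plane to a cone. -/
def planeRestrict (i : Fin 2 × Fin 2) (v : L2Plane) : L2Cone i := ((Lp.memLp v).restrict _).toLp

lemma coeFn_planeRestrict (i : Fin 2 × Fin 2) (v : L2Plane) :
    planeRestrict i v =ᵐ[coneMeasure i] v := ((Lp.memLp v).restrict _).coeFn_toLp

lemma coeFn_zeroExt (i : Fin 2 × Fin 2) (φ : L2Cone i) :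
    zeroExt i φ =ᵐ[volume] (cone i).indicator φ := MemLp.coeFn_toLp _

lemma inner_zeroExt (i : Fin 2 × Fin 2) (v : L2Plane) (φ : L2Cone i) :
    ⟪v, zeroExt i φ⟫_ℂ = ⟪planeRestrict i v, φ⟫_ℂ := by
  rw [inner_eq_integral, inner_eq_integral, ← integral_indicator (measurableSet_cone i)]
  have h := coeFn_planeRestrict i v
  rw [EventuallyEq, ae_restrict_iff' (measurableSet_cone i)] at h
  refine integral_congr_ae ?_
  filter_upwards [h, coeFn_zeroExt i φ] with x e1 e2
  rw [e2]
  by_cases hx : x ∈ cone i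
  · rw [Set.indicator_of_mem hx, Set.indicator_of_mem hx, e1 hx]
  · rw [Set.indicator_of_notMem hx, Set.indicator_of_notMem hx, mul_zero]

lemma planeRestrict_zeroExt (i : Fin 2 × Fin 2) (φ : L2Cone i) :
    planeRestrict i (zeroExt i φ) = φ := by
  have h : zeroExt i φ =ᵐ[coneMeasure i] (cone i).indicator φ :=
    ae_restrict_of_ae (coeFn_zeroExt i φ)
  refine Lp.ext ((coeFn_planeRestrict i _).trans (h.trans ?_))
  filter_upwards [ae_restrict_mem (measurableSet_cone i)] with x hx
  exact Set.indicator_of_mem hx _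

/-- Since the kernel vanishes across different cones, support of `φ` in a cone also cuts `v` down to
that cone; the rest is the adjoint relation `inner_orbitIso`. -/
lemma inner_tensorFun_kernelOf (g : PGroup) (α : L2Group) (i : Fin 2 × Fin 2) (φ : L2Cone i)
    (v : L2Plane)
    {k : Lp ℂ 2 ((volume : Measure Plane).prod (volume : Measure Plane))}
    (hk : k =ᵐ[(volume : Measure Plane).prod volume] fun p => kernelOf g α p.1 p.2) :
    ⟪tensorFun (star (zeroExt i φ)) v, k⟫_ℂ =
      kernelConst g * ⟪coneTensor i (star φ) (planeRestrict i v), groupMink α⟫_ℂ := by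
  rw [coneTensor_apply, inner_orbitIso, ← inner_smul_right, inner_eq_integral, inner_eq_integral]
  have hs : MeasurableSet (cone i ×ˢ cone i) := (measurableSet_cone i).prod (measurableSet_cone i)
  set F : Plane × Plane → ℂ := fun p => φ p.1 * conj (v p.2) * kernelOf g α p.1 p.2 with hF
  have hL : ∫ p, conj (tensorFun (star (zeroExt i φ)) v p) * k p
      ∂((volume : Measure Plane).prod volume) =
      ∫ p, (cone i ×ˢ cone i).indicator F p ∂((volume : Measure Plane).prod volume) := by
    refine integral_congr_ae ?_
    filter_upwards [coeFn_tensorFun (star (zeroExt i φ)) v, hk,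
      ae_fst (Lp.coeFn_star (zeroExt i φ)), ae_fst (coeFn_zeroExt i φ)] with p e1 e2 e3 e4
    rw [e1, e2, e3, Pi.star_apply, e4]
    by_cases h1 : p.1 ∈ cone i
    · rw [Set.indicator_of_mem h1]
      by_cases h2 : p.2 ∈ cone i
      · rw [Set.indicator_of_mem (show p ∈ cone i ×ˢ cone i from ⟨h1, h2⟩)]
        simp [hF]
      · rw [Set.indicator_of_notMem (fun h : p ∈ cone i ×ˢ cone i => h2 h.2), kernelOf_eq_zero,
          mul_zero]
        rintro ⟨j, hj1, hj2⟩
        rw [cone_disjoint h1 hj1] at h2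
        exact h2 hj2
    · rw [Set.indicator_of_notMem h1,
        Set.indicator_of_notMem (fun h : p ∈ cone i ×ˢ cone i => h1 h.1)]
      simp
  rw [hL, integral_indicator hs, ← prod_restrict_cone]
  refine integral_congr_ae ?_
  filter_upwards [kernelOf_ae_eq g α i, coeFn_tensorFun (star φ) (planeRestrict i v),
    ae_fst (Lp.coeFn_star φ), ae_snd (coeFn_planeRestrict i v)] with p e1 e2 e3 e4
  rw [← e1, e2, e3, e4]
  simp [hF]

/-- The Weyl transforms of the theorem in terms of coefficients on the group. -/
lemma inner_weyl_zeroExt (g : PGroup) (α : L2Group) (i : Fin 2 × Fin 2) (φ : L2Cone i)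
    (v : L2Plane) :
    ⟪v, weyl (weylSymbol g α) (zeroExt i φ)⟫_ℂ = ((1 / (2 * Real.pi) * kernelConst g : ℝ) : ℂ) *
      ⟪coneTensor i (star φ) (planeRestrict i v), groupMink α⟫_ℂ := by
  have hk := (memLp_kernelOf g α).coeFn_toLp
  have h := inner_weyl_kernelSymbol (K := kernelOf g α) hk (zeroExt i φ) v
  rw [inner_tensorFun_kernelOf g α i φ v hk, ← mul_assoc, ← Complex.ofReal_mul] at h
  exact h

/-- The condition of the theorem on one cone in terms of coefficients. -/
lemma zeroExt_eq_weyl_iff (g : PGroup) (α : L2Group) (i : Fin 2 × Fin 2)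
    (A : L2Cone i →L[ℂ] L2Cone i) :
    (∀ φ, zeroExt i (A φ) = weyl (weylSymbol g α) (zeroExt i φ)) ↔
      ∀ ψ φ, ⟪ψ, A φ⟫_ℂ = ((1 / (2 * Real.pi) * kernelConst g : ℝ) : ℂ) *
        ⟪coneTensor i (star φ) ψ, groupMink α⟫_ℂ := by
  constructor
  · intro h ψ φ
    rw [← planeRestrict_zeroExt i ψ, ← inner_zeroExt, h, inner_weyl_zeroExt]
  · intro h φ
    refine ext_inner_left ℂ fun v => ?_
    rw [inner_zeroExt, h, inner_weyl_zeroExt]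

end KernelOf

end AffPoincare

end

noncomputable section

namespace AffPoincare

open Filter Topology

/-! ### Countable bases and pairing with weakly continuous maps -/

section Preliminaries

variable {H : Type*} [NormedAddCommGroup H] [InnerProductSpace ℂ H] [CompleteSpace H]

/-- Distinct basis vectors lie at distance `√2`, so the balls of radius `1/2` around them are
disjoint. -/
lemma HilbertBasis.countable [TopologicalSpace.SeparableSpace H] {ι : Type*}
    (b : HilbertBasis ι ℂ H) : Countable ι := by
  refine Pairwise.countable_of_isOpen_disjoint (s := fun i => Metric.ball (b i) (1 / 2))
    (fun i j hij => ?_) (fun i => Metric.isOpen_ball)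
    fun i => Metric.nonempty_ball.2 (by norm_num)
  refine Metric.ball_disjoint_ball ?_
  have h := norm_sub_sq (𝕜 := ℂ) (b i) (b j)
  rw [b.orthonormal.2 hij, b.orthonormal.1 i, b.orthonormal.1 j] at h
  rw [dist_eq_norm]
  simp only [map_zero, mul_zero, sub_zero] at h
  nlinarith [norm_nonneg (b i - b j)]

lemma HilbertBasis.exists_comp_equiv {ι κ : Type*} (b : HilbertBasis ι ℂ H) (e : κ ≃ ι) :
    ∃ c : HilbertBasis κ ℂ H, ∀ k, c k = b (e k) := by
  refine ⟨HilbertBasis.mk (b.orthonormal.comp e e.injective) ?_, fun k => by simp⟩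
  rw [e.surjective.range_comp]
  exact b.dense_span.ge

/-- Local boundedness of `F` absorbs the norm-continuous variation of `G`. -/
lemma WeaklyContinuous.continuous_inner {X : Type*} [TopologicalSpace X] [LocallyCompactSpace X]
    {F G : X → H} (hF : WeaklyContinuous F) (hG : Continuous G) :
    Continuous fun x => ⟪G x, F x⟫_ℂ := by
  refine continuous_iff_continuousAt.2 fun x₀ => ?_
  obtain ⟨C, hC⟩ := hF.locally_bounded x₀
  have h1 : Tendsto (fun x => ⟪G x - G x₀, F x⟫_ℂ) (𝓝 x₀) (𝓝 0) := by
    have h2 : Tendsto (fun x => ‖G x - G x₀‖ * C) (𝓝 x₀) (𝓝 0) := by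
      have : Continuous fun x => ‖G x - G x₀‖ * C := by fun_prop
      simpa using this.tendsto x₀
    refine squeeze_zero_norm' ?_ h2
    filter_upwards [hC] with x hx
    exact (norm_inner_le_norm _ _).trans (by gcongr)
  have h3 := h1.add ((hF (G x₀)).tendsto x₀)
  rw [zero_add] at h3
  refine h3.congr fun x => ?_
  rw [inner_sub_left]; ring

end Preliminaries

/-! ### Vectors of `L²(ℙ)` as families of Hilbert–Schmidt operators -/

section Coefficients

/-- A family of sesquilinear maps carrying the fixed orthonormal bases on the cones to an
orthonormal basis of `L²` of the group. -/
structure IsCoeffSystem (T : ∀ i, L2Cone i → L2Cone i → L2Group) : Prop where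
  exists_basis : ∃ B : HilbertBasis (Σ i, onbIndex (L2Cone i) × onbIndex (L2Cone i)) ℂ L2Group,
    ∀ i m n, B ⟨i, m, n⟩ = T i (onb _ m) (onb _ n)
  exists_op : ∀ i β, ∃ A : L2Cone i →L[ℂ] L2Cone i, ∀ ψ φ, ⟪ψ, A φ⟫_ℂ = ⟪T i ψ φ, β⟫_ℂ

/-- The vector `β` has the same coefficients as the operators `A`. -/
def IsCoeff (T : ∀ i, L2Cone i → L2Cone i → L2Group) (β : L2Group)
    (A : ∀ i, L2Cone i →L[ℂ] L2Cone i) : Prop :=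
  ∀ i ψ φ, ⟪T i ψ φ, β⟫_ℂ = ⟪ψ, A i φ⟫_ℂ

variable {T : ∀ i, L2Cone i → L2Cone i → L2Group}

lemma tsum_sigma_prod_enorm (c : ∀ i, onbIndex (L2Cone i) → onbIndex (L2Cone i) → ℝ≥0∞) :
    ∑' s : (Σ i, onbIndex (L2Cone i) × onbIndex (L2Cone i)), c s.1 s.2.1 s.2.2 =
      ∑ i, ∑' n, ∑' m, c i m n := by
  rw [ENNReal.tsum_sigma' fun s : (Σ i, onbIndex (L2Cone i) × onbIndex (L2Cone i)) =>
    c s.1 s.2.1 s.2.2, tsum_fintype]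
  refine Finset.sum_congr rfl fun i _ => ?_
  rw [ENNReal.tsum_prod (f := fun m n => c i m n), ENNReal.tsum_comm]

lemma IsCoeffSystem.enorm_sq (hT : IsCoeffSystem T) {β : L2Group}
    {A : ∀ i, L2Cone i →L[ℂ] L2Cone i} (h : IsCoeff T β A) :
    ‖β‖ₑ ^ 2 = ∑ i, hsNormSq (A i) := by
  obtain ⟨B, hB⟩ := hT.exists_basis
  rw [enorm_sq_eq_tsum_inner B]
  have h1 : ∀ s : (Σ i, onbIndex (L2Cone i) × onbIndex (L2Cone i)),
      ‖⟪B s, β⟫_ℂ‖ₑ ^ 2 = ‖⟪onb _ s.2.1, A s.1 (onb _ s.2.2)⟫_ℂ‖ₑ ^ 2 := by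
    rintro ⟨i, m, n⟩
    rw [hB, h]
  rw [tsum_congr h1, tsum_sigma_prod_enorm fun i m n => ‖⟪onb _ m, A i (onb _ n)⟫_ℂ‖ₑ ^ 2]
  exact Finset.sum_congr rfl fun i _ => (hsNormSq_eq_tsum (A i)).symm

lemma IsCoeffSystem.isHilbertSchmidt (hT : IsCoeffSystem T) {β : L2Group}
    {A : ∀ i, L2Cone i →L[ℂ] L2Cone i} (h : IsCoeff T β A) (i) : IsHilbertSchmidt (A i) := by
  have h1 : ∑ i, hsNormSq (A i) < ∞ := by
    rw [← hT.enorm_sq h]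
    exact ENNReal.pow_lt_top enorm_lt_top
  exact (ENNReal.sum_lt_top.1 h1) i (Finset.mem_univ i)

lemma IsCoeffSystem.exists_coeff (hT : IsCoeffSystem T) (β : L2Group) :
    ∃ A, IsCoeff T β A := by
  choose A hA using fun i => hT.exists_op i β
  exact ⟨A, fun i ψ φ => (hA i ψ φ).symm⟩

/-- Riesz–Fischer on the matrix entries. The operators attached to the resulting vector have the
same entries as the given ones, hence agree with them. -/
lemma IsCoeffSystem.exists_vec (hT : IsCoeffSystem T) {A : ∀ i, L2Cone i →L[ℂ] L2Cone i}
    (hA : ∀ i, IsHilbertSchmidt (A i)) : ∃ β, IsCoeff T β A := by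
  obtain ⟨B, hB⟩ := hT.exists_basis
  obtain ⟨β, hβ⟩ := HilbertBasis.exists_of_coeff B
    (fun s => ⟪onb _ s.2.1, A s.1 (onb _ s.2.2)⟫_ℂ) (by
      rw [tsum_sigma_prod_enorm fun i m n => ‖⟪onb _ m, A i (onb _ n)⟫_ℂ‖ₑ ^ 2]
      refine ENNReal.sum_lt_top.2 fun i _ => ?_
      rw [← hsNormSq_eq_tsum]
      exact hA i)
  obtain ⟨C, hC⟩ := hT.exists_coeff β
  have e : A = C := by
    ext1 i
    refine clm_ext_matrix fun m n => ?_
    rw [← hC, ← hB, hβ]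
  exact ⟨β, e ▸ hC⟩

lemma IsCoeffSystem.inner_eq (hT : IsCoeffSystem T) {β γ : L2Group}
    {A C : ∀ i, L2Cone i →L[ℂ] L2Cone i} (hA : IsCoeff T β A) (hC : IsCoeff T γ C) :
    ⟪β, γ⟫_ℂ = ∑ i, opTrace (ContinuousLinearMap.adjoint (A i) ∘L C i) := by
  obtain ⟨B, hB⟩ := hT.exists_basis
  have h := B.hasSum_inner_mul_inner β γ
  rw [← h.tsum_eq, h.summable.tsum_sigma, tsum_fintype]
  refine Finset.sum_congr rfl fun i _ => ?_
  have hA' : IsHilbertSchmidt (ContinuousLinearMap.adjoint (A i)) := by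
    rw [IsHilbertSchmidt, hsNormSq_adjoint]
    exact hT.isHilbertSchmidt hA i
  rw [opTrace_comp hA' (hT.isHilbertSchmidt hC i), ← (Equiv.prodComm _ _).tsum_eq]
  refine tsum_congr fun p => ?_
  obtain ⟨m, n⟩ := p
  simp only [Equiv.prodComm_apply, Prod.swap_prod_mk]
  rw [hB, hC, ContinuousLinearMap.adjoint_inner_right, ← inner_conj_symm β, hA, inner_conj_symm]

/-- The coefficients of the group Fourier transform. -/
def leftCoeff (i : Fin 2 × Fin 2) (ψ φ : L2Cone i) : L2Group := coneTensor i ψ (star φ)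

/-- The coefficients of the integral kernels. -/
def rightCoeff (i : Fin 2 × Fin 2) (ψ φ : L2Cone i) : L2Group := coneTensor i (star φ) ψ

lemma isCoeffSystem_leftCoeff : IsCoeffSystem leftCoeff where
  exists_basis := by
    choose c hc using fun i => exists_hilbertBasis_star (onb (L2Cone i))
    obtain ⟨B, hB⟩ := exists_hilbertBasis_coneTensor (fun i => onb (L2Cone i)) c
    exact ⟨B, fun i m n => by rw [hB, hc]; rfl⟩
  exists_op := exists_coneOp

lemma isCoeffSystem_rightCoeff : IsCoeffSystem rightCoeff where
  exists_basis := by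
    choose c hc using fun i => exists_hilbertBasis_star (onb (L2Cone i))
    obtain ⟨B, hB⟩ := exists_hilbertBasis_coneTensor c (fun i => onb (L2Cone i))
    obtain ⟨B', hB'⟩ := HilbertBasis.exists_comp_equiv B
      (Equiv.sigmaCongrRight fun i => Equiv.prodComm (onbIndex (L2Cone i)) (onbIndex (L2Cone i)))
    refine ⟨B', fun i m n => ?_⟩
    rw [hB']
    change B ⟨i, n, m⟩ = _
    rw [hB, hc]; rfl
  exists_op := exists_coneOp'

lemma continuous_star_L2Cone (i : Fin 2 × Fin 2) : Continuous fun φ : L2Cone i => star φ := by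
  have h : Isometry fun φ : L2Cone i => star φ := by
    refine Isometry.of_dist_eq fun x y => ?_
    have e : star x - star y = star (x - y) := by
      rw [sub_eq_iff_eq_add, ← star_add_Lp, sub_add_cancel]
    rw [dist_eq_norm, dist_eq_norm, e, norm_star_Lp]
  exact h.continuous

lemma continuous_leftCoeff {X : Type*} [TopologicalSpace X] (i : Fin 2 × Fin 2)
    {F G : X → L2Cone i} (hF : Continuous F) (hG : Continuous G) :
    Continuous fun x => leftCoeff i (F x) (G x) :=
  ((coneTensor i).continuous.comp hF).clm_apply ((continuous_star_L2Cone i).comp hG)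

end Coefficients

/-! ### The operator `T_σ` and the function `α` -/

section Main

instance countable_onbIndex_L2Group : Countable (onbIndex L2Group) :=
  haveI : SFinite haar := by unfold haar; infer_instance
  haveI : Fact ((2 : ℝ≥0∞) ≠ ∞) := ⟨by simp⟩
  HilbertBasis.countable (onb L2Group)

lemma scale_pos (g : PGroup) : 0 < (g.2.1 : ℝ) := g.2.1.2

lemma continuous_scale : Continuous fun g : PGroup => (g.2.1 : ℝ) := by fun_prop

lemma modular_rpow_neg_half (g : PGroup) : (modular g) ^ (-(1 / 2) : ℝ) = (g.2.1 : ℝ) := by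
  have h := scale_pos g
  rw [modular, one_div, ← Real.rpow_natCast, ← Real.rpow_neg h.le, ← Real.rpow_mul h.le]
  norm_num

lemma kernelConst_eq (g : PGroup) : kernelConst g = (2 * Real.pi * (g.2.1 : ℝ))⁻¹ := by
  have h := scale_pos g
  have h1 : (modular g) ^ (1 / 2 : ℝ) = (g.2.1 : ℝ)⁻¹ := by
    rw [← modular_rpow_neg_half, Real.rpow_neg (by unfold modular; positivity), inv_inv]
  rw [kernelConst, h1]
  field_simp

variable {σ : OpSymbol}

/-- The operator `π_i^j(g)* D_i^j σ(g, π_i^j)`. -/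
def leftOp (σ : OpSymbol) (g : PGroup) (i : Fin 2 × Fin 2) : L2Cone i →L[ℂ] L2Cone i :=
  repAdj g i ∘L dufloComp i (σ g i)

/-- The operator `D_i^j σ(g, π_i^j) π_i^j(g)*`. -/
def rightOp (σ : OpSymbol) (g : PGroup) (i : Fin 2 × Fin 2) : L2Cone i →L[ℂ] L2Cone i :=
  dufloComp i (σ g i) ∘L repAdj g i

lemma hsNormSq_leftOp (σ : OpSymbol) (g : PGroup) (i : Fin 2 × Fin 2) :
    hsNormSq (leftOp σ g i) = hsNormSq (dufloComp i (σ g i)) := hsNormSq_repAdj_comp _ _ _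

lemma hsNormSq_rightOp (σ : OpSymbol) (g : PGroup) (i : Fin 2 × Fin 2) :
    hsNormSq (rightOp σ g i) = hsNormSq (dufloComp i (σ g i)) := hsNormSq_comp_repAdj _ _ _

lemma IsAdmissible.isHilbertSchmidt_dufloComp (hσ : IsAdmissible σ) (g : PGroup)
    (i : Fin 2 × Fin 2) : IsHilbertSchmidt (dufloComp i (σ g i)) := by
  have h := (hσ.weaklyContinuous i).1 g
  rwa [IsHilbertSchmidt, hsNormSq_repAdj_comp] at h

lemma IsAdmissible.isHilbertSchmidt_leftOp (hσ : IsAdmissible σ) (g : PGroup)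
    (i : Fin 2 × Fin 2) : IsHilbertSchmidt (leftOp σ g i) := (hσ.weaklyContinuous i).1 g

lemma IsAdmissible.isHilbertSchmidt_rightOp (hσ : IsAdmissible σ) (g : PGroup)
    (i : Fin 2 × Fin 2) : IsHilbertSchmidt (rightOp σ g i) := by
  rw [IsHilbertSchmidt, hsNormSq_rightOp]
  exact hσ.isHilbertSchmidt_dufloComp g i

/-- The vector whose inner products give the operator `T_σ`, up to the modular function and a
Fourier transform. -/
def symbolVec (hσ : IsAdmissible σ) (g : PGroup) : L2Group :=
  (isCoeffSystem_leftCoeff.exists_vec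
    (A := fun i => ContinuousLinearMap.adjoint (leftOp σ g i)) fun i => by
      rw [IsHilbertSchmidt, hsNormSq_adjoint]
      exact hσ.isHilbertSchmidt_leftOp g i).choose

lemma isCoeff_symbolVec (hσ : IsAdmissible σ) (g : PGroup) :
    IsCoeff leftCoeff (symbolVec hσ g) fun i => ContinuousLinearMap.adjoint (leftOp σ g i) :=
  (isCoeffSystem_leftCoeff.exists_vec
    (A := fun i => ContinuousLinearMap.adjoint (leftOp σ g i)) fun i => by
      rw [IsHilbertSchmidt, hsNormSq_adjoint]
      exact hσ.isHilbertSchmidt_leftOp g i).choose_spec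

lemma inner_symbolVec (hσ : IsAdmissible σ) (g : PGroup) {x : L2Group}
    {C : ∀ i, L2Cone i →L[ℂ] L2Cone i} (hC : IsCoeff leftCoeff x C) :
    ⟪symbolVec hσ g, x⟫_ℂ = ∑ i, opTrace (leftOp σ g i ∘L C i) := by
  rw [isCoeffSystem_leftCoeff.inner_eq (isCoeff_symbolVec hσ g) hC]
  simp only [ContinuousLinearMap.adjoint_adjoint]

lemma enorm_symbolVec_sq (hσ : IsAdmissible σ) (g : PGroup) :
    ‖symbolVec hσ g‖ₑ ^ 2 = ∑ i, hsNormSq (rightOp σ g i) := by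
  rw [isCoeffSystem_leftCoeff.enorm_sq (isCoeff_symbolVec hσ g)]
  refine Finset.sum_congr rfl fun i _ => ?_
  rw [hsNormSq_adjoint, hsNormSq_leftOp, hsNormSq_rightOp]

/-- An inner product with a fixed vector is a finite sum of traces of `π* D σ` against fixed
Hilbert–Schmidt operators, which the hypothesis makes continuous. -/
lemma weaklyContinuous_symbolVec (hσ : IsAdmissible σ) : WeaklyContinuous (symbolVec hσ) := by
  intro x
  obtain ⟨C, hC⟩ := isCoeffSystem_leftCoeff.exists_coeff x
  have h1 : Continuous fun g => ⟪symbolVec hσ g, x⟫_ℂ := by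
    simp only [inner_symbolVec hσ _ hC]
    refine continuous_finsetSum _ fun i _ => ?_
    have h := (hσ.weaklyContinuous i).2 (ContinuousLinearMap.adjoint (C i)) (by
      rw [IsHilbertSchmidt, hsNormSq_adjoint]
      exact isCoeffSystem_leftCoeff.isHilbertSchmidt hC i)
    simp only [ContinuousLinearMap.adjoint_adjoint] at h
    exact h
  exact (Complex.continuous_conj.comp h1).congr fun g => inner_conj_symm _ _

lemma isCoeff_groupFourier (f : L2Group) :
    IsCoeff leftCoeff (groupMink.symm f) (groupFourier f) :=
  fun i ψ φ => (inner_groupFourier f i ψ φ).symm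

lemma pseudoDiff_eq (hσ : IsAdmissible σ) (f : L2Group) (g : PGroup) :
    pseudoDiff σ f g = ⟪((g.2.1 : ℝ) : ℂ) • groupMink (symbolVec hσ g), f⟫_ℂ := by
  have hf := isCoeff_groupFourier f
  have h1 : ⟪groupMink (symbolVec hσ g), f⟫_ℂ = ⟪symbolVec hσ g, groupMink.symm f⟫_ℂ := by
    rw [← groupMink.inner_map_map (symbolVec hσ g), LinearIsometryEquiv.apply_symm_apply]
  rw [inner_smul_left, Complex.conj_ofReal, h1, inner_symbolVec hσ g hf, pseudoDiff,
    modular_rpow_neg_half]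
  congr 1
  refine Finset.sum_congr rfl fun i _ => ?_
  have hF := isCoeffSystem_leftCoeff.isHilbertSchmidt hf i
  have hD := hσ.isHilbertSchmidt_dufloComp g i
  have hFR : IsHilbertSchmidt (groupFourier f i ∘L repAdj g i) := by
    rw [IsHilbertSchmidt, hsNormSq_comp_repAdj]; exact hF
  -- Cyclicity on both sides: each trace becomes that of `f̂ π* D σ`.
  rw [opTrace_comp_comm hD hFR, opTrace_comp_comm (hσ.isHilbertSchmidt_leftOp g i) hF]
  rfl

theorem isHilbertSchmidtPseudoDiff_iff (hσ : IsAdmissible σ) :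
    IsHilbertSchmidtPseudoDiff σ ↔
      ∫⁻ g, ‖((g.2.1 : ℝ) : ℂ) • groupMink (symbolVec hσ g)‖ₑ ^ 2 ∂haar < ∞ := by
  rw [← exists_hilbertSchmidt_iff_lintegral_lt_top, IsHilbertSchmidtPseudoDiff]
  · simp only [funext (pseudoDiff_eq hσ _)]
  · intro f
    have h1 : Continuous fun g => ⟪groupMink.symm f, symbolVec hσ g⟫_ℂ :=
      weaklyContinuous_symbolVec hσ _
    have h2 : Continuous fun g : PGroup => ⟪((g.2.1 : ℝ) : ℂ) • groupMink (symbolVec hσ g), f⟫_ℂ := by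
      refine ((Complex.continuous_ofReal.comp continuous_scale).mul
        (Complex.continuous_conj.comp h1)).congr fun g => ?_
      rw [inner_smul_left, Complex.conj_ofReal, ← inner_conj_symm _ f,
        ← LinearIsometryEquiv.apply_symm_apply groupMink f, groupMink.inner_map_map,
        LinearIsometryEquiv.apply_symm_apply]
      rfl
    exact h2.aestronglyMeasurable

/-- The condition of the theorem in terms of coefficients. -/
lemma forall_zeroExt_eq_weyl_iff (g : PGroup) (α : L2Group) :
    (∀ (i : Fin 2 × Fin 2) (φ : L2Cone i),
      zeroExt i ((dufloComp i (σ g i) ∘L repAdj g i) φ) =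
        weyl (weylSymbol g α) (zeroExt i φ)) ↔
      IsCoeff rightCoeff (((1 / (2 * Real.pi) * kernelConst g : ℝ) : ℂ) • groupMink α)
        (rightOp σ g) := by
  refine forall_congr' fun i => (zeroExt_eq_weyl_iff g α i (rightOp σ g i)).trans
    (forall_congr' fun ψ => forall_congr' fun φ => ?_)
  rw [inner_smul_right, eq_comm]; rfl

/-- Both norms are Hilbert–Schmidt norms of `D σ`, since composing with `π*` on either side changes
nothing. The scalar on `α` is `((2π)² a)⁻¹`, whence `(2π)⁴`. -/
lemma enorm_sq_of_isCoeff (hσ : IsAdmissible σ) {g : PGroup} {α : L2Group}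
    (h : IsCoeff rightCoeff (((1 / (2 * Real.pi) * kernelConst g : ℝ) : ℂ) • groupMink α)
      (rightOp σ g)) :
    ‖α‖ₑ ^ 2 = ENNReal.ofReal ((2 * Real.pi) ^ 4) *
      ‖((g.2.1 : ℝ) : ℂ) • groupMink (symbolVec hσ g)‖ₑ ^ 2 := by
  have h1 := isCoeffSystem_rightCoeff.enorm_sq h
  rw [← enorm_symbolVec_sq hσ] at h1
  have ha := scale_pos g
  have e : ∀ y : L2Group, ‖y‖ₑ ^ 2 = ENNReal.ofReal (‖y‖ ^ 2) := fun y => by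
    rw [ENNReal.ofReal_pow (norm_nonneg _), ofReal_norm]
  rw [e, e, ENNReal.ofReal_eq_ofReal_iff (by positivity) (by positivity), norm_smul,
    groupMink.norm_map, Complex.norm_real, kernelConst_eq, Real.norm_of_nonneg (by positivity)] at h1
  rw [e, e, ← ENNReal.ofReal_mul (by positivity), norm_smul, groupMink.norm_map, Complex.norm_real,
    Real.norm_of_nonneg ha.le, mul_pow (g.2.1 : ℝ), ← h1]
  congr 1
  field_simp

/-- Conjugation by `π(g)`: `⟨ψ, D σ π* φ⟩ = ⟨π* ψ, (π* D σ) π* φ⟩`, a pairing of a weakly continuous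
map with a norm-continuous one. -/
lemma continuous_inner_rightOp (hσ : IsAdmissible σ) (i : Fin 2 × Fin 2) (ψ φ : L2Cone i) :
    Continuous fun g => ⟪ψ, rightOp σ g i φ⟫_ℂ := by
  have h1 : Continuous fun g => ⟪leftCoeff i (repAdj g i φ) (repAdj g i ψ), symbolVec hσ g⟫_ℂ :=
    (weaklyContinuous_symbolVec hσ).continuous_inner
      (continuous_leftCoeff i (continuous_repAdj i φ) (continuous_repAdj i ψ))
  refine (Complex.continuous_conj.comp h1).congr fun g => ?_
  simp only [Function.comp_apply]
  rw [isCoeff_symbolVec hσ g, ContinuousLinearMap.adjoint_inner_right, inner_conj_symm, leftOp,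
    ContinuousLinearMap.comp_apply, inner_repAdj_left, rep_repAdj]
  rfl

theorem exists_weaklyContinuous_isCoeff (hσ : IsAdmissible σ) :
    ∃ α : PGroup → L2Group, WeaklyContinuous α ∧ ∀ g,
      IsCoeff rightCoeff (((1 / (2 * Real.pi) * kernelConst g : ℝ) : ℂ) • groupMink (α g))
        (rightOp σ g) := by
  choose β hβ using fun g =>
    isCoeffSystem_rightCoeff.exists_vec (hσ.isHilbertSchmidt_rightOp g)
  -- Equality of norms transfers local boundedness from `symbolVec` to `β`, so continuity need only
  -- be checked on basis coefficients.
  have hn : ∀ g, ‖β g‖ = ‖symbolVec hσ g‖ := fun g => by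
    have h := isCoeffSystem_rightCoeff.enorm_sq (hβ g)
    rw [← enorm_symbolVec_sq hσ] at h
    have h2 := (ENNReal.pow_right_strictMono two_ne_zero).injective h
    rw [← toReal_enorm, h2, toReal_enorm]
  have hβc : WeaklyContinuous β := by
    obtain ⟨B, hB⟩ := isCoeffSystem_rightCoeff.exists_basis
    refine weaklyContinuous_of_basis B (fun g => ?_) ?_
    · simp only [hn]
      exact (weaklyContinuous_symbolVec hσ).locally_bounded g
    · rintro ⟨i, m, n⟩
      simp only [hB, hβ _ i]
      exact continuous_inner_rightOp hσ i _ _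
  -- The factor `(2π)² a` cancels `(2π)⁻¹` from the Weyl transform and `(2π a)⁻¹` from the kernel.
  refine ⟨fun g => groupMink.symm ((((2 * Real.pi) ^ 2 * (g.2.1 : ℝ) : ℝ) : ℂ) • β g), ?_, ?_⟩
  · intro x
    have h1 : Continuous fun g : PGroup => (((2 * Real.pi) ^ 2 * (g.2.1 : ℝ) : ℝ) : ℂ) :=
      Complex.continuous_ofReal.comp (continuous_const.mul continuous_scale)
    refine (h1.mul (hβc (groupMink x))).congr fun g => ?_
    rw [← groupMink.inner_map_map x, LinearIsometryEquiv.apply_symm_apply, inner_smul_right]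
    rfl
  · intro g
    have ha := scale_pos g
    rw [LinearIsometryEquiv.apply_symm_apply, smul_smul, ← Complex.ofReal_mul, kernelConst_eq]
    have e : 1 / (2 * Real.pi) * (2 * Real.pi * (g.2.1 : ℝ))⁻¹ *
        ((2 * Real.pi) ^ 2 * (g.2.1 : ℝ)) = 1 := by
      field_simp
    rw [e, Complex.ofReal_one, one_smul]
    exact hβ g

end Main

end AffPoincare

end

theorem mainTheorem2 (σ : OpSymbol) (hσ : IsAdmissible σ) :
    IsHilbertSchmidtPseudoDiff σ ↔
      ∃ α : PGroup → L2Group,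
        WeaklyContinuous α ∧ ∫⁻ g, ‖α g‖ₑ ^ 2 ∂haar < ∞ ∧
          ∀ (g : PGroup) (i : Fin 2 × Fin 2) (φ : L2Cone i),
            zeroExt i ((dufloComp i (σ g i) ∘L repAdj g i) φ) =
              weyl (weylSymbol g (α g)) (zeroExt i φ) := by
  -- Any `α` satisfying the operator identity has the same integral up to the factor `(2π)⁴`, so
  -- this settles both directions.
  have key : ∀ α : PGroup → L2Group,
      (∀ g, IsCoeff rightCoeff (((1 / (2 * Real.pi) * kernelConst g : ℝ) : ℂ) • groupMink (α g))
        (rightOp σ g)) →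
      (∫⁻ g, ‖α g‖ₑ ^ 2 ∂haar < ∞ ↔ IsHilbertSchmidtPseudoDiff σ) := by
    intro α hα
    rw [isHilbertSchmidtPseudoDiff_iff hσ,
      lintegral_congr fun g => enorm_sq_of_isCoeff hσ (hα g),
      lintegral_const_mul' _ _ ENNReal.ofReal_ne_top, ENNReal.mul_lt_top_iff]
    have h0 : ENNReal.ofReal ((2 * Real.pi) ^ 4) ≠ 0 := by
      rw [Ne, ENNReal.ofReal_eq_zero, not_le]
      positivity
    simp only [ENNReal.ofReal_lt_top, true_and, h0, false_or]
    exact ⟨fun h => h.elim id fun h => h ▸ ENNReal.zero_lt_top, Or.inl⟩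
  simp only [forall_zeroExt_eq_weyl_iff]
  constructor
  · intro h
    obtain ⟨α, hα, hα'⟩ := exists_weaklyContinuous_isCoeff hσ
    exact ⟨α, hα, (key α hα').2 h, hα'⟩
  · rintro ⟨α, -, h, hα⟩
    exact (key α hα).1 h
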